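/- Let $K$ be a field (for example $\mathbb{C}$, or $\mathbb{C}(q^{1/2},t^{1/2})$ with formal parameters) and fix $q^{1/2},t^{1/2}\in K^\times$ such that $q^at^b=1$ with $a,b\in\mathbb{Z}$ only for $(a,b)=(0,0)$. Let $\tilde H_{\mathrm{int}}$ be the $K$-algebra generated by $T_1^{\pm1},X^{\pm1},Y^{\pm1},T_\pi^{\pm1}$ with relations $$T_\pi=YT_1^{-1}=T_1Y^{-1},\quad T_\pi XT_\pi^{-1}=q^{1/2}X^{-1},\quad T_1XT_1=X^{-1},\quad T_1Y^{-1}T_1=Y,\quad (T_1-t^{1/2})(T_1+t^{-1/2})=0,$$ and let $\tilde H=K(Y)\otimes_{K[Y,Y^{-1}]}\tilde H_{\mathrm{int}}$ be the algebra obtained by inverting all nonzero Laurent polynomials in $Y$. In $\tilde H$ put $$\mathbf 1_0=T_1+t^{-1/2},\qquad \eta_\pi=XT_1,\qquad \eta_{s_1}=t^{1/2}\frac{1-Y^{-2}}{1-tY^{-2}}\Big(T_1+t^{-1/2}\frac{1-t}{1-Y^{-2}}\Big),\qquad \eta=\eta_\pi\eta_{s_1},\qquad \eta^{-1}=\eta_{s_1}\eta_\pi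 .$$ Let $\tilde H_{\mathrm{int}}\mathbf 1_Y$ be the left $\tilde H_{\mathrm{int}}$-module with one generator $\mathbf 1_Y$ and relations $T_1\mathbf 1_Y=t^{1/2}\mathbf 1_Y$, $T_\pi\mathbf 1_Y=\mathbf 1_Y$. For $m\in\mathbb{Z}$ the electronic (nonsymmetric) Macdonald polynomial $E_m\in K[x,x^{-1}]$ is defined by the conditions that the coefficient of $x^m$ in $E_m$ is $1$ and that $YE_m(X)\mathbf 1_Y=t^{-1/2}q^{-m/2}E_m(X)\mathbf 1_Y$ if $m>0$, and $YE_m(X)\mathbf 1_Y=t^{1/2}q^{-m/2}E_m(X)\mathbf 1_Y$ if $m\le 0$. Let $(z;q)_n=\prod_{i=0}^{n-1}(1-zq^i)$ and, for $0\le j\le\ell$, $$\genfrac[]{0pt}{0}{\ell}{j}_{q,t}=\frac{(q;q)_\ell/(t;q)_\ell}{\frac{(q;q)_j}{(t;q)_j}\cdot\frac{(q;q)_{\ell-j}}{(t;q)_{\ell-j}}},\qquad \genfrac(){0pt}{0}{\ell}{j}_{Y}=\frac{(t^{-1}Y^{-2}q^{-(j-1)};q)_{\ell-j}\,(tY^{-2}q^{\ell-2j};q)_j}{(Y^{-2}q;q)_{\ell-j}\,(Y^{-2}q^{-j};q)_j}.$$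 **Theorem.** For every $m\in\mathbb{Z}$ the polynomial $E_m$ exists and is unique, and $\eta$, $\eta^{-1}$ are mutually inverse in $\tilde H$. Moreover: (1) For $\ell\ge 0$ there are unique $D_0^{(\ell)}(Y),\ldots,D_\ell^{(\ell)}(Y)\in K(Y)$ with $E_{\ell+1}(X)\mathbf 1_0=\sum_{j=0}^{\ell}\eta^{\ell+1-2j}D_j^{(\ell)}(Y)\mathbf 1_0$, namely $$D_j^{(\ell)}(Y)=t^{-\frac12(\ell+1)}\,t^{\ell-j}\genfrac[]{0pt}{0}{\ell}{j}_{q,t}\genfrac(){0pt}{0}{\ell}{j}_{Y}\frac{1-tq^{\ell-j}}{1-tq^\ell}\cdot\frac{1-tY^{-2}q^{\ell-j}}{1-tY^{-2}q^{\ell-2j}}.$$ (2) For $\ell\ge 0$ there are unique $D_0^{(-\ell)}(Y),\ldots,D_\ell^{(-\ell)}(Y)\in K(Y)$ with $E_{-\ell}(X)\mathbf 1_0=\sum_{j=0}^{\ell}\eta^{-\ell+2j}D_j^{(-\ell)}(Y)\mathbf 1_0$, namely $$D_j^{(-\ell)}(Y)=t^{-\frac12\ell}(qt)^j\genfrac[]{0pt}{0}{\ell}{j}_{q,t}\genfrac(){0pt}{0}{\ell}{\ell-j}_{Y}\frac{1-tq^{\ell-j}}{1-tq^\ell}\cdot\frac{1-t^{-1}Y^{-2}q^{-(\ell-j)}}{1-t^{-1}Y^{-2}q^{-(\ell-2j)}}.$$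 (For $\ell=0$ the coefficients in (1) and in (2) are different objects.) (3) For $\ell\ge 1$ there are unique $K_0^{(\ell)}(Y),\ldots,K_\ell^{(\ell)}(Y)\in K(Y)$ with $\mathbf 1_0E_\ell(X)\mathbf 1_0=\sum_{j=0}^{\ell}\mathbf 1_0\eta^{\ell-2j}K_j^{(\ell)}(Y)$, namely $$K_j^{(\ell)}(Y)=t^{-\frac12(\ell-1)}\,t^{\ell-1-j}\genfrac[]{0pt}{0}{\ell}{j}_{q,t}\genfrac(){0pt}{0}{\ell}{j}_{Y}\frac{1-Y^{-2}q^{\ell-2j}}{1-t^{-1}Y^{-2}q^{\ell-2j}}\cdot\frac{1-t^{-1}Y^{-2}}{1-Y^{-2}}.$$ -/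

import Mathlib

noncomputable section

namespace SL2DAHA

variable {K : Type*} [Field K]

/-! Throughout, `qh` and `th` stand for the square roots `q^(1/2)` and `t^(1/2)`. -/

/-! ### The double affine Hecke algebra of type `SL₂` -/

/-- The generators `T₁^{±1}, X^{±1}, Y^{±1}, T_π^{±1}`. -/
inductive Gen : Type
  | T | Tinv | X | Xinv | Y | Yinv | P | Pinv

/-- The defining relations of the double affine Hecke algebra of type `SL₂`. -/
inductive Rel (qh th : K) : FreeAlgebra K Gen → FreeAlgebra K Gen → Prop
  | T_Tinv : Rel qh th (FreeAlgebra.ι K Gen.T * FreeAlgebra.ι K Gen.Tinv) 1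
  | Tinv_T : Rel qh th (FreeAlgebra.ι K Gen.Tinv * FreeAlgebra.ι K Gen.T) 1
  | X_Xinv : Rel qh th (FreeAlgebra.ι K Gen.X * FreeAlgebra.ι K Gen.Xinv) 1
  | Xinv_X : Rel qh th (FreeAlgebra.ι K Gen.Xinv * FreeAlgebra.ι K Gen.X) 1
  | Y_Yinv : Rel qh th (FreeAlgebra.ι K Gen.Y * FreeAlgebra.ι K Gen.Yinv) 1
  | Yinv_Y : Rel qh th (FreeAlgebra.ι K Gen.Yinv * FreeAlgebra.ι K Gen.Y) 1
  | P_Pinv : Rel qh th (FreeAlgebra.ι K Gen.P * FreeAlgebra.ι K Gen.Pinv) 1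
  | Pinv_P : Rel qh th (FreeAlgebra.ι K Gen.Pinv * FreeAlgebra.ι K Gen.P) 1
  | P_eq_Y_Tinv : Rel qh th (FreeAlgebra.ι K Gen.P)
      (FreeAlgebra.ι K Gen.Y * FreeAlgebra.ι K Gen.Tinv)
  | P_eq_T_Yinv : Rel qh th (FreeAlgebra.ι K Gen.P)
      (FreeAlgebra.ι K Gen.T * FreeAlgebra.ι K Gen.Yinv)
  | P_X_Pinv : Rel qh th
      (FreeAlgebra.ι K Gen.P * FreeAlgebra.ι K Gen.X * FreeAlgebra.ι K Gen.Pinv)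
      (qh • FreeAlgebra.ι K Gen.Xinv)
  | T_X_T : Rel qh th
      (FreeAlgebra.ι K Gen.T * FreeAlgebra.ι K Gen.X * FreeAlgebra.ι K Gen.T)
      (FreeAlgebra.ι K Gen.Xinv)
  | T_Yinv_T : Rel qh th
      (FreeAlgebra.ι K Gen.T * FreeAlgebra.ι K Gen.Yinv * FreeAlgebra.ι K Gen.T)
      (FreeAlgebra.ι K Gen.Y)
  | quadratic : Rel qh th
      ((FreeAlgebra.ι K Gen.T - algebraMap K _ th) *
        (FreeAlgebra.ι K Gen.T + algebraMap K _ th⁻¹)) 0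

/-- The (integral) double affine Hecke algebra of type `SL₂` with parameters
`q^(1/2) = qh` and `t^(1/2) = th`. -/
abbrev DAHA (qh th : K) := RingQuot (Rel qh th)

/-- The image of a generator in the double affine Hecke algebra. -/
def gen (qh th : K) (g : Gen) : DAHA qh th :=
  RingQuot.mkAlgHom K (Rel qh th) (FreeAlgebra.ι K g)

/-- `X` as an invertible element of the double affine Hecke algebra. -/
def unitX (qh th : K) : (DAHA qh th)ˣ where
  val := gen qh th Gen.X
  inv := gen qh th Gen.Xinv
  val_inv := by
    have h := RingQuot.mkAlgHom_rel K (Rel.X_Xinv (qh := qh) (th := th))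
    simpa [gen] using h
  inv_val := by
    have h := RingQuot.mkAlgHom_rel K (Rel.Xinv_X (qh := qh) (th := th))
    simpa [gen] using h

/-! ### The polynomial representation and the electronic Macdonald polynomials -/

/-- The left ideal generated by `T₁ - t^(1/2)` and `T_π - 1`. -/
def polyIdeal (qh th : K) : Submodule (DAHA qh th) (DAHA qh th) :=
  Submodule.span (DAHA qh th)
    {gen qh th Gen.T - algebraMap K _ th, gen qh th Gen.P - 1}

/-- The polynomial representation: the left module with one generator `1_Y` and the relations
`T₁ 1_Y = t^(1/2) 1_Y` and `T_π 1_Y = 1_Y`. -/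
abbrev PolyRep (qh th : K) := DAHA qh th ⧸ polyIdeal qh th

/-- The generator `1_Y` of the polynomial representation. -/
def oneY (qh th : K) : PolyRep qh th := Submodule.Quotient.mk 1

/-- The eigenvalue of `Y` on `E_m(X) 1_Y`: it is `t^(-1/2) q^(-m/2)` for `m > 0`
and `t^(1/2) q^(-m/2)` for `m ≤ 0`. -/
def eigenvalue (qh th : K) (m : ℤ) : K :=
  (if 0 < m then th⁻¹ else th) * qh ^ (-m)

/-- `E` is the electronic (nonsymmetric) Macdonald polynomial `E_m`: `E(X) 1_Y` is an eigenvector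
of `Y` with the eigenvalue attached to `m`, and the coefficient of `X^m` in `E` is `1`. -/
def IsElectronicMacdonald (qh th : K) (m : ℤ) (E : LaurentPolynomial K) : Prop :=
  gen qh th Gen.Y • (E.smeval (unitX qh th) • oneY qh th) =
      (eigenvalue qh th m • E.smeval (unitX qh th)) • oneY qh th ∧
    E.coeff m = 1

/-! ### The localized double affine Hecke algebra

`K(Y) ⊗_{K[Y,Y⁻¹]} DAHA` as an algebra: the double affine Hecke algebra with all nonzero Laurent
polynomials in `Y` inverted. It is presented as the `K`-algebra generated by `DAHA` and by the
field `K(Y)`, where the two copies of `Y` are identified. -/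

/-- The relations of the localized algebra: those of `DAHA`, those of `K(Y)`,
and the identification of the two copies of `Y`. -/
inductive LocRel (qh th : K) :
    FreeAlgebra K (DAHA qh th ⊕ RatFunc K) → FreeAlgebra K (DAHA qh th ⊕ RatFunc K) → Prop
  | int_add (a b : DAHA qh th) : LocRel qh th (FreeAlgebra.ι K (Sum.inl (a + b)))
      (FreeAlgebra.ι K (Sum.inl a) + FreeAlgebra.ι K (Sum.inl b))
  | int_mul (a b : DAHA qh th) : LocRel qh th (FreeAlgebra.ι K (Sum.inl (a * b)))
      (FreeAlgebra.ι K (Sum.inl a) * FreeAlgebra.ι K (Sum.inl b))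
  | int_scalar (c : K) : LocRel qh th (FreeAlgebra.ι K (Sum.inl (algebraMap K _ c)))
      (algebraMap K _ c)
  | fun_add (f g : RatFunc K) : LocRel qh th (FreeAlgebra.ι K (Sum.inr (f + g)))
      (FreeAlgebra.ι K (Sum.inr f) + FreeAlgebra.ι K (Sum.inr g))
  | fun_mul (f g : RatFunc K) : LocRel qh th (FreeAlgebra.ι K (Sum.inr (f * g)))
      (FreeAlgebra.ι K (Sum.inr f) * FreeAlgebra.ι K (Sum.inr g))
  | fun_scalar (c : K) : LocRel qh th (FreeAlgebra.ι K (Sum.inr (RatFunc.C c)))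
      (algebraMap K _ c)
  | glue : LocRel qh th (FreeAlgebra.ι K (Sum.inl (gen qh th Gen.Y)))
      (FreeAlgebra.ι K (Sum.inr RatFunc.X))

/-- The localized double affine Hecke algebra. -/
abbrev LocDAHA (qh th : K) := RingQuot (LocRel qh th)

/-- The canonical map from the double affine Hecke algebra to its localization. -/
def ofInt (qh th : K) (a : DAHA qh th) : LocDAHA qh th :=
  RingQuot.mkAlgHom K (LocRel qh th) (FreeAlgebra.ι K (Sum.inl a))

/-- A rational function `f(Y)` as an element of the localized double affine Hecke algebra. -/
def ofFun (qh th : K) (f : RatFunc K) : LocDAHA qh th :=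
  RingQuot.mkAlgHom K (LocRel qh th) (FreeAlgebra.ι K (Sum.inr f))

/-- `E(X)` as an element of the localized double affine Hecke algebra. -/
def evalX (qh th : K) (E : LaurentPolynomial K) : LocDAHA qh th :=
  ofInt qh th (E.smeval (unitX qh th))

/-- The variable `Y` of `K(Y)`. -/
abbrev Yv (K : Type*) [Field K] : RatFunc K := RatFunc.X

/-- The bosonic symmetrizer `1₀ = T₁ + t^(-1/2)`. -/
def symmetrizer (qh th : K) : LocDAHA qh th :=
  ofInt qh th (gen qh th Gen.T) + algebraMap K _ th⁻¹

/-- The intertwiner `τ₁ = T₁ + t^(-1/2) (1 - t) / (1 - Y⁻²)`. -/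
def tauOne (qh th : K) : LocDAHA qh th :=
  ofInt qh th (gen qh th Gen.T) +
    ofFun qh th (RatFunc.C (th⁻¹ * (1 - th ^ 2)) / (1 - Yv K ^ (-2 : ℤ)))

/-- The normalized intertwiner `η_π = τ_π = X T₁`. -/
def etaPi (qh th : K) : LocDAHA qh th :=
  ofInt qh th (gen qh th Gen.X * gen qh th Gen.T)

/-- The normalized intertwiner `η_{s₁} = t^(1/2) (1 - Y⁻²) / (1 - t Y⁻²) τ₁`. -/
def etaS (qh th : K) : LocDAHA qh th :=
  ofFun qh th (RatFunc.C th * ((1 - Yv K ^ (-2 : ℤ)) /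
    (1 - RatFunc.C (th ^ 2) * Yv K ^ (-2 : ℤ)))) * tauOne qh th

/-- `η = η_π η_{s₁}`. -/
def eta (qh th : K) : LocDAHA qh th := etaPi qh th * etaS qh th

/-- `η⁻¹ = η_{s₁} η_π`. -/
def etaInv (qh th : K) : LocDAHA qh th := etaS qh th * etaPi qh th

/-- The integer powers `η^k`. -/
def etaPow (qh th : K) : ℤ → LocDAHA qh th
  | Int.ofNat n => eta qh th ^ n
  | Int.negSucc n => etaInv qh th ^ (n + 1)

/-! ### The product formulas -/

/-- `(z; q)_n = (1 - z) (1 - z q) ⋯ (1 - z q^(n-1))`. -/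
def qPoch {R : Type*} [CommRing R] (z q : R) (n : ℕ) : R :=
  ∏ i ∈ Finset.range n, (1 - z * q ^ i)

/-- The `q`-`t`-binomial coefficient (for `j ≤ l`). -/
def qtBinom (q t : K) (l j : ℕ) : K :=
  (qPoch q q l / qPoch t q l) /
    ((qPoch q q j / qPoch t q j) * (qPoch q q (l - j) / qPoch t q (l - j)))

/-- The monomial `c Y⁻² q^n` in `K(Y)`. -/
def mono (q c : K) (n : ℤ) : RatFunc K := RatFunc.C (c * q ^ n) * Yv K ^ (-2 : ℤ)

/-- The `Y`-binomial coefficient (for `j ≤ l`), namely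
`(t⁻¹Y⁻²q^(-(j-1)); q)_(l-j) (tY⁻²q^(l-2j); q)_j / ((Y⁻²q; q)_(l-j) (Y⁻²q^(-j); q)_j)`. -/
def yBinom (q t : K) (l j : ℕ) : RatFunc K :=
  (qPoch (mono q t⁻¹ (-((j : ℤ) - 1))) (RatFunc.C q) (l - j) *
      qPoch (mono q t ((l : ℤ) - 2 * j)) (RatFunc.C q) j) /
    (qPoch (mono q 1 1) (RatFunc.C q) (l - j) * qPoch (mono q 1 (-(j : ℤ))) (RatFunc.C q) j)

/-- The product formula for `D_j^{(l)}(Y)`, `0 ≤ j ≤ l`. -/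
def dPos (qh th : K) (l j : ℕ) : RatFunc K :=
  RatFunc.C (th ^ (-((l : ℤ) + 1)) * (th ^ 2) ^ ((l : ℤ) - j) * qtBinom (qh ^ 2) (th ^ 2) l j) *
    yBinom (qh ^ 2) (th ^ 2) l j *
    RatFunc.C ((1 - th ^ 2 * (qh ^ 2) ^ ((l : ℤ) - j)) / (1 - th ^ 2 * (qh ^ 2) ^ l)) *
    ((1 - mono (qh ^ 2) (th ^ 2) ((l : ℤ) - j)) /
      (1 - mono (qh ^ 2) (th ^ 2) ((l : ℤ) - 2 * j)))

/-- The product formula for `D_j^{(-l)}(Y)`, `0 ≤ j ≤ l`. -/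
def dNeg (qh th : K) (l j : ℕ) : RatFunc K :=
  RatFunc.C (th ^ (-(l : ℤ)) * (qh ^ 2 * th ^ 2) ^ j * qtBinom (qh ^ 2) (th ^ 2) l j) *
    yBinom (qh ^ 2) (th ^ 2) l (l - j) *
    RatFunc.C ((1 - th ^ 2 * (qh ^ 2) ^ ((l : ℤ) - j)) / (1 - th ^ 2 * (qh ^ 2) ^ l)) *
    ((1 - mono (qh ^ 2) (th ^ 2)⁻¹ (-((l : ℤ) - j))) /
      (1 - mono (qh ^ 2) (th ^ 2)⁻¹ (-((l : ℤ) - 2 * j))))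

/-- The product formula for `K_j^{(l)}(Y)`, `0 ≤ j ≤ l`, `l > 0`. -/
def kCoef (qh th : K) (l j : ℕ) : RatFunc K :=
  RatFunc.C (th ^ (-((l : ℤ) - 1)) * (th ^ 2) ^ ((l : ℤ) - 1 - j) *
      qtBinom (qh ^ 2) (th ^ 2) l j) *
    yBinom (qh ^ 2) (th ^ 2) l j *
    ((1 - mono (qh ^ 2) 1 ((l : ℤ) - 2 * j)) /
      (1 - mono (qh ^ 2) (th ^ 2)⁻¹ ((l : ℤ) - 2 * j))) *
    ((1 - mono (qh ^ 2) (th ^ 2)⁻¹ 0) / (1 - mono (qh ^ 2) 1 0))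

end SL2DAHA

end

/-! The engine is the infinite dihedral group generated by `η_s` and `η_π`. Both are involutions,
and moving them past a function of `Y` substitutes `Y ↦ Y⁻¹` and `Y ↦ q^(-1/2) Y⁻¹` respectively, so
moving `η^k` past `f(Y)` scales `Y` by `q^(k/2)`. Write `T₁ = a η_s + b - t^(-1/2)`. The functions
`a`, `b` are exchanged by `Y ↦ Y⁻¹` and satisfy `a + b = t^(1/2) + t^(-1/2)`, hence `1₀ = a η_s + b`
and `η_s 1₀ = 1₀`. Left multiplication by `η_s`, `η_π` or a function of `Y` therefore sends each
element `η^k f(Y) 1₀` to another one, with explicit new `k` and `f`.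

Existence and uniqueness of `E_m`: the polynomial representation is realised on Laurent polynomials
by the Demazure-Lusztig operator. The recursion `E_{l+1} = t^(-1/2) X T₁ E_{-l}`, `E_{-l-1} =
t^(1/2) (T₁ + c_{l+1}) E_{l+1}` produces a unitriangular basis of eigenvectors of `Y`, and
genericity makes their eigenvalues distinct (`isElectronicMacdonald_iff_eq`).

Since `T₁ 1₀ = t^(1/2) 1₀`, the same recursion governs `E_m(X) 1₀`. Its first half is multiplication
by `t^(-1/2) η_π`, so `D_j^{(l)}(Y) = t^(-1/2) D_j^{(-l)}(Y⁻¹)` (`inversion_dPos`). Its second half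
splits every term in two: the `η_s` part of `T₁` negates the exponent of `η`, the remaining function
keeps it. Collecting equal powers of `η` writes an interior `D_j^{(-l-1)}` as a sum of two known
terms, and the product formula reduces to a contiguity relation between Pochhammer quotients
(`negForm_succ_succ`). For `K_j` the expansion of `E_l(X) 1₀` is multiplied by `1₀` on the left,
with `1₀ η_s = 1₀ (a/b)(Y)`, and `symForm_succ_succ` adds the two contributions.

Uniqueness of the coefficients: the localized algebra acts on `K(Y)` with `η_s` and `η_π` acting as
bare substitutions. As `q^(1/2)` is not a root of unity, the resulting automorphisms are distinct,
and Dedekind's independence of characters applies (`coeff_eq_zero_of_sum_eq_zero`). -/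

noncomputable section

namespace SL2DAHA

variable {K : Type*} [Field K]

/-! ### Consequences of the defining relations -/

section Relations

variable (qh th : K)

local notation "gT" => gen qh th Gen.T
local notation "gTi" => gen qh th Gen.Tinv
local notation "gX" => gen qh th Gen.X
local notation "gXi" => gen qh th Gen.Xinv
local notation "gY" => gen qh th Gen.Y
local notation "gYi" => gen qh th Gen.Yinv
local notation "gP" => gen qh th Gen.P
local notation "gPi" => gen qh th Gen.Pinv

theorem T_mul_Tinv : gT * gTi = 1 := by
  simpa [gen] using RingQuot.mkAlgHom_rel K (Rel.T_Tinv (qh := qh) (th := th))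

theorem Tinv_mul_T : gTi * gT = 1 := by
  simpa [gen] using RingQuot.mkAlgHom_rel K (Rel.Tinv_T (qh := qh) (th := th))

theorem X_mul_Xinv : gX * gXi = 1 := by
  simpa [gen] using RingQuot.mkAlgHom_rel K (Rel.X_Xinv (qh := qh) (th := th))

theorem Yinv_mul_Y : gYi * gY = 1 := by
  simpa [gen] using RingQuot.mkAlgHom_rel K (Rel.Yinv_Y (qh := qh) (th := th))

theorem Pinv_mul_P : gPi * gP = 1 := by
  simpa [gen] using RingQuot.mkAlgHom_rel K (Rel.Pinv_P (qh := qh) (th := th))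

theorem P_eq_Y_mul_Tinv : gP = gY * gTi := by
  simpa [gen] using RingQuot.mkAlgHom_rel K (Rel.P_eq_Y_Tinv (qh := qh) (th := th))

theorem P_eq_T_mul_Yinv : gP = gT * gYi := by
  simpa [gen] using RingQuot.mkAlgHom_rel K (Rel.P_eq_T_Yinv (qh := qh) (th := th))

theorem P_mul_X_mul_Pinv : gP * gX * gPi = qh • gXi := by
  simpa [gen] using RingQuot.mkAlgHom_rel K (Rel.P_X_Pinv (qh := qh) (th := th))

theorem T_mul_X_mul_T : gT * gX * gT = gXi := by
  simpa [gen] using RingQuot.mkAlgHom_rel K (Rel.T_X_T (qh := qh) (th := th))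

theorem T_mul_Yinv_mul_T : gT * gYi * gT = gY := by
  simpa [gen] using RingQuot.mkAlgHom_rel K (Rel.T_Yinv_T (qh := qh) (th := th))

variable {th}

theorem T_mul_T (ht : th ≠ 0) : gT * gT = (th - th⁻¹) • gT + 1 := by
  have h := RingQuot.mkAlgHom_rel K (Rel.quadratic (qh := qh) (th := th))
  simp only [map_mul, map_sub, map_add, AlgHom.commutes, map_zero] at h
  change (gT - _) * (gT + _) = 0 at h
  rw [sub_mul, mul_add, mul_add, ← map_mul, mul_inv_cancel₀ ht, map_one, ← Algebra.commutes,
    sub_eq_zero] at h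
  rw [Algebra.smul_def, map_sub, sub_mul, eq_sub_of_add_eq h]
  abel

theorem Tinv_eq (ht : th ≠ 0) : gTi = gT - (th - th⁻¹) • 1 := by
  have h := congrArg (gTi * ·) (T_mul_T qh ht)
  simp only [mul_add, ← mul_assoc, Tinv_mul_T, one_mul, mul_smul_comm, mul_one] at h
  rw [h]; abel

theorem Y_eq_P_mul_T : gY = gP * gT := by
  rw [P_eq_Y_mul_Tinv, mul_assoc, Tinv_mul_T, mul_one]

theorem XT_mul_XT : gX * gT * (gX * gT) = 1 := by
  rw [mul_assoc, ← mul_assoc gT, T_mul_X_mul_T, X_mul_Xinv]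

theorem Y_mul_T (ht : th ≠ 0) : gY * gT = gT * gYi + (th - th⁻¹) • gY := by
  have h : gT = gTi + (th - th⁻¹) • 1 := by rw [Tinv_eq qh ht]; abel
  rw [← P_eq_T_mul_Yinv, P_eq_Y_mul_Tinv]
  conv_lhs => rw [h]
  rw [mul_add, mul_smul_comm, mul_one]

theorem T_mul_Y (ht : th ≠ 0) : gT * gY = gYi * gT + (th - th⁻¹) • gY := by
  have h : gYi * gT = gTi * gY := by
    rw [← T_mul_Yinv_mul_T qh th, ← mul_assoc, ← mul_assoc, Tinv_mul_T, one_mul]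
  rw [h, Tinv_eq qh ht, sub_mul, smul_mul_assoc, one_mul]
  abel

/-- Both sides equal `T_π X⁻¹`: on the left `Y = T_π T₁` and `T₁ X T₁ = X⁻¹`; on the right `T₁ Y⁻¹ =
T_π`, which passes `X` at the cost of `q^(1/2)`. This makes `η_π` an intertwiner for `Y ↦ q^(-1/2)
Y⁻¹`. -/
theorem Y_mul_XT (hq : qh ≠ 0) : gY * (gX * gT) = qh⁻¹ • (gX * gT * gYi) := by
  have h1 : gP * gX = qh • (gXi * gP) := by
    rw [← smul_mul_assoc, ← P_mul_X_mul_Pinv, mul_assoc, Pinv_mul_P, mul_one]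
  have h2 : gX * gP = qh • (gP * gXi) := by
    calc gX * gP = gX * (gP * gX) * gXi := by
          rw [mul_assoc, mul_assoc gP, X_mul_Xinv, mul_one]
      _ = _ := by
          rw [h1, mul_smul_comm, smul_mul_assoc, ← mul_assoc gX, X_mul_Xinv, one_mul]
  rw [mul_assoc gX, ← P_eq_T_mul_Yinv, h2, smul_smul, inv_mul_cancel₀ hq, one_smul,
    Y_eq_P_mul_T, mul_assoc, ← mul_assoc gT, T_mul_X_mul_T]

theorem XT_mul_Y (hq : qh ≠ 0) : gX * gT * gY = qh⁻¹ • (gYi * (gX * gT)) := by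
  have h := congrArg (fun a => gYi * a * gY) (Y_mul_XT qh (th := th) hq)
  simp only [mul_smul_comm, smul_mul_assoc, mul_assoc, Yinv_mul_Y, mul_one] at h
  simp only [← mul_assoc, Yinv_mul_Y, one_mul] at h
  rw [h, mul_assoc]

theorem T_mul_X (ht : th ≠ 0) : gT * gX = gXi * (gT - (th - th⁻¹) • 1) := by
  rw [← Tinv_eq qh ht, ← T_mul_X_mul_T, mul_assoc, T_mul_Tinv, mul_one]

theorem T_mul_Xinv (ht : th ≠ 0) : gT * gXi = gX * gT + (th - th⁻¹) • gXi := by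
  rw [← T_mul_X_mul_T, mul_assoc, ← mul_assoc gT gT, T_mul_T qh ht, add_mul, one_mul,
    smul_mul_assoc, ← mul_assoc, add_comm]

end Relations

/-! ### The inversions `Y ↦ c Y⁻¹` of the field `K(Y)` -/

section Inversion

open Polynomial

variable (K) in
-- Needed to extend the substitution `Y ↦ c Y⁻¹` from polynomials to fractions: no nonzero
-- polynomial may be sent to zero.
theorem transcendental_C_div_X (c : Kˣ) :
    Transcendental K (RatFunc.C (c : K) / RatFunc.X : RatFunc K) := by
  intro h
  apply RatFunc.transcendental_X (K := K)
  have : (RatFunc.X : RatFunc K) =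
      algebraMap K _ (c : K) * (RatFunc.C (c : K) / RatFunc.X)⁻¹ := by
    rw [RatFunc.algebraMap_eq_C, inv_div, mul_div_cancel₀]
    simp
  rw [this]
  exact (isAlgebraic_algebraMap _).mul h.inv

/-- The endomorphism `f(Y) ↦ f(c Y⁻¹)` of `K(Y)`. -/
def invHom (c : Kˣ) : RatFunc K →ₐ[K] RatFunc K :=
  RatFunc.liftAlgHom (aeval (RatFunc.C (c : K) / RatFunc.X)) <| by
    refine nonZeroDivisors_le_comap_nonZeroDivisors_of_injective _ ?_
    exact transcendental_iff_injective.1 (transcendental_C_div_X K c)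

theorem invHom_X (c : Kˣ) : invHom c RatFunc.X = RatFunc.C (c : K) / RatFunc.X := by
  have := RatFunc.liftAlgHom_apply_div' (L := RatFunc K)
    (aeval (R := K) (RatFunc.C (c : K) / RatFunc.X : RatFunc K))
    (nonZeroDivisors_le_comap_nonZeroDivisors_of_injective _
      (transcendental_iff_injective.1 (transcendental_C_div_X K c))) X 1
  simpa [invHom] using this

/-- An algebra homomorphism out of `K(Y)` is determined by the image of `Y`. -/
theorem ratFunc_algHom_ext {L : Type*} [DivisionRing L] [Algebra K L] {f g : RatFunc K →ₐ[K] L}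
    (h : f RatFunc.X = g RatFunc.X) : f = g := by
  have hp : ∀ p : K[X], f (algebraMap _ _ p) = g (algebraMap _ _ p) := by
    intro p
    have : f.comp (IsScalarTower.toAlgHom K K[X] (RatFunc K)) =
        g.comp (IsScalarTower.toAlgHom K K[X] (RatFunc K)) := by
      ext
      simpa using h
    exact DFunLike.congr_fun this p
  ext x
  induction x using RatFunc.induction_on with
  | _ p q hq => rw [map_div₀, map_div₀, hp, hp]

/-- The involution `f(Y) ↦ f(c Y⁻¹)` of `K(Y)`. -/
def inversion (c : Kˣ) : RatFunc K ≃ₐ[K] RatFunc K :=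
  have h : (invHom c).comp (invHom c) = AlgHom.id K (RatFunc K) := by
    apply ratFunc_algHom_ext
    rw [AlgHom.comp_apply, invHom_X, map_div₀, invHom_X, ← RatFunc.algebraMap_eq_C,
      AlgHom.commutes, AlgHom.id_apply, div_div_cancel₀]
    simp
  AlgEquiv.ofAlgHom (invHom c) (invHom c) h h

theorem inversion_X (c : Kˣ) : inversion c RatFunc.X = RatFunc.C (c : K) / RatFunc.X :=
  invHom_X c

theorem inversion_C (c : Kˣ) (a : K) : inversion c (RatFunc.C a) = RatFunc.C a := by
  rw [← RatFunc.algebraMap_eq_C, AlgEquiv.commutes]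

theorem inversion_mul_self (c : Kˣ) : inversion c * inversion c = 1 := by
  ext f
  exact (inversion c).symm_apply_apply f

theorem inversion_inversion (c : Kˣ) (f : RatFunc K) : inversion c (inversion c f) = f :=
  (inversion c).symm_apply_apply f

end Inversion

/-! ### The structure of the localized algebra -/

/-- An element that intertwines `Y` with `σ Y` intertwines every `f(Y)` with `σ f(Y)`. -/
theorem intertwine_of_intertwine_X {A : Type*} [Ring A] [Algebra K A] (φ : RatFunc K →ₐ[K] A)
    (σ : RatFunc K ≃ₐ[K] RatFunc K) {x : A}
    (h : x * φ RatFunc.X = φ (σ RatFunc.X) * x) (f : RatFunc K) : x * φ f = φ (σ f) * x := by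
  have hmul : ∀ f g, x * φ f = φ (σ f) * x → x * φ g = φ (σ g) * x →
      x * φ (f * g) = φ (σ (f * g)) * x := by
    intro f g hf hg
    rw [map_mul, ← mul_assoc, hf, mul_assoc, hg, ← mul_assoc, ← map_mul, ← map_mul]
  have hp : ∀ p : Polynomial K, x * φ (algebraMap _ _ p) = φ (σ (algebraMap _ _ p)) * x := by
    intro p
    induction p using Polynomial.induction_on with
    | C a =>
      rw [RatFunc.algebraMap_C, ← RatFunc.algebraMap_eq_C, AlgEquiv.commutes, AlgHom.commutes,
        Algebra.commutes]
    | add p q hp hq => rw [map_add, map_add, mul_add, hp, hq, map_add, map_add, add_mul]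
    | monomial n a ih =>
      rw [pow_succ, ← mul_assoc, map_mul]
      exact hmul _ _ ih (by rwa [RatFunc.algebraMap_X])
  -- Multiply the relation for `g` by `φ (σ g⁻¹)` on the left and by `φ g⁻¹` on the right.
  have hinv : ∀ g, g ≠ 0 → x * φ g = φ (σ g) * x → x * φ g⁻¹ = φ (σ g⁻¹) * x := by
    intro g hg h
    have h1 : φ g * φ g⁻¹ = 1 := by rw [← map_mul, mul_inv_cancel₀ hg, map_one]
    have h2 : φ (σ g⁻¹) * φ (σ g) = 1 := by
      rw [← map_mul, ← map_mul, inv_mul_cancel₀ hg, map_one, map_one]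
    calc x * φ g⁻¹ = φ (σ g⁻¹) * (φ (σ g) * x) * φ g⁻¹ := by rw [← mul_assoc, h2, one_mul]
      _ = _ := by rw [← h, mul_assoc, mul_assoc, h1, mul_one]
  induction f using RatFunc.induction_on with
  | _ p q hq =>
    rw [div_eq_mul_inv]
    exact hmul _ _ (hp p) (hinv _ (RatFunc.algebraMap_ne_zero hq) (hp q))

section Localized

variable (qh th : K)

theorem mkAlgHom_eq_of_locRel {a b} (h : LocRel qh th a b) :
    RingQuot.mkAlgHom K (LocRel qh th) a = RingQuot.mkAlgHom K (LocRel qh th) b :=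
  RingQuot.mkAlgHom_rel K h

/-- The canonical map from the double affine Hecke algebra to its localization. -/
def intHom : DAHA qh th →ₐ[K] LocDAHA qh th :=
  AlgHom.ofLinearMap
    { toFun := ofInt qh th
      map_add' := fun a b => by
        simpa [ofInt] using mkAlgHom_eq_of_locRel qh th (LocRel.int_add a b)
      map_smul' := fun c a => by
        have h1 := mkAlgHom_eq_of_locRel qh th (LocRel.int_mul (algebraMap K _ c) a)
        have h2 := mkAlgHom_eq_of_locRel qh th (LocRel.int_scalar c)
        rw [map_mul, h2, AlgHom.commutes, ← Algebra.smul_def, ← Algebra.smul_def] at h1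
        exact h1 }
    (by
      have h := mkAlgHom_eq_of_locRel qh th (LocRel.int_scalar 1)
      rw [map_one, map_one, map_one] at h
      exact h)
    (fun a b => (mkAlgHom_eq_of_locRel qh th (LocRel.int_mul a b)).trans (map_mul _ _ _))

/-- The embedding of `K(Y)` into the localized double affine Hecke algebra. -/
def funHom : RatFunc K →ₐ[K] LocDAHA qh th :=
  AlgHom.ofLinearMap
    { toFun := ofFun qh th
      map_add' := fun a b => by
        simpa [ofFun] using mkAlgHom_eq_of_locRel qh th (LocRel.fun_add a b)
      map_smul' := fun c a => by
        have h1 := mkAlgHom_eq_of_locRel qh th (LocRel.fun_mul (RatFunc.C c) a)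
        have h2 := mkAlgHom_eq_of_locRel qh th (LocRel.fun_scalar c)
        rw [map_mul, h2, AlgHom.commutes, ← Algebra.smul_def, ← RatFunc.algebraMap_eq_C,
          ← Algebra.smul_def] at h1
        exact h1 }
    (by
      have h := mkAlgHom_eq_of_locRel qh th (LocRel.fun_scalar 1)
      rw [map_one, map_one, map_one] at h
      exact h)
    (fun a b => (mkAlgHom_eq_of_locRel qh th (LocRel.fun_mul a b)).trans (map_mul _ _ _))

theorem ofInt_eq (a : DAHA qh th) : ofInt qh th a = intHom qh th a := rfl

theorem ofFun_eq (f : RatFunc K) : ofFun qh th f = funHom qh th f := rfl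

theorem intHom_Y : intHom qh th (gen qh th Gen.Y) = funHom qh th RatFunc.X :=
  mkAlgHom_eq_of_locRel qh th LocRel.glue

theorem intHom_Yinv : intHom qh th (gen qh th Gen.Yinv) = funHom qh th RatFunc.X⁻¹ := by
  have h1 : intHom qh th (gen qh th Gen.Yinv) * funHom qh th RatFunc.X = 1 := by
    rw [← intHom_Y, ← map_mul, Yinv_mul_Y, map_one]
  have h2 : funHom qh th RatFunc.X * funHom qh th RatFunc.X⁻¹ = 1 := by
    rw [← map_mul, mul_inv_cancel₀ RatFunc.X_ne_zero, map_one]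
  exact left_inv_eq_right_inv h1 h2

theorem funHom_C (c : K) : funHom qh th (RatFunc.C c) = algebraMap K _ c := by
  rw [← RatFunc.algebraMap_eq_C, AlgHom.commutes]

end Localized

/-- A multiple `c Y⁻²` of `Y⁻²` is not the constant `1`. -/
theorem one_sub_C_mul_ne_zero (c : K) :
    (1 - RatFunc.C c * RatFunc.X ^ (-2 : ℤ) : RatFunc K) ≠ 0 := by
  intro h
  have h1 : (RatFunc.X : RatFunc K) ^ 2 = RatFunc.C c := by
    rw [zpow_neg, sub_eq_zero, ← div_eq_mul_inv, eq_div_iff (zpow_ne_zero _ RatFunc.X_ne_zero),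
      one_mul] at h
    exact_mod_cast h
  apply RatFunc.transcendental_X (K := K)
  apply IsAlgebraic.of_pow (n := 2) (by norm_num)
  rw [h1, ← RatFunc.algebraMap_eq_C]
  exact isAlgebraic_algebraMap _

theorem one_sub_Y_ne_zero : (1 - RatFunc.X ^ (-2 : ℤ) : RatFunc K) ≠ 0 := by
  simpa using one_sub_C_mul_ne_zero (1 : K)

/-- The coefficient `a(Y)` in `T₁ = a(Y) η_s + b(Y) - t^(-1/2)`. -/
def coefA (th : K) : RatFunc K :=
  (1 - RatFunc.C (th ^ 2) * RatFunc.X ^ (-2 : ℤ)) / (RatFunc.C th * (1 - RatFunc.X ^ (-2 : ℤ)))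

/-- The coefficient `b(Y)` in `T₁ = a(Y) η_s + b(Y) - t^(-1/2)`. -/
def coefB (th : K) : RatFunc K :=
  (RatFunc.C (th ^ 2) - RatFunc.X ^ (-2 : ℤ)) / (RatFunc.C th * (1 - RatFunc.X ^ (-2 : ℤ)))

theorem C_ne_zero {c : K} (hc : c ≠ 0) : (RatFunc.C c : RatFunc K) ≠ 0 := by simpa using hc

theorem inversion_one_Y : inversion (1 : Kˣ) (RatFunc.X ^ (-2 : ℤ)) = RatFunc.X ^ (2 : ℤ) := by
  rw [map_zpow₀, inversion_X, Units.val_one, map_one, one_div, inv_zpow, zpow_neg, inv_inv]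

theorem coefA_ne_zero {th : K} (ht : th ≠ 0) : coefA th ≠ 0 :=
  div_ne_zero (one_sub_C_mul_ne_zero _)
    (mul_ne_zero (C_ne_zero ht) one_sub_Y_ne_zero)

theorem coefA_add_coefB {th : K} (ht : th ≠ 0) :
    coefA th + coefB th = RatFunc.C th + RatFunc.C th⁻¹ := by
  have h1 := C_ne_zero ht
  have h2 := one_sub_Y_ne_zero (K := K)
  rw [coefA, coefB, map_inv₀, map_pow]
  generalize (RatFunc.X : RatFunc K) ^ (-2 : ℤ) = y at *
  field_simp
  ring

/-- This symmetry, together with the constant value of `a + b`, is what makes `η_s` an involution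
and lets `1₀` absorb it. -/
theorem inversion_coefA {th : K} (ht : th ≠ 0) :
    inversion (1 : Kˣ) (coefA th) = coefB th := by
  have h1 := C_ne_zero ht
  have h2 := one_sub_Y_ne_zero (K := K)
  have h3 : (RatFunc.X : RatFunc K) ≠ 0 := RatFunc.X_ne_zero
  have h4 : (1 - RatFunc.X ^ 2 : RatFunc K) ≠ 0 := by
    intro h
    apply h2
    rw [zpow_neg, zpow_ofNat, (sub_eq_zero.1 h).symm, inv_one, sub_self]
  rw [coefA, coefB, map_div₀, map_mul, map_sub, map_sub, map_mul, inversion_one_Y, inversion_C,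
    inversion_C, map_one, map_pow, zpow_neg, zpow_ofNat] at *
  rw [div_eq_div_iff (mul_ne_zero h1 h4) (mul_ne_zero h1 h2)]
  field_simp
  ring

theorem inversion_coefB {th : K} (ht : th ≠ 0) :
    inversion (1 : Kˣ) (coefB th) = coefA th := by
  rw [← inversion_coefA ht, inversion_inversion]

theorem coefB_ne_zero {th : K} (ht : th ≠ 0) : coefB th ≠ 0 := by
  rw [← inversion_coefA ht]
  exact (map_ne_zero_iff _ (inversion _).injective).2 (coefA_ne_zero ht)

/-! ### The intertwiners as a dihedral group acting on functions of `Y` -/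

section Intertwiners

variable {qh th : K}

theorem etaS_eq (ht : th ≠ 0) : etaS qh th = funHom qh th (coefA th)⁻¹ *
    (intHom qh th (gen qh th Gen.T) + funHom qh th (RatFunc.C th⁻¹ - coefB th)) := by
  have h1 := C_ne_zero ht
  have h2 := one_sub_Y_ne_zero (K := K)
  have h3 := one_sub_C_mul_ne_zero (th ^ 2)
  rw [etaS, tauOne, ofFun_eq, ofFun_eq, ofInt_eq]
  congr 3
  · rw [coefA, inv_div, mul_div_assoc]
  · rw [coefB, map_mul, map_sub, map_inv₀, map_one, map_pow]
    simp only [map_pow] at h3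
    generalize (RatFunc.X : RatFunc K) ^ (-2 : ℤ) = y at *
    field_simp
    ring

theorem intHom_T (ht : th ≠ 0) : intHom qh th (gen qh th Gen.T) =
    funHom qh th (coefA th) * etaS qh th + funHom qh th (coefB th - RatFunc.C th⁻¹) := by
  rw [etaS_eq ht, ← mul_assoc, ← map_mul, mul_inv_cancel₀ (coefA_ne_zero ht), map_one, one_mul,
    add_assoc, ← map_add, sub_add_sub_cancel, sub_self, map_zero, add_zero]

theorem symmetrizer_eq (ht : th ≠ 0) : symmetrizer qh th =
    funHom qh th (coefA th) * etaS qh th + funHom qh th (coefB th) := by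
  rw [symmetrizer, ofInt_eq, intHom_T ht, map_sub, funHom_C, add_assoc, sub_add_cancel]

theorem etaS_mul_funHom (ht : th ≠ 0) (f : RatFunc K) :
    etaS qh th * funHom qh th f = funHom qh th (inversion 1 f) * etaS qh th := by
  apply intertwine_of_intertwine_X
  have h1 := C_ne_zero ht
  have h2 := one_sub_Y_ne_zero (K := K)
  have h3 : (RatFunc.X : RatFunc K) ≠ 0 := RatFunc.X_ne_zero
  -- The rational term of `τ₁` is chosen to cancel the inhomogeneous term `(t^(1/2) - t^(-1/2)) Y`
  -- that appears when `T₁` passes `Y`.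
  have key : RatFunc.C (th - th⁻¹) * RatFunc.X + (RatFunc.C th⁻¹ - coefB th) * RatFunc.X =
      RatFunc.X⁻¹ * (RatFunc.C th⁻¹ - coefB th) := by
    rw [coefB, map_sub, map_inv₀, map_pow]
    have h4 : (RatFunc.X : RatFunc K) ^ 2 - 1 ≠ 0 := by
      intro h
      apply h2
      rw [zpow_neg, zpow_ofNat, sub_eq_zero.1 h, inv_one, sub_self]
    rw [zpow_neg, zpow_ofNat]
    field_simp
    ring
  have hT : intHom qh th (gen qh th Gen.T) * funHom qh th RatFunc.X =
      funHom qh th RatFunc.X⁻¹ * intHom qh th (gen qh th Gen.T) +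
        funHom qh th (RatFunc.C (th - th⁻¹) * RatFunc.X) := by
    rw [← intHom_Y, ← map_mul, T_mul_Y qh ht, map_add, map_mul, intHom_Yinv, map_smul,
      intHom_Y, ← RatFunc.algebraMap_eq_C, ← Algebra.smul_def, map_smul]
  rw [etaS_eq ht, inversion_X, Units.val_one, map_one, one_div, mul_assoc, add_mul, hT, add_assoc,
    ← map_mul (funHom qh th) (_ - _), ← map_add, key, map_mul, ← mul_add, ← mul_assoc, ← mul_assoc,
    ← map_mul, ← map_mul, mul_comm (RatFunc.X)⁻¹]

/-- Substitute `T₁ = a η_s + b - t^(-1/2)` into the quadratic relation and move functions to the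
left. The terms linear in `η_s` agree on both sides because of the value of `a + b`, and what is
left is `a b η_s² = a b` with `a b` invertible. -/
theorem etaS_mul_etaS (ht : th ≠ 0) : etaS qh th * etaS qh th = 1 := by
  have hab := coefA_add_coefB ht
  have ha := inversion_coefA ht
  have hb := inversion_coefB ht
  have ha0 := coefA_ne_zero ht
  have hb0 := coefB_ne_zero ht
  have hq := congrArg (intHom qh th) (T_mul_T qh ht)
  rw [map_mul, map_add, map_one, map_smul, intHom_T ht, Algebra.smul_def, ← funHom_C] at hq
  generalize coefA th = a at *
  generalize coefB th = b at *
  set s := etaS qh th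
  set φ := funHom qh th
  have hC : (RatFunc.C th⁻¹ : RatFunc K) * RatFunc.C th = 1 := by
    rw [← map_mul, inv_mul_cancel₀ ht, map_one]
  set c : RatFunc K := RatFunc.C th⁻¹ with hc
  have hs : ∀ f, s * φ f = φ (inversion 1 f) * s := etaS_mul_funHom ht
  have h1 : (φ a * s + φ (b - c)) * (φ a * s + φ (b - c)) =
      φ (a * b) * (s * s) + φ (a * (a - c) + (b - c) * a) * s + φ ((b - c) * (b - c)) := by
    have e1 : φ a * s * (φ a * s) = φ (a * b) * (s * s) := by
      rw [mul_assoc, ← mul_assoc s, hs, ha, map_mul]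
      simp only [mul_assoc]
    have e2 : φ a * s * φ (b - c) = φ (a * (a - c)) * s := by
      rw [mul_assoc, hs, map_sub, hb, hc, inversion_C, map_mul, mul_assoc]
    rw [add_mul, mul_add, mul_add, e1, e2, ← mul_assoc (φ (b - c)), ← map_mul φ (b - c),
      ← map_mul φ (b - c), map_add, add_mul]
    abel
  have h2 : φ (RatFunc.C (th - th⁻¹)) * (φ a * s + φ (b - c)) + 1 =
      φ (a * (a - c) + (b - c) * a) * s + φ (b - c) * φ (b - c) + φ (a * b) := by
    have hh : (RatFunc.C (th - th⁻¹) : RatFunc K) = a + b - c - c := by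
      rw [hab, map_sub]; ring
    have hC' : c * (a + b - c) = 1 := by rw [hab]; linear_combination hC
    rw [mul_add, ← mul_assoc, ← map_mul, ← map_mul, add_assoc, add_assoc, ← map_one φ,
      ← map_mul, ← map_add, ← map_add, hh]
    exact congrArg₂ _ (congrArg (φ · * s) (by ring)) (congrArg φ (by linear_combination -hC'))
  rw [h1, h2, ← map_mul, add_comm, ← add_assoc, add_comm (φ ((b - c) * (b - c))), add_comm] at hq
  have h3 : φ (a * b) * (s * s) = φ (a * b) := by
    have := hq
    rw [← sub_eq_zero] at this ⊢
    rw [← this]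
    abel
  have h4 : φ (a * b)⁻¹ * φ (a * b) = 1 := by
    rw [← map_mul, inv_mul_cancel₀ (mul_ne_zero ha0 hb0), map_one]
  calc s * s = φ (a * b)⁻¹ * (φ (a * b) * (s * s)) := by rw [← mul_assoc, h4, one_mul]
    _ = 1 := by rw [h3, h4]

theorem etaPi_mul_etaPi : etaPi qh th * etaPi qh th = 1 := by
  rw [etaPi, ofInt_eq, ← map_mul, XT_mul_XT, map_one]

theorem etaPi_mul_funHom (hq : qh ≠ 0) (f : RatFunc K) :
    etaPi qh th * funHom qh th f =
      funHom qh th (inversion (Units.mk0 qh hq)⁻¹ f) * etaPi qh th := by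
  apply intertwine_of_intertwine_X
  rw [inversion_X, Units.val_inv_eq_inv_val, Units.val_mk0, etaPi, ofInt_eq, ← intHom_Y, ← map_mul,
    XT_mul_Y qh hq, div_eq_mul_inv, ← RatFunc.algebraMap_eq_C, ← Algebra.smul_def, map_smul,
    map_smul, ← intHom_Yinv, map_mul, smul_mul_assoc]

theorem eta_mul_etaInv (ht : th ≠ 0) : eta qh th * etaInv qh th = 1 := by
  rw [eta, etaInv, mul_assoc, ← mul_assoc (etaS qh th), etaS_mul_etaS ht, one_mul,
    etaPi_mul_etaPi]

theorem etaInv_mul_eta (ht : th ≠ 0) : etaInv qh th * eta qh th = 1 := by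
  rw [eta, etaInv, mul_assoc, ← mul_assoc (etaPi qh th), etaPi_mul_etaPi, one_mul,
    etaS_mul_etaS ht]

/-- `η` as a unit. -/
def etaUnit (qh : K) {th : K} (ht : th ≠ 0) : (LocDAHA qh th)ˣ where
  val := eta qh th
  inv := etaInv qh th
  val_inv := eta_mul_etaInv ht
  inv_val := etaInv_mul_eta ht

theorem etaPow_eq (ht : th ≠ 0) (k : ℤ) :
    etaPow qh th k = ((etaUnit qh ht ^ k : _ˣ) : LocDAHA qh th) := by
  cases k with
  | ofNat n => simp [etaPow, etaUnit]
  | negSucc n => rw [zpow_negSucc, ← inv_pow, Units.val_pow_eq_pow_val]; rfl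

theorem etaPow_add (ht : th ≠ 0) (k l : ℤ) :
    etaPow qh th (k + l) = etaPow qh th k * etaPow qh th l := by
  simp only [etaPow_eq ht, zpow_add, Units.val_mul]

theorem etaPow_zero : etaPow qh th 0 = 1 := pow_zero _

theorem etaPow_one : etaPow qh th 1 = eta qh th := pow_one _

/-- Conjugation by the reflection `η_s` inverts the translation `η = η_π η_s`, as in any dihedral
group. -/
theorem etaS_mul_etaPow (ht : th ≠ 0) (k : ℤ) :
    etaS qh th * etaPow qh th k = etaPow qh th (-k) * etaS qh th := by
  have h : SemiconjBy (etaS qh th) (etaUnit qh ht : LocDAHA qh th)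
      ((etaUnit qh ht)⁻¹ : (LocDAHA qh th)ˣ) := by
    change etaS qh th * (etaPi qh th * etaS qh th) = etaS qh th * etaPi qh th * etaS qh th
    rw [mul_assoc]
  rw [etaPow_eq ht, etaPow_eq ht, zpow_neg, ← inv_zpow]
  exact h.units_zpow_right k

theorem etaPi_eq (ht : th ≠ 0) : etaPi qh th = eta qh th * etaS qh th := by
  rw [eta, mul_assoc, etaS_mul_etaS ht, mul_one]

theorem etaPi_mul_etaPow (ht : th ≠ 0) (k : ℤ) :
    etaPi qh th * etaPow qh th k = etaPow qh th (1 - k) * etaS qh th := by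
  rw [etaPi_eq ht, mul_assoc, etaS_mul_etaPow ht, ← mul_assoc, ← etaPow_one, ← etaPow_add ht,
    sub_eq_add_neg]

/-- The automorphism `f(Y) ↦ f(q^(1/2) Y)` of `K(Y)`. -/
def shift (qh : Kˣ) : RatFunc K ≃ₐ[K] RatFunc K := inversion qh⁻¹ * inversion 1

theorem shift_zpow_X (qh : Kˣ) (k : ℤ) :
    (shift qh ^ k) RatFunc.X = RatFunc.C ((qh : K) ^ k) * RatFunc.X := by
  have h1 : shift qh RatFunc.X = RatFunc.C (qh : K) * RatFunc.X := by
    rw [shift, AlgEquiv.mul_apply, inversion_X, map_div₀, inversion_X, inversion_C, Units.val_one,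
      map_one, one_div_div, div_eq_mul_inv, ← map_inv₀, Units.val_inv_eq_inv_val, inv_inv, mul_comm]
  have hC : ∀ (σ : RatFunc K ≃ₐ[K] RatFunc K) (c : K), σ (RatFunc.C c) = RatFunc.C c := by
    intro σ c
    rw [← RatFunc.algebraMap_eq_C, AlgEquiv.commutes]
  induction k with
  | zero => simp
  | succ n ih =>
    rw [zpow_add_one, AlgEquiv.mul_apply, h1, map_mul, hC, ih, zpow_add_one₀ qh.ne_zero, map_mul,
      ← mul_assoc, mul_comm (RatFunc.C (qh : K))]
  | pred n ih =>
    have h2 : (shift qh)⁻¹ RatFunc.X = RatFunc.C (qh : K)⁻¹ * RatFunc.X := by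
      apply (shift qh).injective
      rw [← AlgEquiv.mul_apply, mul_inv_cancel, map_mul, h1, hC, ← mul_assoc, ← map_mul,
        inv_mul_cancel₀ qh.ne_zero, map_one, one_mul, AlgEquiv.one_apply]
    rw [zpow_sub_one, AlgEquiv.mul_apply, h2, map_mul, hC, ih, zpow_sub_one₀ qh.ne_zero, map_mul,
      ← mul_assoc, mul_comm (RatFunc.C (qh : K)⁻¹)]

/-- The two inversions attached to `η_s` and `η_π` compose to the scaling `Y ↦ q^(1/2) Y`; negative
powers follow by conjugating with `η⁻¹`. -/
theorem etaPow_mul_funHom (hq : qh ≠ 0) (ht : th ≠ 0) (k : ℤ) (f : RatFunc K) :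
    etaPow qh th k * funHom qh th f =
      funHom qh th ((shift (Units.mk0 qh hq) ^ k) f) * etaPow qh th k := by
  have h1 : ∀ f, eta qh th * funHom qh th f =
      funHom qh th (shift (Units.mk0 qh hq) f) * eta qh th := by
    intro f
    rw [eta, mul_assoc, etaS_mul_funHom ht, ← mul_assoc, etaPi_mul_funHom hq, mul_assoc]
    rfl
  have h2 : ∀ f, etaInv qh th * funHom qh th f =
      funHom qh th ((shift (Units.mk0 qh hq))⁻¹ f) * etaInv qh th := by
    intro f
    have h := congrArg (fun x => etaInv qh th * x * etaInv qh th)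
      (h1 ((shift (Units.mk0 qh hq))⁻¹ f))
    simp only [← mul_assoc] at h
    rw [etaInv_mul_eta ht, one_mul, mul_assoc, mul_assoc, eta_mul_etaInv ht, mul_one,
      ← AlgEquiv.mul_apply, mul_inv_cancel, AlgEquiv.one_apply] at h
    exact h.symm
  apply intertwine_of_intertwine_X
  induction k with
  | zero => simp [etaPow_zero]
  | succ n ih =>
    rw [etaPow_add ht, etaPow_one, mul_assoc, h1, zpow_add_one, AlgEquiv.mul_apply, ← mul_assoc,
      intertwine_of_intertwine_X _ _ ih, mul_assoc]
  | pred n ih =>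
    have h3 : etaPow qh th (-1) = etaInv qh th := pow_one _
    rw [sub_eq_add_neg, etaPow_add ht, h3, mul_assoc, h2, zpow_add, zpow_neg_one,
      AlgEquiv.mul_apply, ← mul_assoc, intertwine_of_intertwine_X _ _ ih, mul_assoc]

/-! ### The symmetrizer -/

/-- In `a η_s + b` the left factor `η_s` swaps `a` with `b` and squares to one, so the two summands
trade places. This absorbs every `η_s` that reaches `1₀` from the left. -/
theorem etaS_mul_symmetrizer (ht : th ≠ 0) :
    etaS qh th * symmetrizer qh th = symmetrizer qh th := by
  rw [symmetrizer_eq ht, mul_add, ← mul_assoc, etaS_mul_funHom ht, etaS_mul_funHom ht, mul_assoc,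
    etaS_mul_etaS ht, mul_one, inversion_coefA ht, inversion_coefB ht, add_comm]

/-- With functions on the right, `1₀ = (η_s + 1) b` while `1₀ η_s = (η_s + 1) a`. This disposes of
an `η_s` on the right of `1₀`. -/
theorem symmetrizer_mul_etaS (ht : th ≠ 0) : symmetrizer qh th * etaS qh th =
    symmetrizer qh th * funHom qh th (coefA th / coefB th) := by
  have h1 : symmetrizer qh th = (etaS qh th + 1) * funHom qh th (coefB th) := by
    rw [symmetrizer_eq ht, add_mul, etaS_mul_funHom ht, inversion_coefB ht, one_mul]
  have h2 : symmetrizer qh th * etaS qh th = (etaS qh th + 1) * funHom qh th (coefA th) := by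
    rw [symmetrizer_eq ht, add_mul, mul_assoc, etaS_mul_etaS ht, add_mul, etaS_mul_funHom ht,
      inversion_coefA ht, mul_one, one_mul, add_comm]
  rw [h2, h1, mul_assoc, ← map_mul, mul_div_cancel₀ _ (coefB_ne_zero ht)]

end Intertwiners

/-! ### The action of the localized algebra on `K(Y)` -/

section FunctionRep

/-- A `K`-automorphism of `K(Y)` as a linear operator. -/
abbrev autOp (σ : RatFunc K ≃ₐ[K] RatFunc K) : Module.End K (RatFunc K) := σ.toLinearMap

/-- Multiplication by a rational function as a linear operator. -/
abbrev mulOp : RatFunc K →ₐ[K] Module.End K (RatFunc K) := Algebra.lmul K (RatFunc K)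

theorem autOp_mul (σ τ : RatFunc K ≃ₐ[K] RatFunc K) : autOp σ * autOp τ = autOp (σ * τ) := rfl

theorem autOp_one : autOp (1 : RatFunc K ≃ₐ[K] RatFunc K) = 1 := rfl

theorem autOp_mul_mulOp (σ : RatFunc K ≃ₐ[K] RatFunc K) (f : RatFunc K) :
    autOp σ * mulOp f = mulOp (σ f) * autOp σ := by
  ext g
  simp

/-- The operator by which `T₁` acts on `K(Y)`. -/
def opT (th : K) : Module.End K (RatFunc K) :=
  mulOp (coefA th) * autOp (inversion 1) + mulOp (coefB th - RatFunc.C th⁻¹)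

theorem opT_apply (th : K) (f : RatFunc K) :
    opT th f = coefA th * inversion 1 f + (coefB th - RatFunc.C th⁻¹) * f := by
  simp [opT, sub_mul]

/-- The operator by which `T₁⁻¹` acts on `K(Y)`. -/
def opTinv (th : K) : Module.End K (RatFunc K) := opT th - (th - th⁻¹) • 1

variable {qh th : K}

theorem opT_mul_opT (ht : th ≠ 0) : opT th * opT th = (th - th⁻¹) • opT th + 1 := by
  have hab := coefA_add_coefB ht
  have hC : (RatFunc.C th⁻¹ : RatFunc K) * RatFunc.C th = 1 := by
    rw [← map_mul, inv_mul_cancel₀ ht, map_one]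
  apply LinearMap.ext
  intro f
  rw [Module.End.mul_apply, LinearMap.add_apply, LinearMap.smul_apply, Module.End.one_apply,
    Algebra.smul_def, RatFunc.algebraMap_eq_C, map_sub RatFunc.C, opT_apply, opT_apply, map_add,
    map_mul, map_mul, map_sub, inversion_coefA ht, inversion_coefB ht, inversion_C,
    inversion_inversion]
  linear_combination (coefA th * inversion 1 f + (coefB th - RatFunc.C th⁻¹) * f +
    RatFunc.C th⁻¹ * f) * hab + f * hC

theorem opT_mul_opTinv (ht : th ≠ 0) : opT th * opTinv th = 1 := by
  rw [opTinv, mul_sub, opT_mul_opT ht, mul_smul_comm, mul_one]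
  abel

theorem opTinv_mul_opT (ht : th ≠ 0) : opTinv th * opT th = 1 := by
  rw [opTinv, sub_mul, opT_mul_opT ht, smul_mul_assoc, one_mul]
  abel

theorem opT_mul_Yinv_mul_opT (ht : th ≠ 0) :
    opT th * mulOp RatFunc.X⁻¹ * opT th = mulOp RatFunc.X := by
  have hab := coefA_add_coefB ht
  have hC : (RatFunc.C th⁻¹ : RatFunc K) * RatFunc.C th = 1 := by
    rw [← map_mul, inv_mul_cancel₀ ht, map_one]
  have hX : (RatFunc.X : RatFunc K) ≠ 0 := RatFunc.X_ne_zero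
  -- After expanding the composite on `f`, `key` is the vanishing of the coefficient of `f(Y⁻¹)`,
  -- and `key2` evaluates the coefficient of `f(Y)`.
  have key : coefA th * RatFunc.X * (coefA th - RatFunc.C th⁻¹) +
      (coefB th - RatFunc.C th⁻¹) * RatFunc.X⁻¹ * coefA th = 0 := by
    have h1 := C_ne_zero ht
    have h2 := one_sub_Y_ne_zero (K := K)
    have h4 : (RatFunc.X : RatFunc K) ^ 2 - 1 ≠ 0 := by
      intro h
      apply h2
      rw [zpow_neg, zpow_ofNat, sub_eq_zero.1 h, inv_one, sub_self]
    have : (coefA th - RatFunc.C th⁻¹) * RatFunc.X +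
      (coefB th - RatFunc.C th⁻¹) * RatFunc.X⁻¹ = 0 := by
      rw [coefA, coefB, map_inv₀, map_pow, zpow_neg, zpow_ofNat]
      field_simp
      ring
    linear_combination coefA th * this
  have key2 : coefA th * RatFunc.X * coefB th +
      (coefB th - RatFunc.C th⁻¹) * RatFunc.X⁻¹ * (coefB th - RatFunc.C th⁻¹) = RatFunc.X := by
    have h1 := C_ne_zero ht
    have h2 := one_sub_Y_ne_zero (K := K)
    have h4 : (RatFunc.X : RatFunc K) ^ 2 - 1 ≠ 0 := by
      intro h
      apply h2
      rw [zpow_neg, zpow_ofNat, sub_eq_zero.1 h, inv_one, sub_self]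
    rw [coefA, coefB, map_inv₀, map_pow, zpow_neg, zpow_ofNat]
    field_simp
    ring
  apply LinearMap.ext
  intro f
  simp only [Module.End.mul_apply, Algebra.coe_lmul_eq_mul, LinearMap.mul_apply', opT_apply]
  rw [map_mul, map_add, map_mul, map_mul, map_sub, inversion_coefA ht, inversion_coefB ht,
    inversion_C, inversion_inversion, map_inv₀, inversion_X, Units.val_one, map_one, one_div,
    inv_inv]
  linear_combination inversion 1 f * key + f * key2

/-- The operators by which the generators of the double affine Hecke algebra act on `K(Y)`. -/
def funAct (hq : qh ≠ 0) (th : K) : Gen → Module.End K (RatFunc K)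
  | .T => opT th
  | .Tinv => opTinv th
  | .X => autOp (inversion (Units.mk0 qh hq)⁻¹) * opTinv th
  | .Xinv => opT th * autOp (inversion (Units.mk0 qh hq)⁻¹)
  | .Y => mulOp RatFunc.X
  | .Yinv => mulOp RatFunc.X⁻¹
  | .P => mulOp RatFunc.X * opTinv th
  | .Pinv => mulOp RatFunc.X * opTinv th

theorem mulOp_X_mul_mulOp_inv : mulOp (K := K) RatFunc.X * mulOp RatFunc.X⁻¹ = 1 := by
  rw [← map_mul, mul_inv_cancel₀ RatFunc.X_ne_zero, map_one]

theorem mulOp_inv_mul_mulOp_X : mulOp (K := K) RatFunc.X⁻¹ * mulOp RatFunc.X = 1 := by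
  rw [← map_mul, inv_mul_cancel₀ RatFunc.X_ne_zero, map_one]

theorem funAct_rel (hq : qh ≠ 0) (ht : th ≠ 0) ⦃a b : FreeAlgebra K Gen⦄ (h : Rel qh th a b) :
    FreeAlgebra.lift K (funAct hq th) a = FreeAlgebra.lift K (funAct hq th) b := by
  have hP : mulOp RatFunc.X * opTinv th = opT th * mulOp RatFunc.X⁻¹ := by
    rw [← opT_mul_Yinv_mul_opT ht, mul_assoc _ (opT th), opT_mul_opTinv ht, mul_one]
  -- The two expressions `Y T₁⁻¹` and `T₁ Y⁻¹` for `T_π` are mutually inverse, so `T_π` is an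
  -- involution; this is why `funAct` gives `P` and `Pinv` the same operator.
  have hPP : mulOp RatFunc.X * opTinv th * (mulOp RatFunc.X * opTinv th) = 1 := by
    nth_rw 2 [hP]
    rw [mul_assoc, ← mul_assoc (opTinv th), opTinv_mul_opT ht, one_mul, mulOp_X_mul_mulOp_inv]
  have hpi : autOp (inversion (Units.mk0 qh hq)⁻¹) * autOp (inversion (Units.mk0 qh hq)⁻¹) = 1 := by
    rw [autOp_mul, inversion_mul_self, autOp_one]
  cases h <;> simp only [map_mul, map_one, map_smul, map_sub, map_add, map_zero, AlgHom.commutes,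
    FreeAlgebra.lift_ι_apply, funAct]
  case T_Tinv => exact opT_mul_opTinv ht
  case Tinv_T => exact opTinv_mul_opT ht
  case X_Xinv => rw [mul_assoc, ← mul_assoc (opTinv th), opTinv_mul_opT ht, one_mul, hpi]
  case Xinv_X => rw [mul_assoc, ← mul_assoc (autOp _), hpi, one_mul, opT_mul_opTinv ht]
  case Y_Yinv => exact mulOp_X_mul_mulOp_inv
  case Yinv_Y => exact mulOp_inv_mul_mulOp_X
  case P_Pinv => exact hPP
  case Pinv_P => exact hPP
  case P_eq_T_Yinv => exact hP
  case P_X_Pinv =>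
    nth_rw 2 [hP]
    have h1 : autOp (inversion (Units.mk0 qh hq)⁻¹) * mulOp RatFunc.X⁻¹ =
        qh • (mulOp RatFunc.X * autOp (inversion (Units.mk0 qh hq)⁻¹)) := by
      rw [autOp_mul_mulOp, map_inv₀, inversion_X, Units.val_inv_eq_inv_val, Units.val_mk0,
        inv_div, map_inv₀, div_inv_eq_mul, mul_comm, ← RatFunc.algebraMap_eq_C, ← Algebra.smul_def,
        map_smul, smul_mul_assoc]
    calc mulOp RatFunc.X * opTinv th * (autOp (inversion (Units.mk0 qh hq)⁻¹) * opTinv th) *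
          (opT th * mulOp RatFunc.X⁻¹)
        = mulOp RatFunc.X * opTinv th * (autOp (inversion (Units.mk0 qh hq)⁻¹) *
          (opTinv th * opT th) * mulOp RatFunc.X⁻¹) := by simp only [mul_assoc]
      _ = qh • ((mulOp RatFunc.X * opTinv th) * mulOp RatFunc.X *
          autOp (inversion (Units.mk0 qh hq)⁻¹)) := by
          rw [opTinv_mul_opT ht, mul_one, h1, mul_smul_comm, mul_assoc _ (mulOp _)]
      _ = _ := by
          rw [hP, mul_assoc (opT th), mulOp_inv_mul_mulOp_X, mul_one]
  case T_X_T =>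
    rw [mul_assoc, mul_assoc (autOp _), opTinv_mul_opT ht, mul_one]
  case T_Yinv_T => exact opT_mul_Yinv_mul_opT ht
  case quadratic =>
    rw [sub_mul, mul_add, mul_add, opT_mul_opT ht, ← map_mul, mul_inv_cancel₀ ht, map_one,
      ← Algebra.commutes, ← Algebra.smul_def, ← Algebra.smul_def, sub_smul]
    abel

/-- The action of the double affine Hecke algebra on `K(Y)`. -/
def funRepInt (hq : qh ≠ 0) (ht : th ≠ 0) : DAHA qh th →ₐ[K] Module.End K (RatFunc K) :=
  RingQuot.liftAlgHom K ⟨FreeAlgebra.lift K (funAct hq th), funAct_rel hq ht⟩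

theorem funRepInt_gen (hq : qh ≠ 0) (ht : th ≠ 0) (g : Gen) :
    funRepInt hq ht (gen qh th g) = funAct hq th g := by
  rw [funRepInt, gen, RingQuot.liftAlgHom_mkAlgHom_apply, FreeAlgebra.lift_ι_apply]

/-- The action of the localized double affine Hecke algebra on `K(Y)`. -/
def funRep (hq : qh ≠ 0) (ht : th ≠ 0) : LocDAHA qh th →ₐ[K] Module.End K (RatFunc K) :=
  RingQuot.liftAlgHom K ⟨FreeAlgebra.lift K (Sum.elim (funRepInt hq ht) mulOp), by
    intro a b h
    cases h <;> simp only [map_mul, map_add, FreeAlgebra.lift_ι_apply, AlgHom.commutes,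
      Sum.elim_inl, Sum.elim_inr]
    case fun_scalar c => rw [← RatFunc.algebraMap_eq_C, AlgHom.commutes]
    case glue => exact funRepInt_gen hq ht Gen.Y⟩

theorem funRep_intHom (hq : qh ≠ 0) (ht : th ≠ 0) (a : DAHA qh th) :
    funRep hq ht (intHom qh th a) = funRepInt hq ht a := by
  change funRep hq ht (ofInt qh th a) = _
  rw [funRep, ofInt, RingQuot.liftAlgHom_mkAlgHom_apply, FreeAlgebra.lift_ι_apply, Sum.elim_inl]

theorem funRep_funHom (hq : qh ≠ 0) (ht : th ≠ 0) (f : RatFunc K) :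
    funRep hq ht (funHom qh th f) = mulOp f := by
  change funRep hq ht (ofFun qh th f) = _
  rw [funRep, ofFun, RingQuot.liftAlgHom_mkAlgHom_apply, FreeAlgebra.lift_ι_apply, Sum.elim_inr]

/-- The operator of `T₁` is designed so that solving `T₁ = a η_s + b - t^(-1/2)` for `η_s` leaves
the bare substitution `Y ↦ Y⁻¹`. -/
theorem funRep_etaS (hq : qh ≠ 0) (ht : th ≠ 0) :
    funRep hq ht (etaS qh th) = autOp (inversion 1) := by
  rw [etaS_eq ht, map_mul, map_add, funRep_intHom, funRep_funHom, funRep_funHom, funRepInt_gen,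
    funAct, opT, add_assoc, ← map_add, sub_add_sub_cancel, sub_self, map_zero, add_zero,
    ← mul_assoc, ← map_mul, inv_mul_cancel₀ (coefA_ne_zero ht), map_one, one_mul]

theorem funRep_etaPi (hq : qh ≠ 0) (ht : th ≠ 0) :
    funRep hq ht (etaPi qh th) = autOp (inversion (Units.mk0 qh hq)⁻¹) := by
  rw [etaPi, ofInt_eq, funRep_intHom, map_mul, funRepInt_gen, funRepInt_gen, funAct, funAct,
    mul_assoc, opTinv_mul_opT ht, mul_one]

theorem funRep_etaPow (hq : qh ≠ 0) (ht : th ≠ 0) (k : ℤ) :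
    funRep hq ht (etaPow qh th k) = autOp (shift (Units.mk0 qh hq) ^ k) := by
  have h : ∀ (σ : RatFunc K ≃ₐ[K] RatFunc K) (n : ℕ), autOp σ ^ n = autOp (σ ^ n) := by
    intro σ n
    induction n with
    | zero => rfl
    | succ n ih => rw [pow_succ, ih, pow_succ, autOp_mul]
  cases k with
  | ofNat n =>
    rw [etaPow, map_pow, eta, map_mul, funRep_etaPi, funRep_etaS, autOp_mul, h]
    rfl
  | negSucc n =>
    rw [etaPow, map_pow, etaInv, map_mul, funRep_etaPi, funRep_etaS, autOp_mul, h, zpow_negSucc,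
      ← inv_pow, shift, mul_inv_rev]
    congr 2

theorem funRep_symmetrizer (hq : qh ≠ 0) (ht : th ≠ 0) :
    funRep hq ht (symmetrizer qh th) =
      mulOp (coefA th) * autOp (inversion 1) + mulOp (coefB th) := by
  rw [symmetrizer_eq ht, map_add, map_mul, funRep_funHom, funRep_funHom, funRep_etaS]

/-- The translations and reflections in the affine Weyl group are linearly independent
over `K(Y)`. -/
theorem coeff_eq_zero_of_sum_eq_zero {qh : Kˣ} (hroot : ∀ k : ℤ, (qh : K) ^ k = 1 → k = 0)
    (s : Finset ℕ) (k l : ℕ → ℤ) (hk : Function.Injective k) (hl : Function.Injective l)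
    (α β : ℕ → RatFunc K)
    (h : ∀ f : RatFunc K, ∑ j ∈ s, (α j * (shift qh ^ k j) f +
      β j * (shift qh ^ l j) (inversion 1 f)) = 0) :
    ∀ j ∈ s, α j = 0 ∧ β j = 0 := by
  -- Dedekind's theorem applies to automorphisms as multiplicative characters. They are told apart
  -- by their values at `Y`, namely `q^(k/2) Y` for translations and `q^(-l/2) Y⁻¹` for reflections.
  let χ : ℕ ⊕ ℕ → (RatFunc K →* RatFunc K) := Sum.elim
    (fun j => ((shift qh ^ k j : RatFunc K ≃ₐ[K] RatFunc K) : RatFunc K →* RatFunc K))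
    (fun j => ((shift qh ^ l j * inversion 1 : RatFunc K ≃ₐ[K] RatFunc K) :
      RatFunc K →* RatFunc K))
  have hX : (RatFunc.X : RatFunc K) ≠ 0 := RatFunc.X_ne_zero
  have hinj : ∀ m n : ℤ, (qh : K) ^ m = (qh : K) ^ n → m = n := by
    intro m n hmn
    rw [← sub_eq_zero]
    apply hroot
    rw [zpow_sub₀ qh.ne_zero, hmn, div_self (zpow_ne_zero _ qh.ne_zero)]
  have v1 : ∀ j, χ (Sum.inl j) RatFunc.X = RatFunc.C ((qh : K) ^ k j) * RatFunc.X :=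
    fun j => shift_zpow_X qh (k j)
  have v2 : ∀ j, χ (Sum.inr j) RatFunc.X = (RatFunc.C ((qh : K) ^ l j) * RatFunc.X)⁻¹ := by
    intro j
    change (shift qh ^ l j) (inversion 1 RatFunc.X) = _
    rw [inversion_X, Units.val_one, map_one, one_div, map_inv₀, shift_zpow_X]
  have hne : ∀ i j, χ (Sum.inl i) ≠ χ (Sum.inr j) := by
    intro i j hij
    have h1 := DFunLike.congr_fun hij RatFunc.X
    rw [v1, v2] at h1
    have hci := C_ne_zero (zpow_ne_zero (k i) qh.ne_zero)
    have hcj := C_ne_zero (zpow_ne_zero (l j) qh.ne_zero)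
    apply one_sub_C_mul_ne_zero ((qh : K) ^ k i * qh ^ l j)⁻¹
    rw [map_inv₀, map_mul, zpow_neg, zpow_ofNat, ← mul_inv, sub_eq_zero, eq_comm, inv_eq_one]
    rw [← mul_eq_one_iff_eq_inv₀ (mul_ne_zero hcj hX)] at h1
    rw [← h1]
    ring
  have hχ : Function.Injective χ := by
    rintro (i | i) (j | j) hij
    · have h1 := DFunLike.congr_fun hij RatFunc.X
      rw [v1, v1] at h1
      rw [hk (hinj _ _ (RatFunc.C_injective (mul_right_cancel₀ hX h1)))]
    · exact absurd hij (hne i j)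
    · exact absurd hij.symm (hne j i)
    · have h1 := DFunLike.congr_fun hij RatFunc.X
      rw [v2, v2, inv_inj] at h1
      rw [hl (hinj _ _ (RatFunc.C_injective (mul_right_cancel₀ hX h1)))]
  have hli := (linearIndependent_monoidHom (RatFunc K) (RatFunc K)).comp χ hχ
  rw [linearIndependent_iff'] at hli
  have hz := hli (s.disjSum s) (Sum.elim α β) (by
    funext f
    rw [Finset.sum_disjSum, ← Finset.sum_add_distrib, Finset.sum_apply, Pi.zero_apply, ← h f]
    rfl)
  exact fun j hj => ⟨hz (Sum.inl j) (by simpa using hj), hz (Sum.inr j) (by simpa using hj)⟩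

/-- The elements `η^k f(Y) 1₀` with distinct `k` are independent. -/
theorem eq_of_sum_symmetrizer (hq : qh ≠ 0) (ht : th ≠ 0)
    (hroot : ∀ k : ℤ, qh ^ k = 1 → k = 0) (s : Finset ℕ) (k : ℕ → ℤ) (hk : Function.Injective k)
    (C D : ℕ → RatFunc K)
    (h : ∑ j ∈ s, etaPow qh th (k j) * ofFun qh th (C j) * symmetrizer qh th =
      ∑ j ∈ s, etaPow qh th (k j) * ofFun qh th (D j) * symmetrizer qh th) :
    ∀ j ∈ s, C j = D j := by
  have h1 : ∑ j ∈ s, etaPow qh th (k j) * funHom qh th (C j - D j) * symmetrizer qh th = 0 := by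
    simp only [ofFun_eq] at h
    simp only [map_sub, mul_sub, sub_mul, Finset.sum_sub_distrib, h, sub_self]
  have h2 := congrArg (funRep hq ht) h1
  simp only [map_sum, map_mul, funRep_etaPow, funRep_funHom, funRep_symmetrizer, map_zero] at h2
  -- The summand `b` of `1₀ = a η_s + b` feeds the translations and `a η_s` the reflections. The
  -- translation part alone suffices, as `b ≠ 0`.
  have h3 := coeff_eq_zero_of_sum_eq_zero (qh := Units.mk0 qh hq) hroot s k k hk hk
    (fun j => (shift (Units.mk0 qh hq) ^ k j) ((C j - D j) * coefB th))
    (fun j => (shift (Units.mk0 qh hq) ^ k j) ((C j - D j) * coefA th)) (by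
      intro f
      refine Eq.trans ?_ (LinearMap.congr_fun h2 f)
      rw [LinearMap.sum_apply]
      refine Finset.sum_congr rfl fun j _ => ?_
      change _ = (shift (Units.mk0 qh hq) ^ k j)
        ((C j - D j) * (coefA th * inversion 1 f + coefB th * f))
      rw [← map_mul, ← map_mul, ← map_add]
      congr 1
      ring)
  intro j hj
  have h4 := (h3 j hj).1
  rw [EmbeddingLike.map_eq_zero_iff, mul_eq_zero, sub_eq_zero] at h4
  exact h4.resolve_right (coefB_ne_zero ht)

theorem inversion_mul_shift_zpow (qh : Kˣ) (k : ℤ) :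
    inversion 1 * shift qh ^ k = shift qh ^ (-k) * inversion 1 := by
  have h : SemiconjBy (inversion 1) (shift qh) (shift qh)⁻¹ := by
    rw [SemiconjBy, shift, mul_inv_rev, ← eq_inv_of_mul_eq_one_left (inversion_mul_self _),
      ← eq_inv_of_mul_eq_one_left (inversion_mul_self _), mul_assoc]
  rw [zpow_neg, ← inv_zpow]
  exact h.zpow_right k

/-- The elements `1₀ η^k f(Y)` with distinct `k` are independent. -/
theorem eq_of_symmetrizer_sum (hq : qh ≠ 0) (ht : th ≠ 0)
    (hroot : ∀ k : ℤ, qh ^ k = 1 → k = 0) (s : Finset ℕ) (k : ℕ → ℤ) (hk : Function.Injective k)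
    (C D : ℕ → RatFunc K)
    (h : ∑ j ∈ s, symmetrizer qh th * etaPow qh th (k j) * ofFun qh th (C j) =
      ∑ j ∈ s, symmetrizer qh th * etaPow qh th (k j) * ofFun qh th (D j)) :
    ∀ j ∈ s, C j = D j := by
  have h1 : ∑ j ∈ s, symmetrizer qh th * etaPow qh th (k j) * funHom qh th (C j - D j) = 0 := by
    simp only [ofFun_eq] at h
    simp only [map_sub, mul_sub, Finset.sum_sub_distrib, h, sub_self]
  have h2 := congrArg (funRep hq ht) h1
  simp only [map_sum, map_mul, funRep_etaPow, funRep_funHom, funRep_symmetrizer, map_zero] at h2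
  -- Here the reflection in `1₀` stands to the left of the translation by `k`; moving it to the
  -- right replaces `k` by `-k`.
  have h3 := coeff_eq_zero_of_sum_eq_zero (qh := Units.mk0 qh hq) hroot s k (fun j => -k j) hk
    (fun _ _ hij => hk (neg_injective hij))
    (fun j => coefB th * (shift (Units.mk0 qh hq) ^ k j) (C j - D j))
    (fun j => coefA th * (shift (Units.mk0 qh hq) ^ (-k j)) (inversion 1 (C j - D j))) (by
      intro f
      refine Eq.trans ?_ (LinearMap.congr_fun h2 f)
      rw [LinearMap.sum_apply]
      refine Finset.sum_congr rfl fun j _ => ?_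
      change _ = coefA th * (inversion 1 * shift (Units.mk0 qh hq) ^ k j : RatFunc K ≃ₐ[K] _)
          ((C j - D j) * f) +
        coefB th * (shift (Units.mk0 qh hq) ^ k j) ((C j - D j) * f)
      rw [inversion_mul_shift_zpow, AlgEquiv.mul_apply, map_mul, map_mul, map_mul]
      ring)
  intro j hj
  have h4 := (h3 j hj).1
  rw [mul_eq_zero, EmbeddingLike.map_eq_zero_iff, sub_eq_zero] at h4
  exact h4.resolve_left (coefB_ne_zero ht)

end FunctionRep

/-! ### The polynomial representation on Laurent polynomials -/

section PolynomialRep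

open LaurentPolynomial

/-- The monomial basis of the Laurent polynomials. -/
def monomialBasis (K : Type*) [Field K] : Module.Basis ℤ K K[T;T⁻¹] := AddMonoidAlgebra.basis ℤ K

theorem monomialBasis_apply (n : ℤ) : monomialBasis K n = T n :=
  AddMonoidAlgebra.basis_apply K n

/-- The image of `x^n` under the Demazure-Lusztig operator. -/
def heckeMonomial (th : K) : ℤ → K[T;T⁻¹]
  | Int.ofNat k => th • T (-(k : ℤ)) -
      (th - th⁻¹) • ∑ i ∈ Finset.range k, T ((k : ℤ) - 2 * i - 2)
  | Int.negSucc k => th • T ((k : ℤ) + 1) +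
      (th - th⁻¹) • ∑ i ∈ Finset.range (k + 1), T (2 * (i : ℤ) - (k + 1))

theorem heckeMonomial_natCast (th : K) (k : ℕ) : heckeMonomial th k = th • T (-(k : ℤ)) -
    (th - th⁻¹) • ∑ i ∈ Finset.range k, T ((k : ℤ) - 2 * i - 2) := rfl

theorem heckeMonomial_neg_natCast (th : K) (k : ℕ) : heckeMonomial th (-(k : ℤ)) =
    th • T (k : ℤ) + (th - th⁻¹) • ∑ i ∈ Finset.range k, T (2 * (i : ℤ) - k) := by
  cases k with
  | zero => simpa using heckeMonomial_natCast th 0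
  | succ k =>
    rw [show -((k + 1 : ℕ) : ℤ) = Int.negSucc k from rfl, heckeMonomial]
    push_cast
    rfl

/-- With `s : x ↦ x⁻¹`, `heckeMonomial` is the closed form of `th s + (th - th⁻¹) (s - 1) / (x² -
1)` on monomials. This one-step recursion is the relation `T₁ X = X⁻¹ (T₁ - (th - th⁻¹))` evaluated
on `x^n`. -/
theorem heckeMonomial_add_one (th : K) (n : ℤ) : heckeMonomial th (n + 1) =
    T (-1) * heckeMonomial th n - (th - th⁻¹) • T (n - 1) := by
  rcases Int.eq_nat_or_neg n with ⟨k, rfl | rfl⟩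
  · have h := heckeMonomial_natCast th (k + 1)
    push_cast at h
    rw [h, heckeMonomial_natCast, Finset.sum_range_succ', mul_sub, mul_smul_comm, mul_smul_comm,
      ← T_add, Finset.mul_sum, smul_add, ← sub_sub]
    congr 2
    · congr 2
      ring
    · congr 1
      refine Finset.sum_congr rfl fun i _ => ?_
      rw [← T_add]
      congr 1
      push_cast
      ring
    · congr 1
      push_cast
      ring
  · cases k with
    | zero =>
      have h := heckeMonomial_natCast th 1
      have h0 := heckeMonomial_natCast th 0
      simp only [Nat.cast_zero, neg_zero, Nat.cast_one, zero_add] at *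
      rw [h, h0]
      simp [T_zero]
    | succ k =>
      rw [heckeMonomial_neg_natCast]
      have h : (-((k + 1 : ℕ) : ℤ) + 1) = -(k : ℤ) := by push_cast; ring
      rw [h, heckeMonomial_neg_natCast, Finset.sum_range_succ', mul_add, mul_smul_comm,
        mul_smul_comm, ← T_add, mul_add, ← T_add, smul_add, Finset.mul_sum, ← add_assoc,
        add_sub_assoc]
      have e : ((-1 : ℤ) + (2 * ((0 : ℕ) : ℤ) - ((k + 1 : ℕ) : ℤ))) = -((k + 1 : ℕ) : ℤ) - 1 := by
        push_cast; ring
      rw [e, sub_self, add_zero]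
      congr 2
      · congr 1
        push_cast
        ring
      · refine Finset.sum_congr rfl fun i _ => ?_
        rw [← T_add]
        congr 1
        push_cast
        ring

/-- The Demazure-Lusztig operator by which `T₁` acts on Laurent polynomials. -/
def heckeOp (th : K) : Module.End K K[T;T⁻¹] := (monomialBasis K).constr K (heckeMonomial th)

theorem heckeOp_T (th : K) (n : ℤ) : heckeOp th (T n) = heckeMonomial th n := by
  rw [← monomialBasis_apply, heckeOp, Module.Basis.constr_basis]

/-- The operator `x^n ↦ q^(n/2) x^(-n)` by which `T_π` acts on Laurent polynomials. -/
def piOp (qh : K) : Module.End K K[T;T⁻¹] :=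
  (monomialBasis K).constr K fun n => qh ^ n • T (-n)

theorem piOp_T (qh : K) (n : ℤ) : piOp qh (T n) = qh ^ n • T (-n) := by
  rw [← monomialBasis_apply, piOp, Module.Basis.constr_basis]

/-- Multiplication by `x^n`. -/
abbrev shiftOp (K : Type*) [Field K] (n : ℤ) : Module.End K K[T;T⁻¹] :=
  LinearMap.mulLeft K (T n)

theorem shiftOp_T (m n : ℤ) : shiftOp K m (T n) = T (m + n) := by
  rw [LinearMap.mulLeft_apply, T_add]

theorem shiftOp_mul (m n : ℤ) : shiftOp K m * shiftOp K n = shiftOp K (m + n) := by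
  rw [shiftOp, shiftOp, shiftOp, T_add, LinearMap.mulLeft_mul]
  rfl

theorem shiftOp_zero : shiftOp K 0 = 1 := by
  rw [shiftOp, T_zero, LinearMap.mulLeft_one]
  rfl

theorem end_ext {M : Type*} [AddCommGroup M] [Module K M] {f g : K[T;T⁻¹] →ₗ[K] M}
    (h : ∀ n, f (T n) = g (T n)) : f = g :=
  (monomialBasis K).ext fun n => by rw [monomialBasis_apply, h]

variable {qh th : K}

theorem heckeOp_mul_shiftOp (th : K) : heckeOp th * shiftOp K 1 =
    shiftOp K (-1) * (heckeOp th - (th - th⁻¹) • 1) := by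
  refine end_ext fun n => ?_
  rw [Module.End.mul_apply, Module.End.mul_apply, shiftOp_T, heckeOp_T, add_comm,
    heckeMonomial_add_one, LinearMap.sub_apply, map_sub, heckeOp_T, LinearMap.smul_apply,
    Module.End.one_apply, map_smul, shiftOp_T, LinearMap.mulLeft_apply, neg_add_eq_sub]

theorem heckeOp_mul_shiftOp_neg (th : K) : heckeOp th * shiftOp K (-1) =
    shiftOp K 1 * heckeOp th + (th - th⁻¹) • shiftOp K (-1) := by
  have h := congrArg (fun a => shiftOp K 1 * a * shiftOp K (-1)) (heckeOp_mul_shiftOp th)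
  simp only [mul_assoc, shiftOp_mul] at h
  simp only [← mul_assoc, shiftOp_mul, add_neg_cancel, shiftOp_zero, one_mul, mul_one, sub_mul,
    smul_mul_assoc] at h
  rw [h]
  abel

/-- The defect `Z` of the quadratic relation commutes with multiplication by `x`, as a formal
consequence of the two cross relations, and it kills `1`. Hence it kills every `x^n`, with no
computation on closed forms. -/
theorem heckeOp_mul_heckeOp (ht : th ≠ 0) :
    heckeOp th * heckeOp th = (th - th⁻¹) • heckeOp th + 1 := by
  set Z := heckeOp th * heckeOp th - (th - th⁻¹) • heckeOp th - 1 with hZ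
  have hcomm : Commute Z (shiftOp K 1) := by
    have h1 := heckeOp_mul_shiftOp th
    have h2 := heckeOp_mul_shiftOp_neg th
    rw [commute_iff_eq, hZ]
    clear_value Z
    clear hZ
    generalize th - th⁻¹ = h at *
    rw [sub_mul, sub_mul, smul_mul_assoc, mul_assoc, h1, ← mul_assoc, h2]
    simp only [add_mul, mul_sub, smul_mul_assoc, mul_smul_comm, mul_assoc, mul_one, one_mul,
      smul_sub, smul_add]
    abel
  have hpow : ∀ n : ℤ, Commute Z (shiftOp K n) := by
    let u : (Module.End K K[T;T⁻¹])ˣ := ⟨shiftOp K 1, shiftOp K (-1),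
      by rw [shiftOp_mul, add_neg_cancel, shiftOp_zero],
      by rw [shiftOp_mul, neg_add_cancel, shiftOp_zero]⟩
    have hu : ∀ n : ℤ, ((u ^ n : _ˣ) : Module.End K K[T;T⁻¹]) = shiftOp K n := by
      intro n
      induction n with
      | zero => simp [shiftOp_zero]
      | succ n ih => rw [zpow_add_one, Units.val_mul, ih, ← shiftOp_mul]
      | pred n ih => rw [zpow_sub_one, Units.val_mul, ih, sub_eq_add_neg, ← shiftOp_mul]; rfl
    intro n
    rw [← hu]
    exact Commute.units_zpow_right (u := u) hcomm n
  have hone : Z (T 0) = 0 := by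
    have h0 : heckeOp th (T 0) = th • T 0 := by
      rw [heckeOp_T]
      have := heckeMonomial_natCast th 0
      simpa using this
    have e : th * th - (th - th⁻¹) * th - 1 = 0 := by field_simp; ring
    rw [hZ, LinearMap.sub_apply, LinearMap.sub_apply, Module.End.mul_apply, h0, map_smul, h0,
      LinearMap.smul_apply, h0, Module.End.one_apply, smul_smul, smul_smul, ← sub_smul]
    nth_rw 2 [← one_smul K (T 0)]
    rw [← sub_smul, e, zero_smul]
  have hzero : Z = 0 := by
    refine end_ext fun n => ?_
    have := LinearMap.congr_fun (hpow n).eq (T 0)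
    rw [Module.End.mul_apply, Module.End.mul_apply, shiftOp_T, add_zero, hone, map_zero] at this
    rw [this, LinearMap.zero_apply]
  rw [hZ, sub_sub, sub_eq_zero] at hzero
  exact hzero

theorem piOp_mul_shiftOp (hq : qh ≠ 0) :
    piOp qh * shiftOp K 1 = qh • (shiftOp K (-1) * piOp qh) := by
  refine end_ext fun n => ?_
  rw [LinearMap.smul_apply, Module.End.mul_apply, Module.End.mul_apply, shiftOp_T, piOp_T, piOp_T,
    map_smul, shiftOp_T, smul_smul, zpow_one_add₀ hq, neg_add]

theorem piOp_mul_piOp (hq : qh ≠ 0) : piOp qh * piOp qh = 1 := by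
  refine end_ext fun n => ?_
  rw [Module.End.mul_apply, piOp_T, map_smul, piOp_T, smul_smul, ← zpow_add₀ hq, add_neg_cancel,
    zpow_zero, one_smul, neg_neg, Module.End.one_apply]

/-- The operators by which the generators act on Laurent polynomials. -/
def polyAct (qh th : K) : Gen → Module.End K K[T;T⁻¹]
  | .T => heckeOp th
  | .Tinv => heckeOp th - (th - th⁻¹) • 1
  | .X => shiftOp K 1
  | .Xinv => shiftOp K (-1)
  | .Y => piOp qh * heckeOp th
  | .Yinv => (heckeOp th - (th - th⁻¹) • 1) * piOp qh
  | .P => piOp qh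
  | .Pinv => piOp qh

theorem polyAct_rel (hq : qh ≠ 0) (ht : th ≠ 0) ⦃a b : FreeAlgebra K Gen⦄ (h : Rel qh th a b) :
    FreeAlgebra.lift K (polyAct qh th) a = FreeAlgebra.lift K (polyAct qh th) b := by
  have h1 : heckeOp th * (heckeOp th - (th - th⁻¹) • 1) = 1 := by
    rw [mul_sub, heckeOp_mul_heckeOp ht, mul_smul_comm, mul_one]; abel
  have h2 : (heckeOp th - (th - th⁻¹) • 1) * heckeOp th = 1 := by
    rw [sub_mul, heckeOp_mul_heckeOp ht, smul_mul_assoc, one_mul]; abel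
  have hP := piOp_mul_piOp hq
  cases h <;> simp only [map_mul, map_one, map_smul, map_sub, map_add, map_zero, AlgHom.commutes,
    FreeAlgebra.lift_ι_apply, polyAct]
  case T_Tinv => exact h1
  case Tinv_T => exact h2
  case X_Xinv => rw [shiftOp_mul, add_neg_cancel, shiftOp_zero]
  case Xinv_X => rw [shiftOp_mul, neg_add_cancel, shiftOp_zero]
  case Y_Yinv => rw [mul_assoc, ← mul_assoc (heckeOp th), h1, one_mul, hP]
  case Yinv_Y => rw [mul_assoc, ← mul_assoc (piOp qh), hP, one_mul, h2]
  case P_Pinv => exact hP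
  case Pinv_P => exact hP
  case P_eq_Y_Tinv => rw [mul_assoc, h1, mul_one]
  case P_eq_T_Yinv => rw [← mul_assoc, h1, one_mul]
  case P_X_Pinv => rw [piOp_mul_shiftOp hq, smul_mul_assoc, mul_assoc, hP, mul_one]
  case T_X_T => rw [heckeOp_mul_shiftOp, mul_assoc, h2, mul_one]
  case T_Yinv_T => rw [← mul_assoc, h1, one_mul]
  case quadratic =>
    rw [sub_mul, mul_add, mul_add, heckeOp_mul_heckeOp ht, ← map_mul, mul_inv_cancel₀ ht, map_one,
      ← Algebra.commutes, ← Algebra.smul_def, ← Algebra.smul_def]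
    module

/-- The polynomial representation on Laurent polynomials. -/
def polyHom (hq : qh ≠ 0) (ht : th ≠ 0) : DAHA qh th →ₐ[K] Module.End K K[T;T⁻¹] :=
  RingQuot.liftAlgHom K ⟨FreeAlgebra.lift K (polyAct qh th), polyAct_rel hq ht⟩

theorem polyHom_gen (hq : qh ≠ 0) (ht : th ≠ 0) (g : Gen) :
    polyHom hq ht (gen qh th g) = polyAct qh th g := by
  rw [polyHom, gen, RingQuot.liftAlgHom_mkAlgHom_apply, FreeAlgebra.lift_ι_apply]

theorem heckeOp_T_zero (th : K) : heckeOp th (T 0) = th • T 0 := by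
  rw [heckeOp_T]
  simpa using heckeMonomial_natCast th 0

theorem piOp_T_zero (qh : K) : piOp qh (T 0) = T 0 := by
  rw [piOp_T, zpow_zero, one_smul, neg_zero]

variable (qh th) in
/-- The linear map `E ↦ E(X)`. -/
abbrev evalInt : K[T;T⁻¹] →ₗ[K] DAHA qh th := leval K (unitX qh th)

theorem evalInt_T (n : ℤ) : evalInt qh th (T n) = ((unitX qh th ^ n : _ˣ) : DAHA qh th) := by
  rw [leval_apply, smeval_T_pow]

/-- Applying `E(X)` to the constant `1` recovers `E`. Together with `polyHom_apply_eq_zero` this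
shows that `E ↦ E(X) 1_Y` is injective, so the module given by generators and relations does not
collapse. -/
theorem polyHom_evalInt (hq : qh ≠ 0) (ht : th ≠ 0) (f : K[T;T⁻¹]) :
    polyHom hq ht (evalInt qh th f) (T 0) = f := by
  have hX : ∀ n : ℤ, polyHom hq ht ((unitX qh th ^ n : _ˣ) : DAHA qh th) = shiftOp K n := by
    have h1 : polyHom hq ht (unitX qh th : DAHA qh th) = shiftOp K 1 := polyHom_gen hq ht Gen.X
    have h2 : polyHom hq ht ((unitX qh th)⁻¹ : (DAHA qh th)ˣ) = shiftOp K (-1) :=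
      polyHom_gen hq ht Gen.Xinv
    intro n
    induction n with
    | zero => rw [zpow_zero, Units.val_one, map_one, shiftOp_zero]
    | succ n ih => rw [zpow_add_one, Units.val_mul, map_mul, ih, h1, shiftOp_mul]
    | pred n ih => rw [zpow_sub_one, Units.val_mul, map_mul, ih, h2, shiftOp_mul, sub_eq_add_neg]
  have h : (LinearMap.applyₗ (T 0 : K[T;T⁻¹])) ∘ₗ (polyHom hq ht).toLinearMap ∘ₗ evalInt qh th =
      LinearMap.id := by
    refine end_ext fun n => ?_
    change polyHom hq ht (evalInt qh th (T n)) (T 0) = _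
    rw [evalInt_T, hX, shiftOp_T, add_zero, LinearMap.id_apply]
  exact LinearMap.congr_fun h f

/-- The constant `1` satisfies both relations imposed on `1_Y`, so the left ideal defining the
module annihilates it. -/
theorem polyHom_apply_eq_zero (hq : qh ≠ 0) (ht : th ≠ 0) {a : DAHA qh th}
    (h : a • oneY qh th = 0) : polyHom hq ht a (T 0) = 0 := by
  have h1 : a ∈ polyIdeal qh th := by
    rw [← Submodule.Quotient.mk_eq_zero, ← h, oneY, ← Submodule.Quotient.mk_smul, smul_eq_mul,
      mul_one]
  rw [polyIdeal] at h1
  clear h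
  induction h1 using Submodule.span_induction with
  | mem x hx =>
    rcases hx with rfl | rfl
    · rw [map_sub, AlgHom.commutes, polyHom_gen, LinearMap.sub_apply, polyAct, heckeOp_T_zero,
        Module.algebraMap_end_apply, sub_self]
    · rw [map_sub, map_one, polyHom_gen, LinearMap.sub_apply, polyAct, piOp_T_zero,
        Module.End.one_apply, sub_self]
  | zero => rw [map_zero, LinearMap.zero_apply]
  | add x y hx _ ihx ihy =>
    rw [map_add, LinearMap.add_apply, ihx, ihy, add_zero]
  | smul r x _ ihx => rw [smul_eq_mul, map_mul, Module.End.mul_apply, ihx, map_zero]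

end PolynomialRep

/-! ### From the presented module to operators on Laurent polynomials -/

section Macdonald

open LaurentPolynomial

variable {qh th : K}

theorem evalInt_T_mul (n : ℤ) (f : K[T;T⁻¹]) : evalInt qh th (T n * f) =
    ((unitX qh th ^ n : _ˣ) : DAHA qh th) * evalInt qh th f := by
  have h : evalInt qh th ∘ₗ LinearMap.mulLeft K (T n) =
      LinearMap.mulLeft K ((unitX qh th ^ n : _ˣ) : DAHA qh th) ∘ₗ evalInt qh th := by
    refine end_ext fun m => ?_
    rw [LinearMap.comp_apply, LinearMap.comp_apply, LinearMap.mulLeft_apply, ← T_add, evalInt_T,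
      LinearMap.mulLeft_apply, evalInt_T, zpow_add, Units.val_mul]
  exact LinearMap.congr_fun h f

/-- `T₁ f(X)` is the image of `f` under the Demazure-Lusztig operator,
modulo the left ideal generated by `T₁ - t^(1/2)`. -/
theorem T_mul_evalInt (ht : th ≠ 0) (f : K[T;T⁻¹]) : ∃ r : DAHA qh th,
    gen qh th Gen.T * evalInt qh th f =
      evalInt qh th (heckeOp th f) + r * (gen qh th Gen.T - algebraMap K _ th) := by
  have hT : ∀ n : ℤ, ∃ r : DAHA qh th, gen qh th Gen.T * evalInt qh th (T n) =
      evalInt qh th (heckeOp th (T n)) + r * (gen qh th Gen.T - algebraMap K _ th) := by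
    have hX : ((unitX qh th ^ (1 : ℤ) : _ˣ) : DAHA qh th) = gen qh th Gen.X := by
      rw [zpow_one]; rfl
    have hX' : ((unitX qh th ^ (-1 : ℤ) : _ˣ) : DAHA qh th) = gen qh th Gen.Xinv := by
      rw [zpow_neg_one]; rfl
    -- Induct away from `x^0` in both directions. Passing `T₁` through `X` or `X⁻¹` only multiplies
    -- the remainder `r` on the left by `X⁻¹` or `X`, so the error stays in the left ideal.
    intro n
    induction n with
    | zero =>
      refine ⟨1, ?_⟩
      rw [heckeOp_T_zero, map_smul, evalInt_T, zpow_zero, Units.val_one, mul_one, one_mul,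
        Algebra.algebraMap_eq_smul_one]
      abel
    | succ n ih =>
      obtain ⟨r, hr⟩ := ih
      refine ⟨gen qh th Gen.Xinv * r, ?_⟩
      have h1 := LinearMap.congr_fun (heckeOp_mul_shiftOp th) (T (n : ℤ))
      rw [Module.End.mul_apply, Module.End.mul_apply, shiftOp_T, LinearMap.sub_apply,
        LinearMap.smul_apply, Module.End.one_apply] at h1
      rw [add_comm (n : ℤ), h1, LinearMap.mulLeft_apply, evalInt_T_mul, T_add, evalInt_T_mul, hX,
        hX', ← mul_assoc, T_mul_X qh ht, mul_assoc, sub_mul, hr, map_sub, map_smul,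
        smul_mul_assoc, one_mul, mul_assoc, ← mul_add]
      congr 1
      abel
    | pred n ih =>
      obtain ⟨r, hr⟩ := ih
      refine ⟨gen qh th Gen.X * r, ?_⟩
      have h1 := LinearMap.congr_fun (heckeOp_mul_shiftOp_neg th) (T (-(n : ℤ)))
      rw [Module.End.mul_apply, LinearMap.add_apply, Module.End.mul_apply, shiftOp_T,
        LinearMap.smul_apply] at h1
      rw [sub_eq_add_neg, add_comm (-(n : ℤ)), h1, map_add, map_smul, LinearMap.mulLeft_apply,
        LinearMap.mulLeft_apply, evalInt_T_mul, T_add, evalInt_T_mul, hX,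
        hX', ← mul_assoc, T_mul_Xinv qh ht, add_mul, mul_assoc, hr, smul_mul_assoc, mul_add,
        mul_assoc]
      abel
  induction f using LaurentPolynomial.induction_on' with
  | add p q hp hq =>
    obtain ⟨r, hr⟩ := hp
    obtain ⟨s, hs⟩ := hq
    refine ⟨r + s, ?_⟩
    rw [map_add, map_add, map_add, mul_add, hr, hs, add_mul]
    abel
  | C_mul_T n a =>
    obtain ⟨r, hr⟩ := hT n
    refine ⟨a • r, ?_⟩
    rw [← smul_eq_C_mul, map_smul, map_smul, map_smul, mul_smul_comm, hr, smul_add,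
      smul_mul_assoc]

theorem P_mul_evalInt (f : K[T;T⁻¹]) (hq : qh ≠ 0) :
    gen qh th Gen.P * evalInt qh th f = evalInt qh th (piOp qh f) * gen qh th Gen.P := by
  have h1 : gen qh th Gen.P * gen qh th Gen.X =
      qh • (gen qh th Gen.Xinv * gen qh th Gen.P) := by
    rw [← smul_mul_assoc, ← P_mul_X_mul_Pinv, mul_assoc, Pinv_mul_P, mul_one]
  have hu : ∀ n : ℤ, gen qh th Gen.P * ((unitX qh th ^ n : _ˣ) : DAHA qh th) =
      qh ^ n • (((unitX qh th ^ (-n) : _ˣ) : DAHA qh th) * gen qh th Gen.P) := by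
    have h2 : gen qh th Gen.P * ((unitX qh th)⁻¹ : (DAHA qh th)ˣ) =
        qh⁻¹ • ((unitX qh th : DAHA qh th) * gen qh th Gen.P) := by
      have h := congrArg (fun a => gen qh th Gen.X * a * gen qh th Gen.Xinv) h1
      simp only [mul_smul_comm, smul_mul_assoc, mul_assoc, X_mul_Xinv, mul_one] at h
      simp only [← mul_assoc, X_mul_Xinv, one_mul] at h
      change gen qh th Gen.P * gen qh th Gen.Xinv = qh⁻¹ • (gen qh th Gen.X * gen qh th Gen.P)
      rw [h, smul_smul, inv_mul_cancel₀ hq, one_smul]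
    intro n
    induction n with
    | zero => simp
    | succ n ih =>
      rw [zpow_add_one, Units.val_mul, ← mul_assoc, ih, smul_mul_assoc, mul_assoc]
      change qh ^ (n : ℤ) • (_ * (gen qh th Gen.P * gen qh th Gen.X)) = _
      rw [h1, mul_smul_comm, smul_smul, zpow_add_one₀ hq, neg_add, zpow_add, Units.val_mul,
        zpow_neg_one, mul_assoc]
      rfl
    | pred n ih =>
      rw [zpow_sub_one, Units.val_mul, ← mul_assoc, ih, smul_mul_assoc, mul_assoc, h2,
        mul_smul_comm, smul_smul, zpow_sub_one₀ hq, neg_sub, sub_neg_eq_add, neg_neg, add_comm,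
        zpow_add_one, Units.val_mul, mul_assoc]
  have h : LinearMap.mulLeft K (gen qh th Gen.P) ∘ₗ evalInt qh th =
      LinearMap.mulRight K (gen qh th Gen.P) ∘ₗ evalInt qh th ∘ₗ piOp qh := by
    refine end_ext fun n => ?_
    rw [LinearMap.comp_apply, LinearMap.comp_apply, LinearMap.comp_apply, LinearMap.mulLeft_apply,
      LinearMap.mulRight_apply, piOp_T, map_smul, evalInt_T, evalInt_T, hu, smul_mul_assoc]
  exact LinearMap.congr_fun h f

theorem polyHom_Y (hq : qh ≠ 0) (ht : th ≠ 0) :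
    polyHom hq ht (gen qh th Gen.Y) = piOp qh * heckeOp th := polyHom_gen hq ht Gen.Y

/-- One direction lets the eigenvalue equation act on the constant `1`. The other pushes `Y = T_π
T₁` through `E(X)` and uses that `T₁ - t^(1/2)` kills `1_Y` and `T_π` fixes it. -/
theorem isElectronicMacdonald_iff (hq : qh ≠ 0) (ht : th ≠ 0) (m : ℤ) (E : K[T;T⁻¹]) :
    IsElectronicMacdonald qh th m E ↔
      polyHom hq ht (gen qh th Gen.Y) E = eigenvalue qh th m • E ∧ E.coeff m = 1 := by
  refine and_congr_left fun _ => ?_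
  change gen qh th Gen.Y • (evalInt qh th E • oneY qh th) =
    (eigenvalue qh th m • evalInt qh th E) • oneY qh th ↔ _
  constructor
  · intro h
    rw [smul_smul, ← sub_eq_zero, ← sub_smul, ← map_smul] at h
    have h1 := polyHom_apply_eq_zero hq ht h
    rw [map_sub, map_mul, LinearMap.sub_apply, Module.End.mul_apply, polyHom_evalInt,
      polyHom_evalInt, sub_eq_zero] at h1
    exact h1
  · intro h
    obtain ⟨r, hr⟩ := T_mul_evalInt (qh := qh) ht E
    have hT : (gen qh th Gen.T - algebraMap K _ th) • oneY qh th = 0 := by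
      rw [oneY, ← Submodule.Quotient.mk_smul, smul_eq_mul, mul_one, Submodule.Quotient.mk_eq_zero]
      exact Submodule.subset_span (Or.inl rfl)
    have hP : gen qh th Gen.P • oneY qh th = oneY qh th := by
      rw [← sub_eq_zero, ← one_smul (DAHA qh th) (oneY qh th), smul_smul, mul_one, ← sub_smul,
        oneY, ← Submodule.Quotient.mk_smul, smul_eq_mul, mul_one, Submodule.Quotient.mk_eq_zero]
      exact Submodule.subset_span (Or.inr rfl)
    rw [smul_smul, Y_eq_P_mul_T, mul_assoc, hr, mul_add, P_mul_evalInt _ hq, add_smul, mul_smul,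
      hP, ← mul_assoc, mul_smul _ (gen qh th Gen.T - _), hT, smul_zero, add_zero, ← map_smul, ← h,
      polyHom_Y, Module.End.mul_apply]

end Macdonald

/-! ### Construction, triangularity and eigenvalues of the Macdonald polynomials -/

section Macdonald

open LaurentPolynomial

variable {qh th : K}

/-- The Laurent polynomials with exponents in `s`. -/
abbrev supp (K : Type*) [Field K] (s : Set ℤ) : Submodule K K[T;T⁻¹] :=
  AddMonoidAlgebra.supported K K s

theorem T_mem_supp {s : Set ℤ} {n : ℤ} (h : n ∈ s) : (T n : K[T;T⁻¹]) ∈ supp K s := by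
  rw [AddMonoidAlgebra.mem_supported']
  intro m hm
  rw [T_apply, if_neg]
  rintro rfl
  exact hm h

theorem supp_le {s : Set ℤ} {V : Submodule K K[T;T⁻¹]} (h : ∀ n ∈ s, T n ∈ V) : supp K s ≤ V := by
  rw [supp, AddMonoidAlgebra.supported_eq_span_single, Submodule.span_le]
  rintro _ ⟨n, hn, rfl⟩
  exact h n hn

theorem supp_mono {s t : Set ℤ} (h : s ⊆ t) : supp K s ≤ supp K t :=
  AddMonoidAlgebra.supported_mono h

theorem map_mem_supp {s t : Set ℤ} (f : Module.End K K[T;T⁻¹])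
    (h : ∀ n ∈ s, f (T n) ∈ supp K t) {p : K[T;T⁻¹]} (hp : p ∈ supp K s) : f p ∈ supp K t :=
  supp_le (V := (supp K t).comap f) h hp

/-- The last monomial of the sum is `x^(-k)` itself, which lowers its coefficient from `th` to
`th⁻¹`; this explains the factor `th` in `macNeg`. -/
theorem heckeOp_T_natCast_sub (th : K) {k : ℕ} (hk : 0 < k) :
    heckeOp th (T (k : ℤ)) - th⁻¹ • T (-(k : ℤ)) ∈ supp K (Set.Ioo (-(k : ℤ)) k) := by
  obtain ⟨k, rfl⟩ := Nat.exists_eq_succ_of_ne_zero hk.ne'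
  have e : ((k.succ : ℕ) : ℤ) - 2 * (k : ℤ) - 2 = -((k.succ : ℕ) : ℤ) := by push_cast; ring
  rw [heckeOp_T, heckeMonomial_natCast, Finset.sum_range_succ, e]
  have : th • T (-((k.succ : ℕ) : ℤ)) - (th - th⁻¹) •
      (∑ i ∈ Finset.range k, T (((k.succ : ℕ) : ℤ) - 2 * i - 2) + T (-((k.succ : ℕ) : ℤ))) -
      th⁻¹ • T (-((k.succ : ℕ) : ℤ)) =
    -((th - th⁻¹) • ∑ i ∈ Finset.range k, T (((k.succ : ℕ) : ℤ) - 2 * i - 2) : K[T;T⁻¹]) := by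
    module
  rw [this]
  refine neg_mem (Submodule.smul_mem _ _ (Submodule.sum_mem _ fun i hi => T_mem_supp ?_))
  rw [Finset.mem_range] at hi
  rw [Set.mem_Ioo]
  push_cast
  omega

/-- For negative exponents the sum stops short of `x^k`, whose coefficient stays `th`; this explains
the factor `th⁻¹` in `raisePos`. -/
theorem heckeOp_T_neg_natCast_sub (th : K) (k : ℕ) :
    heckeOp th (T (-(k : ℤ))) - th • T (k : ℤ) ∈ supp K (Set.Ico (-(k : ℤ)) k) := by
  rw [heckeOp_T, heckeMonomial_neg_natCast, add_sub_cancel_left]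
  refine Submodule.smul_mem _ _ (Submodule.sum_mem _ fun i hi => T_mem_supp ?_)
  rw [Finset.mem_range] at hi
  rw [Set.mem_Ico]
  omega

theorem heckeOp_T_natCast_mem (th : K) {k : ℕ} (hk : 0 < k) :
    heckeOp th (T (k : ℤ)) ∈ supp K (Set.Ico (-(k : ℤ)) k) := by
  rw [← sub_add_cancel (heckeOp th (T (k : ℤ))) (th⁻¹ • T (-(k : ℤ)))]
  refine add_mem (supp_mono Set.Ioo_subset_Ico_self (heckeOp_T_natCast_sub th hk))
    (Submodule.smul_mem _ _ (T_mem_supp ?_))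
  rw [Set.mem_Ico]
  omega

theorem heckeOp_T_neg_natCast_mem (th : K) (k : ℕ) :
    heckeOp th (T (-(k : ℤ))) ∈ supp K (Set.Icc (-(k : ℤ)) k) := by
  rw [← sub_add_cancel (heckeOp th (T (-(k : ℤ)))) (th • T (k : ℤ))]
  refine add_mem (supp_mono Set.Ico_subset_Icc_self (heckeOp_T_neg_natCast_sub th k))
    (Submodule.smul_mem _ _ (T_mem_supp ?_))
  rw [Set.mem_Icc]
  omega

theorem heckeOp_mem_Ioo (th : K) {k : ℤ} {p : K[T;T⁻¹]} (hp : p ∈ supp K (Set.Ioo (-k) k)) :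
    heckeOp th p ∈ supp K (Set.Ioo (-k) k) := by
  refine map_mem_supp _ (fun n hn => ?_) hp
  rw [Set.mem_Ioo] at hn
  rcases Int.eq_nat_or_neg n with ⟨j, rfl | rfl⟩
  · rcases Nat.eq_zero_or_pos j with rfl | hj
    · rw [Nat.cast_zero, heckeOp_T_zero]
      exact Submodule.smul_mem _ _ (T_mem_supp hn)
    · exact supp_mono (fun m hm => by rw [Set.mem_Ico] at hm; rw [Set.mem_Ioo]; omega)
        (heckeOp_T_natCast_mem th hj)
  · exact supp_mono (fun m hm => by rw [Set.mem_Icc] at hm; rw [Set.mem_Ioo]; omega)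
      (heckeOp_T_neg_natCast_mem th j)

theorem heckeOp_mem_Ico (th : K) {k : ℤ} {p : K[T;T⁻¹]} (hp : p ∈ supp K (Set.Ioc (-k) k)) :
    heckeOp th p ∈ supp K (Set.Ico (-k) k) := by
  refine map_mem_supp _ (fun n hn => ?_) hp
  rw [Set.mem_Ioc] at hn
  rcases Int.eq_nat_or_neg n with ⟨j, rfl | rfl⟩
  · rcases Nat.eq_zero_or_pos j with rfl | hj
    · rw [Nat.cast_zero, heckeOp_T_zero]
      exact Submodule.smul_mem _ _ (T_mem_supp (by rw [Set.mem_Ico]; omega))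
    · exact supp_mono (fun m hm => by rw [Set.mem_Ico] at *; omega)
        (heckeOp_T_natCast_mem th hj)
  · exact supp_mono (fun m hm => by rw [Set.mem_Icc] at hm; rw [Set.mem_Ico]; omega)
      (heckeOp_T_neg_natCast_mem th j)

/-- The constant that makes `T₁ + c` an intertwiner on `E_l`, `l > 0`. -/
def raiseConst (qh th : K) (l : ℕ) : K := th⁻¹ * (1 - th ^ 2) / (1 - th ^ 2 * (qh ^ 2) ^ l)

/-- The polynomial `E_{l+1}` in terms of `E_{-l}`. -/
def raisePos (th : K) (E : K[T;T⁻¹]) : K[T;T⁻¹] := th⁻¹ • shiftOp K 1 (heckeOp th E)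

/-- The polynomial `E_{-l}`, by recursion. -/
def macNeg (qh th : K) : ℕ → K[T;T⁻¹]
  | 0 => T 0
  | l + 1 => th • (heckeOp th (raisePos th (macNeg qh th l)) +
      raiseConst qh th (l + 1) • raisePos th (macNeg qh th l))

/-- The polynomial `E_{l+1}`. -/
def macPos (qh th : K) (l : ℕ) : K[T;T⁻¹] := raisePos th (macNeg qh th l)

theorem macNeg_succ (qh th : K) (l : ℕ) : macNeg qh th (l + 1) =
    th • (heckeOp th (macPos qh th l) + raiseConst qh th (l + 1) • macPos qh th l) := rfl

/-- The electronic Macdonald polynomial `E_m`. -/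
def macdonald (qh th : K) : ℤ → K[T;T⁻¹]
  | Int.ofNat 0 => macNeg qh th 0
  | Int.ofNat (l + 1) => macPos qh th l
  | Int.negSucc l => macNeg qh th (l + 1)

theorem macdonald_add_one (qh th : K) (l : ℕ) : macdonald qh th ((l : ℤ) + 1) = macPos qh th l :=
  rfl

theorem macdonald_neg (qh th : K) (l : ℕ) : macdonald qh th (-(l : ℤ)) = macNeg qh th l := by
  cases l <;> rfl

/-- Half of the induction showing that `E_m` is unitriangular for the order `0, 1, -1, 2, -2, …` of
exponents: `T₁` leaves only exponents in `[-l, l)` below the leading `x^l`, and multiplication by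
`x` moves them inside `(-(l+1), l+1)`. -/
theorem macPos_sub_mem (ht : th ≠ 0) {l : ℕ}
    (h : macNeg qh th l - T (-(l : ℤ)) ∈ supp K (Set.Ioc (-(l : ℤ)) l)) :
    macPos qh th l - T ((l : ℤ) + 1) ∈ supp K (Set.Ioo (-((l : ℤ) + 1)) (l + 1)) := by
  have h1 := add_mem (heckeOp_mem_Ico th h) (heckeOp_T_neg_natCast_sub th l)
  rw [map_sub, sub_add_sub_cancel] at h1
  have h2 : shiftOp K 1 (heckeOp th (macNeg qh th l) - th • T (l : ℤ)) ∈
      supp K (Set.Ioo (-((l : ℤ) + 1)) (l + 1)) := by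
    refine map_mem_supp _ (fun n hn => ?_) h1
    rw [shiftOp_T]
    refine T_mem_supp ?_
    rw [Set.mem_Ico] at hn
    rw [Set.mem_Ioo]
    omega
  have h3 := Submodule.smul_mem _ th⁻¹ h2
  rw [map_sub, smul_sub, map_smul, smul_smul, inv_mul_cancel₀ ht, one_smul, shiftOp_T,
    add_comm (1 : ℤ)] at h3
  exact h3

theorem macNeg_sub_mem (ht : th ≠ 0) (l : ℕ) :
    macNeg qh th l - T (-(l : ℤ)) ∈ supp K (Set.Ioc (-(l : ℤ)) l) := by
  induction l with
  | zero =>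
    rw [macNeg, Nat.cast_zero, neg_zero, sub_self]
    exact zero_mem _
  | succ l ih =>
    have h1 := macPos_sub_mem ht ih
    have h2 := heckeOp_mem_Ioo th h1
    have h3 := heckeOp_T_natCast_sub th (Nat.succ_pos l)
    rw [Nat.cast_succ] at h3
    have h4 := supp_mono Set.Ioo_subset_Ioc_self (add_mem h2 h3)
    rw [map_sub, sub_add_sub_cancel] at h4
    have h5 : macPos qh th l ∈ supp K (Set.Ioc (-((l : ℤ) + 1)) (l + 1)) := by
      rw [← sub_add_cancel (macPos qh th l) (T ((l : ℤ) + 1))]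
      exact add_mem (supp_mono Set.Ioo_subset_Ioc_self h1)
        (T_mem_supp (by rw [Set.mem_Ioc]; omega))
    have h6 := Submodule.smul_mem _ th
      (add_mem h4 (Submodule.smul_mem _ (raiseConst qh th (l + 1)) h5))
    rw [macNeg_succ, Nat.cast_succ]
    convert h6 using 1
    rw [sub_add_eq_add_sub, smul_sub, smul_smul, mul_inv_cancel₀ ht, one_smul]

theorem coeff_eq_zero_of_mem_supp {s : Set ℤ} {p : K[T;T⁻¹]} (hp : p ∈ supp K s) {m : ℤ}
    (hm : m ∉ s) : p.coeff m = 0 := AddMonoidAlgebra.mem_supported'.1 hp m hm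

theorem coeff_macdonald (ht : th ≠ 0) (m : ℤ) : (macdonald qh th m).coeff m = 1 := by
  have key : ∀ (E : K[T;T⁻¹]) (s : Set ℤ), E - T m ∈ supp K s → m ∉ s → E.coeff m = 1 := by
    intro E s h hm
    have := coeff_eq_zero_of_mem_supp h hm
    rw [AddMonoidAlgebra.coeff_sub, Finsupp.sub_apply, T_apply, if_pos rfl, sub_eq_zero] at this
    exact this
  rcases lt_or_ge 0 m with hm | hm
  · obtain ⟨l, rfl⟩ : ∃ l : ℕ, m = l + 1 := ⟨(m - 1).toNat, by omega⟩
    rw [macdonald_add_one]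
    exact key _ _ (macPos_sub_mem ht (macNeg_sub_mem ht l)) (by rw [Set.mem_Ioo]; omega)
  · obtain ⟨l, rfl⟩ : ∃ l : ℕ, m = -l := ⟨(-m).toNat, by omega⟩
    rw [macdonald_neg]
    exact key _ _ (macNeg_sub_mem ht l) (by rw [Set.mem_Ioc]; omega)

/-- Unitriangularity solves successively for the monomials `x^0, x^1, x^(-1), x^2, …`. -/
theorem span_macdonald (ht : th ≠ 0) :
    Submodule.span K (Set.range (macdonald qh th)) = ⊤ := by
  set V := Submodule.span K (Set.range (macdonald qh th)) with hV
  have hmem : ∀ m, macdonald qh th m ∈ V := fun m => Submodule.subset_span ⟨m, rfl⟩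
  have h : ∀ l : ℕ, ∀ n ∈ Set.Icc (-(l : ℤ)) l, (T n : K[T;T⁻¹]) ∈ V := by
    intro l
    induction l with
    | zero =>
      intro n hn
      obtain rfl : n = 0 := by rw [Set.mem_Icc] at hn; push_cast at hn; omega
      exact hmem 0
    | succ l ih =>
      have hpos : (T ((l : ℤ) + 1) : K[T;T⁻¹]) ∈ V := by
        have h1 := supp_le (V := V) (fun n hn => ih n (by
          rw [Set.mem_Ioo] at hn; rw [Set.mem_Icc]; omega))
          (macPos_sub_mem (qh := qh) ht (macNeg_sub_mem ht l))
        have h2 := sub_mem (hmem (l + 1)) h1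
        rwa [macdonald_add_one, sub_sub_cancel] at h2
      intro n hn
      rw [Set.mem_Icc] at hn
      have hle : ∀ n ∈ Set.Ioc (-((l + 1 : ℕ) : ℤ)) ((l + 1 : ℕ) : ℤ), (T n : K[T;T⁻¹]) ∈ V := by
        intro n hn
        rw [Set.mem_Ioc] at hn
        push_cast at hn
        rcases hn.2.eq_or_lt with rfl | h
        · exact hpos
        · exact ih n (by rw [Set.mem_Icc]; omega)
      rcases hn.1.eq_or_lt with rfl | h
      · have h1 := supp_le (V := V) hle (macNeg_sub_mem (qh := qh) ht (l + 1))
        have h2 := sub_mem (hmem (-((l + 1 : ℕ) : ℤ))) h1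
        rwa [macdonald_neg, sub_sub_cancel] at h2
      · exact hle n ⟨h, hn.2⟩
  rw [eq_top_iff, ← (monomialBasis K).span_eq, Submodule.span_le]
  rintro _ ⟨n, rfl⟩
  rw [monomialBasis_apply]
  exact h n.natAbs n (by rw [Set.mem_Icc]; omega)

theorem eigenvalue_ne_zero (hq : qh ≠ 0) (ht : th ≠ 0) (m : ℤ) : eigenvalue qh th m ≠ 0 := by
  rw [eigenvalue]
  refine mul_ne_zero ?_ (zpow_ne_zero _ hq)
  split_ifs
  exacts [inv_ne_zero ht, ht]

theorem Yinv_of_Y (hq : qh ≠ 0) (ht : th ≠ 0) {E : K[T;T⁻¹]} {c : K} (hc : c ≠ 0)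
    (h : polyHom hq ht (gen qh th Gen.Y) E = c • E) :
    polyHom hq ht (gen qh th Gen.Yinv) E = c⁻¹ • E := by
  have h1 := congrArg (polyHom hq ht (gen qh th Gen.Yinv)) h
  rw [← Module.End.mul_apply, ← map_mul, Yinv_mul_Y, map_one, Module.End.one_apply, map_smul] at h1
  rw [h1, smul_smul, inv_mul_cancel₀ hc, one_smul, ← h1]

theorem Y_raisePos (hq : qh ≠ 0) (ht : th ≠ 0) {E : K[T;T⁻¹]} {c : K} (hc : c ≠ 0)
    (h : polyHom hq ht (gen qh th Gen.Y) E = c • E) :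
    polyHom hq ht (gen qh th Gen.Y) (raisePos th E) = (qh⁻¹ * c⁻¹) • raisePos th E := by
  have h1 := congrArg (fun a => polyHom hq ht a E) (Y_mul_XT (th := th) qh hq)
  simp only [map_mul, map_smul, Module.End.mul_apply, LinearMap.smul_apply,
    Yinv_of_Y hq ht hc h] at h1
  have hT : ∀ E, raisePos th E = th⁻¹ • polyHom hq ht (gen qh th Gen.X)
      (polyHom hq ht (gen qh th Gen.T) E) := by
    intro E
    rw [polyHom_gen, polyHom_gen]
    rfl
  rw [hT, map_smul, h1, smul_smul, smul_smul, smul_smul]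
  congr 1
  ring

/-- The hypothesis on `d` says that `d` is the rational term of `τ₁` evaluated at `Y = c` (when `c²
≠ 1`); then `d • E` compensates the inhomogeneous term in `Y T₁ = T₁ Y⁻¹ + (th - th⁻¹) Y`. For `c`
the eigenvalue of `E_l`, `Y⁻²` becomes `t q^l`, which gives `raiseConst`. -/
theorem Y_heckeOp_add (hq : qh ≠ 0) (ht : th ≠ 0) {E : K[T;T⁻¹]} {c d : K} (hc : c ≠ 0)
    (h : polyHom hq ht (gen qh th Gen.Y) E = c • E) (hd : d * (c⁻¹ - c) = (th - th⁻¹) * c) :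
    polyHom hq ht (gen qh th Gen.Y) (th • (heckeOp th E + d • E)) =
      c⁻¹ • (th • (heckeOp th E + d • E)) := by
  have h1 := congrArg (fun a => polyHom hq ht a E) (Y_mul_T qh ht)
  simp only [map_mul, map_smul, map_add, Module.End.mul_apply, LinearMap.add_apply,
    LinearMap.smul_apply, Yinv_of_Y hq ht hc h, h] at h1
  have hT : polyHom hq ht (gen qh th Gen.T) = heckeOp th := polyHom_gen hq ht Gen.T
  rw [hT] at h1
  rw [map_smul, map_add, h1, map_smul, h, smul_comm _ th]
  congr 1
  rw [smul_add, add_assoc, smul_smul, smul_smul, smul_smul, ← add_smul, ← hd]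
  congr 2
  ring

theorem Y_macdonald (hq : qh ≠ 0) (ht : th ≠ 0)
    (hgen : ∀ a b : ℤ, (qh ^ 2) ^ a * (th ^ 2) ^ b = 1 → a = 0 ∧ b = 0) (m : ℤ) :
    polyHom hq ht (gen qh th Gen.Y) (macdonald qh th m) =
      eigenvalue qh th m • macdonald qh th m := by
  have hraise : ∀ l : ℕ, polyHom hq ht (gen qh th Gen.Y) (macNeg qh th l) =
      eigenvalue qh th (-(l : ℤ)) • macNeg qh th l →
      polyHom hq ht (gen qh th Gen.Y) (macPos qh th l) =
      eigenvalue qh th ((l : ℤ) + 1) • macPos qh th l := by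
    intro l h
    rw [macPos, Y_raisePos hq ht (eigenvalue_ne_zero hq ht _) h]
    congr 1
    rw [eigenvalue, eigenvalue, if_neg (by omega), if_pos (by omega), neg_neg, neg_add, zpow_add₀ hq,
      zpow_neg, zpow_neg_one, mul_inv]
    ring
  have hneg : ∀ l : ℕ, polyHom hq ht (gen qh th Gen.Y) (macNeg qh th l) =
      eigenvalue qh th (-(l : ℤ)) • macNeg qh th l := by
    intro l
    induction l with
    | zero =>
      rw [macNeg, polyHom_Y, Module.End.mul_apply, heckeOp_T_zero, map_smul, piOp_T_zero]
      simp [eigenvalue]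
    | succ l ih =>
      have hinv : eigenvalue qh th (-((l + 1 : ℕ) : ℤ)) = (eigenvalue qh th ((l : ℤ) + 1))⁻¹ := by
        rw [eigenvalue, eigenvalue, if_neg (by omega), if_pos (by omega), mul_inv, inv_inv, neg_neg,
          ← zpow_neg, neg_neg, Nat.cast_succ]
      rw [macNeg_succ, hinv]
      refine Y_heckeOp_add hq ht (eigenvalue_ne_zero hq ht _) (hraise l ih) ?_
      have hne : 1 - th ^ 2 * (qh ^ 2) ^ (l + 1) ≠ 0 := by
        intro h
        have := hgen ((l + 1 : ℕ) : ℤ) 1 (by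
          rw [zpow_natCast, zpow_one, mul_comm]
          exact (sub_eq_zero.1 h).symm)
        omega
      rw [eigenvalue, if_pos (by omega), raiseConst, zpow_neg, ← Nat.cast_succ, zpow_natCast,
        Nat.succ_eq_add_one]
      rw [← pow_mul, mul_comm 2, pow_mul] at *
      have := pow_ne_zero (l + 1) hq
      generalize qh ^ (l + 1) = Q at *
      field_simp
      ring
  rcases lt_or_ge 0 m with hm | hm
  · obtain ⟨l, rfl⟩ : ∃ l : ℕ, m = l + 1 := ⟨(m - 1).toNat, by omega⟩
    exact hraise l (hneg l)
  · obtain ⟨l, rfl⟩ : ∃ l : ℕ, m = -l := ⟨(-m).toNat, by omega⟩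
    rw [macdonald_neg]
    exact hneg l

theorem eigenvalue_injective (hq : qh ≠ 0) (ht : th ≠ 0)
    (hgen : ∀ a b : ℤ, (qh ^ 2) ^ a * (th ^ 2) ^ b = 1 → a = 0 ∧ b = 0) :
    Function.Injective (eigenvalue qh th) := by
  -- Genericity concerns `q` and `t`, not their square roots, so squares of eigenvalues are
  -- compared; the exponent of `q` alone determines `m`.
  have hpow : ∀ m, eigenvalue qh th m ^ 2 =
      (qh ^ 2) ^ (-m) * (th ^ 2) ^ (if 0 < m then -1 else 1 : ℤ) := by
    intro m
    have e : (qh ^ (-m)) ^ 2 = (qh ^ 2) ^ (-m) := by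
      rw [← zpow_natCast, ← zpow_natCast, ← zpow_mul, ← zpow_mul, mul_comm]
    rw [eigenvalue, mul_pow, e, mul_comm]
    congr 1
    split_ifs <;> simp
  intro m n hmn
  have h1 : eigenvalue qh th m ^ 2 / eigenvalue qh th n ^ 2 = 1 := by
    rw [hmn]
    exact div_self (pow_ne_zero _ (eigenvalue_ne_zero hq ht n))
  have hq2 := pow_ne_zero 2 hq
  have ht2 := pow_ne_zero 2 ht
  rw [hpow, hpow, mul_div_mul_comm, ← zpow_sub₀ hq2, ← zpow_sub₀ ht2] at h1
  have := (hgen _ _ h1).1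
  omega

/-- Expand an eigenvector in the eigenbasis. The eigenvalues are distinct, so only the term of index
`m` survives, and its coefficient is read off at `x^m`. -/
theorem eq_coeff_smul_macdonald (hq : qh ≠ 0) (ht : th ≠ 0)
    (hgen : ∀ a b : ℤ, (qh ^ 2) ^ a * (th ^ 2) ^ b = 1 → a = 0 ∧ b = 0) {m : ℤ} {E : K[T;T⁻¹]}
    (h : polyHom hq ht (gen qh th Gen.Y) E = eigenvalue qh th m • E) :
    E = E.coeff m • macdonald qh th m := by
  have hne : ∀ n, macdonald qh th n ≠ 0 := by
    intro n h0
    have := coeff_macdonald (qh := qh) ht n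
    rw [h0, AddMonoidAlgebra.coeff_zero, Finsupp.zero_apply] at this
    exact zero_ne_one this
  have hli : LinearIndependent K (macdonald qh th) :=
    Module.End.eigenvectors_linearIndependent' (polyHom hq ht (gen qh th Gen.Y)) _
      (eigenvalue_injective hq ht hgen) _ fun n =>
        ⟨Module.End.mem_eigenspace_iff.2 (Y_macdonald hq ht hgen n), hne n⟩
  have hE : E ∈ Submodule.span K (Set.range (macdonald qh th)) := by
    rw [span_macdonald ht]; trivial
  rw [Finsupp.mem_span_range_iff_exists_finsupp] at hE
  obtain ⟨c, rfl⟩ := hE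
  rw [Finsupp.sum, map_sum, Finset.smul_sum, ← sub_eq_zero, ← Finset.sum_sub_distrib] at h
  rw [linearIndependent_iff'] at hli
  have h1 := hli c.support (fun n => c n * (eigenvalue qh th n - eigenvalue qh th m)) (by
    rw [← h]
    refine Finset.sum_congr rfl fun n _ => ?_
    rw [map_smul, Y_macdonald hq ht hgen, smul_smul, smul_smul, ← sub_smul]
    congr 1
    ring)
  have h2 : ∀ n, n ≠ m → c n = 0 := by
    intro n hn
    by_contra hcn
    have := h1 n (Finsupp.mem_support_iff.2 hcn)
    rcases mul_eq_zero.1 this with h3 | h3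
    · exact hcn h3
    · exact hn (eigenvalue_injective hq ht hgen (sub_eq_zero.1 h3))
  have h3 : c = Finsupp.single m (c m) := by
    ext n
    rcases eq_or_ne n m with rfl | hn
    · rw [Finsupp.single_eq_same]
    · rw [h2 n hn, Finsupp.single_eq_of_ne hn]
  rw [h3, Finsupp.sum_single_index (h := fun n a => a • macdonald qh th n) (zero_smul K _),
    AddMonoidAlgebra.coeff_smul,
    Finsupp.smul_apply, coeff_macdonald ht, smul_eq_mul, mul_one]

theorem isElectronicMacdonald_iff_eq (hq : qh ≠ 0) (ht : th ≠ 0)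
    (hgen : ∀ a b : ℤ, (qh ^ 2) ^ a * (th ^ 2) ^ b = 1 → a = 0 ∧ b = 0) (m : ℤ) (E : K[T;T⁻¹]) :
    IsElectronicMacdonald qh th m E ↔ E = macdonald qh th m := by
  rw [isElectronicMacdonald_iff hq ht]
  constructor
  · rintro ⟨h1, h2⟩
    rw [eq_coeff_smul_macdonald hq ht hgen h1, h2, one_smul]
  · rintro rfl
    exact ⟨Y_macdonald hq ht hgen m, coeff_macdonald ht m⟩

/-! ### The recursion for `E_m(X) 1₀` -/

/-- Thus `1₀` obeys the first relation of `1_Y`. That is enough to transport the recursion for `E_m`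
to `E_m(X) 1₀`, because the recursion involves only `X` and `T₁`, not `T_π`. -/
theorem intHom_T_mul_symmetrizer :
    intHom qh th (gen qh th Gen.T - algebraMap K _ th) * symmetrizer qh th = 0 := by
  rw [symmetrizer, ofInt_eq, ← AlgHom.commutes (intHom qh th), ← map_add, ← map_mul]
  have h := RingQuot.mkAlgHom_rel K (Rel.quadratic (qh := qh) (th := th))
  simp only [map_mul, map_sub, map_add, AlgHom.commutes, map_zero] at h
  change (gen qh th Gen.T - algebraMap K _ th) * (gen qh th Gen.T + algebraMap K _ th⁻¹) = 0 at h
  rw [h, map_zero]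

theorem intHom_T_mul_evalX (ht : th ≠ 0) (f : K[T;T⁻¹]) :
    intHom qh th (gen qh th Gen.T) * (evalX qh th f * symmetrizer qh th) =
      evalX qh th (heckeOp th f) * symmetrizer qh th := by
  obtain ⟨r, hr⟩ := T_mul_evalInt (qh := qh) ht f
  change intHom qh th _ * (intHom qh th (evalInt qh th f) * _) =
    intHom qh th (evalInt qh th _) * _
  rw [← mul_assoc, ← map_mul, hr, map_add, map_mul, add_mul, mul_assoc _ _ (symmetrizer qh th),
    intHom_T_mul_symmetrizer, mul_zero, add_zero]

theorem evalX_smul (c : K) (f : K[T;T⁻¹]) : evalX qh th (c • f) = c • evalX qh th f := by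
  change intHom qh th (evalInt qh th (c • f)) = c • intHom qh th (evalInt qh th f)
  rw [map_smul, map_smul]

theorem evalX_add (f g : K[T;T⁻¹]) : evalX qh th (f + g) = evalX qh th f + evalX qh th g := by
  change intHom qh th (evalInt qh th (f + g)) =
    intHom qh th (evalInt qh th f) + intHom qh th (evalInt qh th g)
  rw [map_add, map_add]

theorem evalX_macPos (ht : th ≠ 0) (l : ℕ) : evalX qh th (macPos qh th l) * symmetrizer qh th =
    th⁻¹ • (etaPi qh th * (evalX qh th (macNeg qh th l) * symmetrizer qh th)) := by
  have hX : ∀ f : K[T;T⁻¹], evalX qh th (shiftOp K 1 f) =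
      intHom qh th (gen qh th Gen.X) * evalX qh th f := by
    intro f
    change intHom qh th (evalInt qh th (T 1 * f)) = intHom qh th _ * intHom qh th (evalInt qh th f)
    rw [evalInt_T_mul, zpow_one, map_mul]
    rfl
  rw [macPos, raisePos, evalX_smul, hX, smul_mul_assoc, mul_assoc, ← intHom_T_mul_evalX ht, etaPi,
    ofInt_eq, map_mul, mul_assoc]

theorem evalX_macNeg_succ (ht : th ≠ 0) (l : ℕ) :
    evalX qh th (macNeg qh th (l + 1)) * symmetrizer qh th =
    th • ((intHom qh th (gen qh th Gen.T) + algebraMap K _ (raiseConst qh th (l + 1))) *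
      (evalX qh th (macPos qh th l) * symmetrizer qh th)) := by
  rw [macNeg_succ, evalX_smul, evalX_add, evalX_smul, smul_mul_assoc, add_mul, add_mul,
    intHom_T_mul_evalX ht, ← Algebra.smul_def, smul_mul_assoc]

theorem evalX_macNeg_zero : evalX qh th (macNeg qh th 0) = 1 := by
  change intHom qh th (evalInt qh th (T 0)) = 1
  rw [evalInt_T, zpow_zero, Units.val_one, map_one]

end Macdonald

/-! ### Identities between Pochhammer quotients -/

section Pochhammer

theorem qPoch_zero {R : Type*} [CommRing R] (z q : R) : qPoch z q 0 = 1 := rfl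

theorem qPoch_succ {R : Type*} [CommRing R] (z q : R) (n : ℕ) :
    qPoch z q (n + 1) = qPoch z q n * (1 - z * q ^ n) := Finset.prod_range_succ _ _

theorem qPoch_succ' {R : Type*} [CommRing R] (z q : R) (n : ℕ) :
    qPoch z q (n + 1) = (1 - z) * qPoch (z * q) q n := by
  rw [qPoch, Finset.prod_range_succ', pow_zero, mul_one, mul_comm, qPoch]
  congr 1
  refine Finset.prod_congr rfl fun i _ => ?_
  rw [pow_succ]
  ring

theorem map_qPoch {R S : Type*} [CommRing R] [CommRing S] (f : R →+* S) (z q : R) (n : ℕ) :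
    f (qPoch z q n) = qPoch (f z) (f q) n := by
  simp [qPoch]

variable {F : Type*} [Field F]

theorem qPoch_ne_zero {z q : F} {n : ℕ} (h : ∀ i < n, 1 - z * q ^ i ≠ 0) : qPoch z q n ≠ 0 :=
  Finset.prod_ne_zero_iff.2 fun i hi => h i (Finset.mem_range.1 hi)

/-- Inversion of a Pochhammer symbol. -/
theorem qPoch_inversion {z q : F} (hz : z ≠ 0) (hq : q ≠ 0) (m : ℕ) :
    qPoch z q m = (-z) ^ m * (∏ i ∈ Finset.range m, q ^ i) *
      qPoch (z⁻¹ * q ^ (1 - (m : ℤ))) q m := by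
  -- Factor by factor, `1 - z q^i = -z q^i (1 - z⁻¹ q^(-i))`; reversing the order makes the
  -- exponents increase again.
  rw [qPoch, qPoch, ← Finset.prod_range_reflect (fun i => 1 - z⁻¹ * q ^ (1 - (m : ℤ)) * q ^ i),
    ← Finset.card_range m, ← Finset.prod_const, Finset.card_range, ← Finset.prod_mul_distrib,
    ← Finset.prod_mul_distrib]
  refine Finset.prod_congr rfl fun i hi => ?_
  rw [Finset.mem_range] at hi
  have e : q ^ (1 - (m : ℤ)) * q ^ (m - 1 - i) = (q ^ i)⁻¹ := by
    rw [← zpow_natCast, ← zpow_natCast, ← zpow_add₀ hq, ← zpow_neg]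
    congr 1
    omega
  rw [mul_assoc z⁻¹, e]
  have := pow_ne_zero i hq
  field_simp
  ring

/-- The parameters `q`, `t`, `y` are generic enough for all denominators to be nonzero. -/
structure IsGeneric (q t y : F) : Prop where
  q_ne : q ≠ 0
  t_ne : t ≠ 0
  y_ne : y ≠ 0
  one_sub_q : ∀ n : ℕ, 1 - q * q ^ n ≠ 0
  one_sub_t : ∀ n : ℕ, 1 - t * q ^ n ≠ 0
  one_sub_y : ∀ n : ℤ, 1 - y * q ^ n ≠ 0
  one_sub_ty : ∀ n : ℤ, 1 - t * y * q ^ n ≠ 0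
  one_sub_ty' : ∀ n : ℤ, 1 - t⁻¹ * y * q ^ n ≠ 0

/-- The scalar `(q)_{i+j} (t)_j (t)_{i+1} / ((t)_{i+j+1} (q)_j (q)_i)`. -/
def scalarForm (q t : F) (i j : ℕ) : F :=
  qPoch q q (i + j) * qPoch t q j * qPoch t q (i + 1) /
    (qPoch t q (i + j + 1) * qPoch q q j * qPoch q q i)

/-- The reduced form of `D_j^{(i+j)}`, up to a monomial. -/
def posForm (q t y : F) (i j : ℕ) : F :=
  scalarForm q t i j *
    ((qPoch (t⁻¹ * y * q ^ (1 - (j : ℤ))) q i * qPoch (t * y * q ^ ((i : ℤ) - j + 1)) q j) /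
      (qPoch (y * q) q i * qPoch (y * q ^ (-(j : ℤ))) q j))

/-- The reduced form of `D_j^{(-i-j)}`, up to a monomial. -/
def negForm (q t y : F) (i j : ℕ) : F :=
  scalarForm q t i j *
    ((qPoch (t⁻¹ * y * q ^ (-(i : ℤ))) q j * qPoch (t * y * q ^ ((j : ℤ) - i)) q i) /
      (qPoch (y * q) q j * qPoch (y * q ^ (-(i : ℤ))) q i))

/-- The reduced form of `K_j^{(i+j)}`, up to a monomial. -/
def symForm (q t y : F) (i j : ℕ) : F :=
  (qPoch q q (i + j) * qPoch t q j * qPoch t q i /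
    (qPoch t q (i + j) * qPoch q q j * qPoch q q i)) *
    ((qPoch (t⁻¹ * y * q ^ (1 - (j : ℤ))) q i * qPoch (t * y * q ^ ((i : ℤ) - j)) q j) /
      (qPoch (y * q) q i * qPoch (y * q ^ (-(j : ℤ))) q j))

/-- Inverting each of the four Pochhammer symbols turns the quotient at `y⁻¹` into the one at `y`,
up to a monomial. This is the formula-level trace of multiplication by `η_π`, which replaces `Y` by
`Y⁻¹`. -/
theorem negForm_inv {q t y : F} (hq : q ≠ 0) (ht : t ≠ 0) (hy : y ≠ 0) (i j : ℕ) :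
    (q * t) ^ j * negForm q t y⁻¹ i j = t ^ i * posForm q t y i j := by
  have hz : ∀ n : ℤ, q ^ n ≠ 0 := fun n => zpow_ne_zero n hq
  rw [negForm, qPoch_inversion (z := t⁻¹ * y⁻¹ * _) (by simp [*]) hq,
    qPoch_inversion (z := t * y⁻¹ * _) (by simp [*]) hq,
    qPoch_inversion (z := y⁻¹ * q) (by simp [*]) hq,
    qPoch_inversion (z := y⁻¹ * q ^ _) (by simp [*]) hq, posForm]
  have e1 : (t⁻¹ * y⁻¹ * q ^ (-(i : ℤ)))⁻¹ * q ^ (1 - (j : ℤ)) = t * y * q ^ ((i : ℤ) - j + 1) := by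
    rw [mul_inv, mul_inv, inv_inv, inv_inv, ← zpow_neg, mul_assoc, ← zpow_add₀ hq]
    congr 2
    ring
  have e2 : (t * y⁻¹ * q ^ ((j : ℤ) - i))⁻¹ * q ^ (1 - (i : ℤ)) = t⁻¹ * y * q ^ (1 - (j : ℤ)) := by
    rw [mul_inv, mul_inv, inv_inv, ← zpow_neg, mul_assoc, ← zpow_add₀ hq]
    congr 2
    ring
  have e3 : (y⁻¹ * q)⁻¹ * q ^ (1 - (j : ℤ)) = y * q ^ (-(j : ℤ)) := by
    rw [mul_inv, inv_inv, mul_assoc, ← zpow_neg_one, ← zpow_add₀ hq]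
    congr 2
    ring
  have e4 : (y⁻¹ * q ^ (-(i : ℤ)))⁻¹ * q ^ (1 - (i : ℤ)) = y * q := by
    rw [mul_inv, inv_inv, ← zpow_neg, mul_assoc, ← zpow_add₀ hq, neg_neg, add_sub_cancel, zpow_one]
  rw [e1, e2, e3, e4]
  have hi : (∏ k ∈ Finset.range i, q ^ k) ≠ 0 :=
    Finset.prod_ne_zero_iff.2 fun _ _ => pow_ne_zero _ hq
  have hj : (∏ k ∈ Finset.range j, q ^ k) ≠ 0 :=
    Finset.prod_ne_zero_iff.2 fun _ _ => pow_ne_zero _ hq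
  generalize (∏ k ∈ Finset.range i, q ^ k) = Qi at *
  generalize (∏ k ∈ Finset.range j, q ^ k) = Qj at *
  generalize qPoch (t * y * q ^ ((i : ℤ) - j + 1)) q j = p1
  generalize qPoch (t⁻¹ * y * q ^ (1 - (j : ℤ))) q i = p2
  generalize qPoch (y * q ^ (-(j : ℤ))) q j = p3
  generalize qPoch (y * q) q i = p4
  -- The triangular powers of `q` cancel between numerator and denominator; `key` compares the
  -- remaining monomial prefactors.
  have key : (q * t) ^ j * ((-(t⁻¹ * y⁻¹ * q ^ (-(i : ℤ)))) ^ j * (-(t * y⁻¹ * q ^ ((j : ℤ) - i))) ^ i) =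
      t ^ i * ((-(y⁻¹ * q)) ^ j * (-(y⁻¹ * q ^ (-(i : ℤ)))) ^ i) := by
    have h1 : (q ^ (-(i : ℤ))) ^ j * (q ^ (j : ℤ)) ^ i = 1 := by
      rw [← zpow_natCast, ← zpow_natCast, ← zpow_mul, ← zpow_mul, ← zpow_add₀ hq]
      rw [show -(i : ℤ) * j + j * i = 0 by ring, zpow_zero]
    have h2 : t ^ j * t⁻¹ ^ j = 1 := by rw [← mul_pow, mul_inv_cancel₀ ht, one_pow]
    rw [sub_eq_add_neg, zpow_add₀ hq, neg_pow, neg_pow (t * _ * _), neg_pow (y⁻¹ * q),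
      neg_pow (y⁻¹ * q ^ (-(i : ℤ)))]
    simp only [mul_pow]
    linear_combination ((-1) ^ i * (-1) ^ j * q ^ j * y⁻¹ ^ j * y⁻¹ ^ i * t ^ i *
      (q ^ (-(i : ℤ))) ^ i) * (t ^ j * t⁻¹ ^ j * h1 + h2)
  have hA : (-(y⁻¹ * q)) ^ j ≠ 0 := pow_ne_zero _ (by simp [*])
  have hB : (-(y⁻¹ * q ^ (-(i : ℤ)))) ^ i ≠ 0 := pow_ne_zero _ (by simp [*])
  generalize (-(y⁻¹ * q)) ^ j = A at *
  generalize (-(y⁻¹ * q ^ (-(i : ℤ)))) ^ i = B at *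
  generalize (-(t⁻¹ * y⁻¹ * q ^ (-(i : ℤ)))) ^ j = C at *
  generalize (-(t * y⁻¹ * q ^ ((j : ℤ) - i))) ^ i = D at *
  rw [mul_left_comm, mul_left_comm (t ^ i)]
  congr 1
  have e : C * Qj * p1 * (D * Qi * p2) / (A * Qj * p3 * (B * Qi * p4)) =
      (C * D) / (A * B) * (p2 * p1 / (p4 * p3)) := by
    rw [div_mul_div_comm, ← mul_div_mul_right (C * D * (p2 * p1)) _ (mul_ne_zero hi hj)]
    congr 1 <;> ring
  rw [e, ← mul_assoc, ← mul_div_assoc ((q * t) ^ j), key, mul_div_assoc,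
    div_self (mul_ne_zero hA hB), mul_one]

/-! ### Contiguity relations for the Pochhammer quotients -/

section Recursion

variable {q t y : F}

theorem IsGeneric.qPoch_q (h : IsGeneric q t y) (n : ℕ) : qPoch q q n ≠ 0 :=
  qPoch_ne_zero fun i _ => h.one_sub_q i

theorem IsGeneric.qPoch_t (h : IsGeneric q t y) (n : ℕ) : qPoch t q n ≠ 0 :=
  qPoch_ne_zero fun i _ => h.one_sub_t i

theorem IsGeneric.qPoch_y (h : IsGeneric q t y) (k : ℤ) (n : ℕ) : qPoch (y * q ^ k) q n ≠ 0 :=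
  qPoch_ne_zero fun i _ => by
    rw [mul_assoc, ← zpow_natCast, ← zpow_add₀ h.q_ne]
    exact h.one_sub_y _

theorem IsGeneric.qPoch_yq (h : IsGeneric q t y) (n : ℕ) : qPoch (y * q) q n ≠ 0 := by
  simpa using h.qPoch_y 1 n

theorem negForm_zero_right (h : IsGeneric q t y) (i : ℕ) :
    negForm q t y (i + 1) 0 = (1 - t * (y * q ^ (-((i : ℤ) + 1)))) /
      (1 - y * q ^ (-((i : ℤ) + 1))) * negForm q t y i 0 := by
  have hs : ∀ i, scalarForm q t i 0 = 1 := by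
    intro i
    have h1 := h.qPoch_q i
    have h2 := h.qPoch_t (i + 1)
    simp only [scalarForm, qPoch_zero, add_zero, mul_one]
    field_simp
  have e : ∀ c : F, c * q ^ (-((i : ℤ) + 1)) * q = c * q ^ (-(i : ℤ)) := by
    intro c
    rw [mul_assoc, ← zpow_add_one₀ h.q_ne]
    congr 2
    ring
  simp only [negForm, hs, qPoch_zero, one_mul, Nat.cast_zero, zero_sub, Nat.cast_add,
    Nat.cast_one]
  rw [qPoch_succ', qPoch_succ', e, e, mul_div_mul_comm, mul_assoc t y]

theorem negForm_zero_left (h : IsGeneric q t y) (j : ℕ) :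
    q ^ (j + 1) * t * negForm q t y 0 (j + 1) =
      (1 - t) * (t * q ^ (j + 1) - y * q ^ (j + 1)) /
        ((1 - t * q ^ (j + 1)) * (1 - y * q ^ (j + 1))) * posForm q t y j 0 := by
  have hs : scalarForm q t j 0 = 1 := by
    have h1 := h.qPoch_q j
    have h2 := h.qPoch_t (j + 1)
    simp only [scalarForm, qPoch_zero, add_zero, mul_one]
    field_simp
  have h1 := h.qPoch_q (j + 1)
  have h2 := h.qPoch_t (j + 1)
  have h3 := h.one_sub_t (j + 1)
  have h4 := h.one_sub_y (j + 1 : ℕ)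
  have h5 := h.qPoch_yq j
  have ht := h.t_ne
  rw [zpow_natCast] at h4
  rw [posForm, hs]
  simp only [negForm, qPoch_zero, scalarForm, zero_add, one_mul, mul_one, Nat.cast_zero,
     neg_zero, zpow_zero, sub_zero, zpow_one]
  rw [qPoch_succ t q (j + 1), qPoch_succ (y * q), qPoch_succ' (t⁻¹ * y),
    mul_assoc y q, ← pow_succ', qPoch_succ t q 0, qPoch_zero, pow_zero, mul_one, one_mul]
  generalize qPoch q q (j + 1) = p1 at *
  generalize qPoch t q (j + 1) = p2 at *
  generalize qPoch (y * q) q j = p3 at *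
  generalize qPoch (t⁻¹ * y * q) q j = p4 at *
  generalize q ^ (j + 1) = J at *
  field_simp

/-- The three quotients share all but a few boundary factors of their Pochhammer symbols. Once the
common parts are split off, an identity of rational functions in `t`, `w`, `q^(i+1)` and `q^(j+1)`
remains. -/
theorem negForm_succ_succ (h : IsGeneric q t y) (i j : ℕ) :
    q ^ (j + 1) * t * negForm q t y (i + 1) (j + 1) =
      q ^ (j + 1) * t * ((1 - t * (y * q ^ ((j : ℤ) - i))) / (1 - y * q ^ ((j : ℤ) - i)) *
        negForm q t y i (j + 1)) +
      (1 - t) * (t * q ^ (i + j + 2) - y * q ^ ((j : ℤ) - i)) /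
        ((1 - t * q ^ (i + j + 2)) * (1 - y * q ^ ((j : ℤ) - i))) * posForm q t y j (i + 1) := by
  -- `w` is the smallest shift of `y` that occurs; in terms of it every remaining power of `q` has a
  -- natural exponent.
  obtain ⟨w, hw⟩ : ∃ w, w = y * q ^ (-((i : ℤ) + 1)) := ⟨_, rfl⟩
  have hq := h.q_ne
  have ht := h.t_ne
  have hy : y = w * q ^ (i + 1) := by
    rw [hw, mul_assoc, ← zpow_natCast, ← zpow_add₀ hq]
    push_cast
    rw [neg_add_cancel, zpow_zero, mul_one]
  have hyz : y * q ^ ((j : ℤ) - i) = w * q ^ (j + 1) := by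
    rw [hw, mul_assoc, ← zpow_natCast, ← zpow_add₀ hq]
    push_cast
    congr 2
    ring
  have a1 := h.qPoch_q (i + j + 1)
  have a2 := h.qPoch_t (i + j + 2)
  have a3 := h.one_sub_t (i + j + 2)
  have a4 := h.one_sub_q i
  have a5 := h.one_sub_q j
  rw [← pow_succ'] at a4 a5
  have a6 := h.qPoch_q i
  have a7 := h.qPoch_q j
  have a8 := h.qPoch_yq j
  have a9 := h.qPoch_y (-(i : ℤ)) i
  have b1 := h.one_sub_y (j + 1 : ℕ)
  have b2 := h.one_sub_y (-((i : ℤ) + 1))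
  have b3 := h.one_sub_y ((j : ℤ) - i)
  rw [← hw] at b2
  rw [hyz] at b3
  rw [zpow_natCast] at b1
  have ew : y * q ^ (-(i : ℤ)) = w * q := by
    rw [hw, mul_assoc, ← zpow_add_one₀ hq]
    congr 2
    ring
  have ew2 : y * q ^ ((j : ℤ) + 1 - i) = w * q ^ (j + 1) * q := by
    rw [← hyz, mul_assoc, ← zpow_add_one₀ hq]
    congr 2
    ring
  rw [ew] at a9
  simp only [negForm, posForm, scalarForm, Nat.cast_add, Nat.cast_one, mul_assoc t⁻¹ y,
    mul_assoc t y, ew, ew2, ← hw, hyz]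
  rw [show (j : ℤ) + 1 - (i + 1) = j - i by ring, show (1 : ℤ) - (i + 1) = -i by ring,
    show (j : ℤ) - (i + 1) + 1 = j - i by ring, hyz, ew]
  rw [show i + 1 + (j + 1) = i + j + 1 + 1 by ring, show i + (j + 1) = i + j + 1 by ring,
    show j + (i + 1) = i + j + 1 by ring, show i + j + 1 + 1 = i + j + 2 by ring]
  rw [qPoch_succ q q (i + j + 1), qPoch_succ t q (i + j + 2), qPoch_succ t q (i + 1),
    qPoch_succ q q i, qPoch_succ q q j, qPoch_succ' (t⁻¹ * w), qPoch_succ' (t * (w * q ^ (j + 1))),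
    qPoch_succ' w, qPoch_succ (y * q), qPoch_succ (t⁻¹ * (w * q))]
  rw [mul_assoc y q, mul_assoc t⁻¹ w q, mul_assoc t (w * _) q, mul_assoc t⁻¹ (w * q),
    mul_assoc w q]
  simp only [← pow_succ', show i + j + 1 + 1 = i + j + 2 by ring]
  generalize qPoch (y * q) q j = p1 at *
  have e : q ^ (i + j + 2) = q ^ (i + 1) * q ^ (j + 1) := by rw [← pow_add]; congr 1; ring
  rw [e] at a3 ⊢
  rw [hy] at b1 ⊢
  clear hyz ew ew2 hw hy e h
  generalize qPoch q q (i + j + 1) = p2 at *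
  generalize qPoch t q (i + j + 2) = p3 at *
  generalize qPoch q q i = p4 at *
  generalize qPoch q q j = p5 at *
  generalize qPoch (w * q) q i = p6 at *
  generalize qPoch t q (j + 1) = p7 at *
  generalize qPoch t q (i + 1) = p8 at *
  generalize qPoch (t⁻¹ * (w * q)) q j = p9 at *
  generalize qPoch (t * (w * q ^ (j + 1) * q)) q i = p10 at *
  generalize q ^ (i + 1) = I at *
  generalize q ^ (j + 1) = J at *
  -- The denominators are kept as atoms while fractions are cleared and are expanded only for the
  -- final polynomial identity.
  obtain ⟨d1, hd1⟩ : ∃ d, d = 1 - t * (I * J) := ⟨_, rfl⟩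
  obtain ⟨d2, hd2⟩ : ∃ d, d = 1 - w * I * J := ⟨_, rfl⟩
  obtain ⟨d3, hd3⟩ : ∃ d, d = 1 - w * J := ⟨_, rfl⟩
  obtain ⟨d4, hd4⟩ : ∃ d, d = 1 - I := ⟨_, rfl⟩
  obtain ⟨d5, hd5⟩ : ∃ d, d = 1 - J := ⟨_, rfl⟩
  rw [← hd1] at a3 ⊢
  rw [← hd2] at b1 ⊢
  rw [← hd3] at b3 ⊢
  rw [← hd4] at a4 ⊢
  rw [← hd5] at a5 ⊢
  field_simp
  rw [hd1, hd2, hd3, hd4, hd5]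
  ring

theorem IsGeneric.t_sub_ne (h : IsGeneric q t y) (n : ℤ) : t - y * q ^ n ≠ 0 := by
  have h1 := mul_ne_zero h.t_ne (h.one_sub_ty' n)
  rwa [mul_sub, mul_one, mul_assoc, mul_inv_cancel_left₀ h.t_ne] at h1

theorem symForm_zero_right (h : IsGeneric q t y) (i : ℕ) :
    symForm q t y (i + 1) 0 * ((1 - y * q ^ (i + 1)) / (1 - t⁻¹ * y * q ^ (i + 1))) =
      posForm q t y i 0 := by
  have a1 := h.qPoch_q (i + 1)
  have a2 := h.qPoch_t (i + 1)
  have a3 := h.qPoch_q i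
  have a5 := h.qPoch_yq i
  have a6 := h.one_sub_y (i + 1 : ℕ)
  have a7 := h.one_sub_ty' (i + 1 : ℕ)
  rw [zpow_natCast] at a6 a7
  simp only [symForm, posForm, scalarForm, qPoch_zero, add_zero, mul_one, Nat.cast_zero, neg_zero,
    zpow_zero, sub_zero, zpow_one]
  rw [qPoch_succ (y * q), qPoch_succ (t⁻¹ * y * q), mul_assoc y q, mul_assoc _ q, ← pow_succ']
  generalize qPoch q q (i + 1) = p1 at *
  generalize qPoch t q (i + 1) = p2 at *
  generalize qPoch q q i = p3 at *
  generalize qPoch (y * q) q i = p5 at *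
  generalize qPoch (t⁻¹ * y * q) q i = p6 at *
  generalize 1 - t⁻¹ * y * q ^ (i + 1) = p7 at *
  generalize 1 - y * q ^ (i + 1) = p8 at *
  field_simp

theorem symForm_zero_left (h : IsGeneric q t y) (j : ℕ) :
    symForm q t y 0 (j + 1) * ((1 - y * q ^ (-((j : ℤ) + 1))) /
      (1 - t⁻¹ * y * q ^ (-((j : ℤ) + 1)))) =
      t * ((1 - t * y * q ^ (-((j : ℤ) + 1))) / (t - y * q ^ (-((j : ℤ) + 1))) *
        negForm q t y j 0) := by
  have a1 := h.qPoch_q (j + 1)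
  have a2 := h.qPoch_t (j + 1)
  have a3 := h.qPoch_q j
  have a5 := h.qPoch_y (-(j : ℤ)) j
  have a6 := h.one_sub_y (-((j : ℤ) + 1))
  have a7 := h.t_sub_ne (-((j : ℤ) + 1))
  have ht := h.t_ne
  have e : ∀ c : F, c * q ^ (-((j : ℤ) + 1)) * q = c * q ^ (-(j : ℤ)) := by
    intro c
    rw [mul_assoc, ← zpow_add_one₀ h.q_ne]
    congr 2
    ring
  simp only [symForm, negForm, scalarForm, qPoch_zero, add_zero, zero_add, mul_one, one_mul,
    Nat.cast_zero, zero_sub, Nat.cast_add, Nat.cast_one]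
  rw [qPoch_succ' (y * _), qPoch_succ' (t * y * _), e, e, mul_assoc t y, mul_assoc t⁻¹ y]
  generalize qPoch q q (j + 1) = p1 at *
  generalize qPoch t q (j + 1) = p2 at *
  generalize qPoch q q j = p3 at *
  generalize qPoch (y * q ^ (-(j : ℤ))) q j = p5 at *
  generalize qPoch (t * y * q ^ (-(j : ℤ))) q j = p6 at *
  generalize y * q ^ (-((j : ℤ) + 1)) = w at *
  field_simp

/-- The same reduction as for `negForm_succ_succ`. The left side is an interior `K_j`; the right
side adds the term from the function `b` in the right-hand `1₀` and the term from its `η_s`. -/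
theorem symForm_succ_succ (h : IsGeneric q t y) (i j : ℕ) :
    symForm q t y (i + 1) (j + 1) * ((1 - y * q ^ ((i : ℤ) - j)) /
      (1 - t⁻¹ * y * q ^ ((i : ℤ) - j))) =
      posForm q t y i (j + 1) + (1 - t * y * q ^ ((i : ℤ) - j)) / (t - y * q ^ ((i : ℤ) - j)) *
        (q ^ (i + 1) * t * negForm q t y j (i + 1)) := by
  obtain ⟨w, hw⟩ : ∃ w, w = y * q ^ (-((j : ℤ) + 1)) := ⟨_, rfl⟩
  have hq := h.q_ne
  have ht := h.t_ne
  have hy : y = w * q ^ (j + 1) := by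
    rw [hw, mul_assoc, ← zpow_natCast, ← zpow_add₀ hq]
    push_cast
    rw [neg_add_cancel, zpow_zero, mul_one]
  have hyz : y * q ^ ((i : ℤ) - j) = w * q ^ (i + 1) := by
    rw [hw, mul_assoc, ← zpow_natCast, ← zpow_add₀ hq]
    push_cast
    congr 2
    ring
  have a1 := h.qPoch_q (i + j + 1)
  have a2 := h.qPoch_t (i + j + 2)
  have a4 := h.one_sub_q i
  have a5 := h.one_sub_q j
  rw [← pow_succ'] at a4 a5
  have a6 := h.qPoch_q i
  have a7 := h.qPoch_q j
  have a8 := h.qPoch_yq i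
  have a9 := h.qPoch_y (-(j : ℤ)) j
  have b1 := h.one_sub_y (i + 1 : ℕ)
  have b2 := h.one_sub_y (-((j : ℤ) + 1))
  have b3 := h.t_sub_ne ((i : ℤ) - j)
  rw [← hw] at b2
  rw [hyz] at b3
  rw [zpow_natCast] at b1
  have ew : y * q ^ (-(j : ℤ)) = w * q := by
    rw [hw, mul_assoc, ← zpow_add_one₀ hq]
    congr 2
    ring
  have ew2 : y * q ^ ((i : ℤ) + 1 - j) = w * q ^ (i + 1) * q := by
    rw [← hyz, mul_assoc, ← zpow_add_one₀ hq]
    congr 2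
    ring
  rw [ew] at a9
  simp only [symForm, negForm, posForm, scalarForm, Nat.cast_add, Nat.cast_one, mul_assoc t⁻¹ y,
    mul_assoc t y, ew, ew2, ← hw, hyz]
  rw [show (i : ℤ) + 1 - (j + 1) = i - j by ring, show (1 : ℤ) - (j + 1) = -j by ring,
    show (i : ℤ) - (j + 1) + 1 = i - j by ring, hyz, ew]
  rw [show i + 1 + (j + 1) = i + j + 2 by ring, show i + (j + 1) + 1 = i + j + 2 by ring,
    show j + (i + 1) + 1 = i + j + 2 by ring,
    show i + (j + 1) = i + j + 1 by ring,
    show j + (i + 1) = i + j + 1 by ring, qPoch_succ q q (i + j + 1),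
    qPoch_succ q q i, qPoch_succ q q j, qPoch_succ (t⁻¹ * (w * q)),
    qPoch_succ' (t * (w * q ^ (i + 1))), qPoch_succ' w, qPoch_succ (y * q)]
  rw [mul_assoc y q, mul_assoc t (w * _) q, mul_assoc t⁻¹ (w * q), mul_assoc w q]
  simp only [← pow_succ', show i + j + 1 + 1 = i + j + 2 by ring]
  generalize qPoch (y * q) q i = p1 at *
  have e : q ^ (i + j + 2) = q ^ (i + 1) * q ^ (j + 1) := by rw [← pow_add]; congr 1; ring
  rw [e]
  rw [hy] at b1 ⊢
  clear hyz ew ew2 hw hy e h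
  generalize qPoch q q (i + j + 1) = p2 at *
  generalize qPoch t q (i + j + 2) = p3 at *
  generalize qPoch q q i = p4 at *
  generalize qPoch q q j = p5 at *
  generalize qPoch (w * q) q j = p6 at *
  generalize qPoch t q (j + 1) = p7 at *
  generalize qPoch t q (i + 1) = p8 at *
  generalize qPoch (t⁻¹ * (w * q)) q i = p9 at *
  generalize qPoch (t * (w * q ^ (i + 1) * q)) q j = p10 at *
  generalize q ^ (i + 1) = I at *
  generalize q ^ (j + 1) = J at *
  obtain ⟨d2, hd2⟩ : ∃ d, d = 1 - w * J * I := ⟨_, rfl⟩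
  obtain ⟨d3, hd3⟩ : ∃ d, d = t - w * I := ⟨_, rfl⟩
  obtain ⟨d4, hd4⟩ : ∃ d, d = 1 - I := ⟨_, rfl⟩
  obtain ⟨d5, hd5⟩ : ∃ d, d = 1 - J := ⟨_, rfl⟩
  have e : 1 - t⁻¹ * (w * I) = t⁻¹ * d3 := by
    rw [hd3, mul_sub, inv_mul_cancel₀ ht]
  rw [e]
  rw [← hd2] at b1 ⊢
  rw [← hd3] at b3 ⊢
  rw [← hd4] at a4 ⊢
  rw [← hd5] at a5 ⊢
  field_simp
  rw [hd2, hd4, hd5]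
  ring

end Recursion

end Pochhammer

/-! ### The product formulas in reduced form, with `l = i + j` -/

section Coefficients

variable {qh th : K}

theorem isGeneric_ratFunc (hq : qh ≠ 0) (ht : th ≠ 0)
    (hgen : ∀ a b : ℤ, (qh ^ 2) ^ a * (th ^ 2) ^ b = 1 → a = 0 ∧ b = 0) :
    IsGeneric (RatFunc.C (qh ^ 2)) (RatFunc.C (th ^ 2)) (RatFunc.X ^ (-2 : ℤ)) := by
  have hq2 := pow_ne_zero 2 hq
  have ht2 := pow_ne_zero 2 ht
  have hy : ∀ (c : K) (n : ℤ), (1 - RatFunc.C c * RatFunc.X ^ (-2 : ℤ) *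
      RatFunc.C (qh ^ 2) ^ n : RatFunc K) ≠ 0 := by
    intro c n
    rw [← map_zpow₀, mul_right_comm, ← map_mul]
    exact one_sub_C_mul_ne_zero _
  refine ⟨C_ne_zero hq2, C_ne_zero ht2, zpow_ne_zero _ RatFunc.X_ne_zero, fun n => ?_, fun n => ?_,
    fun n => ?_, fun n => hy _ n, fun n => ?_⟩
  · rw [← map_one RatFunc.C, ← map_pow, ← map_mul, ← map_sub]
    refine C_ne_zero fun h => ?_
    have := (hgen (n + 1 : ℕ) 0 (by
      rw [zpow_zero, mul_one, zpow_natCast, pow_succ']; exact (sub_eq_zero.1 h).symm)).1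
    omega
  · rw [← map_one RatFunc.C, ← map_pow, ← map_mul, ← map_sub]
    refine C_ne_zero fun h => ?_
    have := (hgen n 1 (by
      rw [zpow_one, zpow_natCast, mul_comm]; exact (sub_eq_zero.1 h).symm)).2
    omega
  · simpa using hy 1 n
  · rw [← map_inv₀]
    exact hy _ n

theorem mono_eq (q c : K) (n : ℤ) :
    mono q c n = RatFunc.C c * RatFunc.X ^ (-2 : ℤ) * RatFunc.C q ^ n := by
  rw [mono, map_mul, map_zpow₀]
  ring

theorem dPos_eq (hq : qh ≠ 0) (ht : th ≠ 0)
    (hgen : ∀ a b : ℤ, (qh ^ 2) ^ a * (th ^ 2) ^ b = 1 → a = 0 ∧ b = 0) (i j : ℕ) :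
    dPos qh th (i + j) j = RatFunc.C th ^ (-((i : ℤ) + j + 1)) * (RatFunc.C (th ^ 2) ^ i *
      posForm (RatFunc.C (qh ^ 2)) (RatFunc.C (th ^ 2)) (RatFunc.X ^ (-2 : ℤ)) i j) := by
  have h := isGeneric_ratFunc hq ht hgen
  have hpow : ∀ n : ℕ, RatFunc.C ((qh ^ 2) ^ n) = RatFunc.C (qh ^ 2) ^ n := fun n => map_pow _ _ _
  rw [dPos, yBinom, posForm, scalarForm]
  simp only [map_mul, map_div₀, map_sub, map_one, mono_eq, map_qPoch, map_zpow₀, qtBinom, one_mul,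
    map_inv₀, Nat.add_sub_cancel, Nat.cast_add, hpow]
  generalize (RatFunc.X : RatFunc K) ^ (-2 : ℤ) = y at *
  generalize RatFunc.C (qh ^ 2) = q at *
  generalize RatFunc.C (th ^ 2) = t at *
  generalize RatFunc.C th = θ at *
  have a1 := h.qPoch_t (i + j)
  have a2 := h.qPoch_yq i
  have a3 := h.one_sub_t (i + j)
  have a4 := h.qPoch_y (-(j : ℤ)) j
  have a6 := h.qPoch_t i
  have a7 := h.qPoch_t j
  have a8 := h.qPoch_q i
  have a9 := h.qPoch_q j
  -- The last factor of the product formula trades the first Pochhammer factor for the next one,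
  -- shifting the base by `q`.
  have e3 : qPoch (t * y * q ^ ((i : ℤ) - j)) q j * ((1 - t * y * q ^ (i : ℤ)) /
      (1 - t * y * q ^ ((i : ℤ) - j))) = qPoch (t * y * q ^ ((i : ℤ) - j + 1)) q j := by
    rw [← mul_div_assoc, div_eq_iff (h.one_sub_ty _), zpow_add_one₀ h.q_ne, ← mul_assoc,
      mul_comm _ (1 - _), mul_comm _ (1 - _), ← qPoch_succ', qPoch_succ, mul_assoc (t * y) _ (q ^ j),
      ← zpow_natCast q j, ← zpow_add₀ h.q_ne, sub_add_cancel, mul_comm]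
  rw [show (i : ℤ) + j - 2 * j = i - j by ring, show (i : ℤ) + j - j = i by ring,
    show -((j : ℤ) - 1) = 1 - j by ring, zpow_one, zpow_natCast t i, qPoch_succ t q (i + j),
    qPoch_succ t q i, ← e3, zpow_natCast q i]
  generalize (1 - t * y * q ^ i) / (1 - t * y * q ^ ((i : ℤ) - j)) = r
  field_simp

theorem dNeg_eq (hq : qh ≠ 0) (ht : th ≠ 0)
    (hgen : ∀ a b : ℤ, (qh ^ 2) ^ a * (th ^ 2) ^ b = 1 → a = 0 ∧ b = 0) (i j : ℕ) :
    dNeg qh th (i + j) j = RatFunc.C th ^ (-((i : ℤ) + j)) *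
      ((RatFunc.C (qh ^ 2) * RatFunc.C (th ^ 2)) ^ j *
      negForm (RatFunc.C (qh ^ 2)) (RatFunc.C (th ^ 2)) (RatFunc.X ^ (-2 : ℤ)) i j) := by
  have h := isGeneric_ratFunc hq ht hgen
  have hpow : ∀ n : ℕ, RatFunc.C ((qh ^ 2) ^ n) = RatFunc.C (qh ^ 2) ^ n := fun n => map_pow _ _ _
  have hpow' : ∀ n : ℕ, RatFunc.C ((qh ^ 2 * th ^ 2) ^ n) =
      (RatFunc.C (qh ^ 2) * RatFunc.C (th ^ 2)) ^ n := fun n => by rw [map_pow, map_mul]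
  rw [dNeg, yBinom, negForm, scalarForm]
  simp only [hpow', map_mul, map_div₀, map_sub, map_one, mono_eq, map_qPoch, map_zpow₀, qtBinom,
    one_mul, map_inv₀, Nat.add_sub_cancel, Nat.add_sub_cancel_left, Nat.cast_add, hpow]
  generalize (RatFunc.X : RatFunc K) ^ (-2 : ℤ) = y at *
  generalize RatFunc.C (qh ^ 2) = q at *
  generalize RatFunc.C (th ^ 2) = t at *
  generalize RatFunc.C th = θ at *
  have a1 := h.qPoch_t (i + j)
  have a2 := h.qPoch_yq j
  have a3 := h.one_sub_t (i + j)
  have a4 := h.qPoch_y (-(i : ℤ)) i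
  have a6 := h.qPoch_t i
  have a7 := h.qPoch_t j
  have a8 := h.qPoch_q i
  have a9 := h.qPoch_q j
  have e3 : qPoch (t⁻¹ * y * q ^ (1 - (i : ℤ))) q j * ((1 - t⁻¹ * y * q ^ (-(i : ℤ))) /
      (1 - t⁻¹ * y * q ^ ((j : ℤ) - i))) = qPoch (t⁻¹ * y * q ^ (-(i : ℤ))) q j := by
    rw [← mul_div_assoc, div_eq_iff (h.one_sub_ty' _), sub_eq_neg_add, zpow_add_one₀ h.q_ne,
      ← mul_assoc, mul_comm _ (1 - _), ← qPoch_succ', qPoch_succ, mul_assoc (t⁻¹ * y) _ (q ^ j),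
      ← zpow_natCast q j, ← zpow_add₀ h.q_ne, neg_add_eq_sub]
  rw [show (i : ℤ) + j - 2 * i = j - i by ring, show (i : ℤ) + j - j = i by ring,
    show -((i : ℤ) - 1) = 1 - i by ring, show -((i : ℤ) + j - 2 * j) = j - i by ring, zpow_one,
    qPoch_succ t q (i + j), qPoch_succ t q i, ← e3, zpow_natCast q i]
  generalize (1 - t⁻¹ * y * q ^ (-(i : ℤ))) / (1 - t⁻¹ * y * q ^ ((j : ℤ) - i)) = r
  field_simp

theorem kCoef_eq (hq : qh ≠ 0) (ht : th ≠ 0)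
    (hgen : ∀ a b : ℤ, (qh ^ 2) ^ a * (th ^ 2) ^ b = 1 → a = 0 ∧ b = 0) (i j : ℕ) :
    kCoef qh th (i + j) j = coefB th * (RatFunc.C th ^ (-((i : ℤ) + j)) *
      (RatFunc.C (th ^ 2) ^ ((i : ℤ) - 1) *
      (symForm (RatFunc.C (qh ^ 2)) (RatFunc.C (th ^ 2)) (RatFunc.X ^ (-2 : ℤ)) i j *
      ((1 - RatFunc.X ^ (-2 : ℤ) * RatFunc.C (qh ^ 2) ^ ((i : ℤ) - j)) /
        (1 - (RatFunc.C (th ^ 2))⁻¹ * RatFunc.X ^ (-2 : ℤ) *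
          RatFunc.C (qh ^ 2) ^ ((i : ℤ) - j)))))) := by
  have h := isGeneric_ratFunc hq ht hgen
  have hθ := C_ne_zero ht
  have hθ2 : RatFunc.C (th ^ 2) = RatFunc.C th ^ 2 := map_pow _ _ _
  have hy := one_sub_Y_ne_zero (K := K)
  rw [kCoef, yBinom, symForm, coefB]
  simp only [map_mul, map_div₀, map_one, mono_eq, map_qPoch, map_zpow₀, qtBinom,
    one_mul, map_inv₀, Nat.add_sub_cancel, Nat.cast_add]
  generalize (RatFunc.X : RatFunc K) ^ (-2 : ℤ) = y at *
  generalize RatFunc.C (qh ^ 2) = q at *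
  generalize RatFunc.C (th ^ 2) = t at *
  generalize RatFunc.C th = θ at *
  have a1 := h.qPoch_t (i + j)
  have a2 := h.qPoch_yq i
  have a4 := h.qPoch_y (-(j : ℤ)) j
  have a6 := h.qPoch_t i
  have a7 := h.qPoch_t j
  have a8 := h.qPoch_q i
  have a9 := h.qPoch_q j
  rw [show (i : ℤ) + j - 2 * j = i - j by ring, show (i : ℤ) + j - 1 - j = i - 1 by ring,
    show -((j : ℤ) - 1) = 1 - j by ring, show -((i : ℤ) + j - 1) = -(i + j) + 1 by ring, zpow_one,
    zpow_zero, mul_one, mul_one, zpow_add_one₀ hθ]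
  -- Up to `t^(-1/2)`, the last factor of `K_j` is `b(Y)`, which is common to both contributions in
  -- the recursion.
  have e : (1 - t⁻¹ * y) / (1 - y) = θ⁻¹ * ((t - y) / (θ * (1 - y))) := by
    have ht0 := h.t_ne
    subst hθ2
    field_simp
  rw [e]
  generalize (t - y) / (θ * (1 - y)) = b
  generalize (1 - y * q ^ ((i : ℤ) - j)) / (1 - t⁻¹ * y * q ^ ((i : ℤ) - j)) = r
  field_simp

/-! ### Recursions for the coefficients -/

theorem inversion_dPos (hq : qh ≠ 0) (ht : th ≠ 0)
    (hgen : ∀ a b : ℤ, (qh ^ 2) ^ a * (th ^ 2) ^ b = 1 → a = 0 ∧ b = 0) (i j : ℕ) :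
    inversion 1 (dPos qh th (i + j) j) = RatFunc.C th⁻¹ * dNeg qh th (i + j) j := by
  have h := isGeneric_ratFunc hq ht hgen
  have hm : ∀ y : RatFunc K, inversion 1 (negForm (RatFunc.C (qh ^ 2)) (RatFunc.C (th ^ 2)) y i j) =
      negForm (RatFunc.C (qh ^ 2)) (RatFunc.C (th ^ 2)) (inversion 1 y) i j := by
    intro y
    have hP : ∀ (z q : RatFunc K) (n : ℕ), inversion 1 (qPoch z q n) =
        qPoch (inversion 1 z) (inversion 1 q) n :=
      fun z q n => map_qPoch ((inversion (1 : Kˣ) : RatFunc K ≃ₐ[K] RatFunc K) :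
        RatFunc K →+* RatFunc K) z q n
    simp only [negForm, scalarForm, map_mul, map_div₀, hP, map_zpow₀, map_inv₀, inversion_C]
  have key : dPos qh th (i + j) j = RatFunc.C th⁻¹ * inversion 1 (dNeg qh th (i + j) j) := by
    rw [dPos_eq hq ht hgen, dNeg_eq hq ht hgen, ← negForm_inv h.q_ne h.t_ne h.y_ne, map_mul,
      map_mul, hm, inversion_one_Y, map_zpow₀, map_pow (inversion 1), map_mul, inversion_C,
      inversion_C, inversion_C, zpow_neg RatFunc.X, inv_inv, neg_add, map_inv₀,
      zpow_add₀ (C_ne_zero ht), zpow_neg_one]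
    ring
  rw [key, map_mul, inversion_C, inversion_inversion]

theorem shift_zpow_C (q : Kˣ) (k : ℤ) (c : K) : (shift q ^ k) (RatFunc.C c) = RatFunc.C c := by
  rw [← RatFunc.algebraMap_eq_C, AlgEquiv.commutes]

theorem shift_zpow_Y (hq : qh ≠ 0) (k : ℤ) :
    (shift (Units.mk0 qh hq) ^ k) (RatFunc.X ^ (-2 : ℤ)) =
      RatFunc.X ^ (-2 : ℤ) * RatFunc.C (qh ^ 2) ^ (-k) := by
  rw [map_zpow₀, shift_zpow_X, Units.val_mk0, mul_zpow, map_zpow₀, map_pow, ← zpow_mul,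
    ← zpow_natCast (RatFunc.C qh), ← zpow_mul, mul_comm]
  congr 2
  push_cast
  ring

theorem shift_zpow_coefA (hq : qh ≠ 0) (k : ℤ) : (shift (Units.mk0 qh hq) ^ k) (coefA th) =
    (1 - RatFunc.C (th ^ 2) * (RatFunc.X ^ (-2 : ℤ) * RatFunc.C (qh ^ 2) ^ (-k))) /
      (RatFunc.C th * (1 - RatFunc.X ^ (-2 : ℤ) * RatFunc.C (qh ^ 2) ^ (-k))) := by
  rw [coefA, map_div₀, map_mul, map_sub, map_sub, map_mul, shift_zpow_Y, shift_zpow_C,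
    shift_zpow_C, map_one]

theorem shift_zpow_coefB (hq : qh ≠ 0) (k : ℤ) : (shift (Units.mk0 qh hq) ^ k) (coefB th) =
    (RatFunc.C (th ^ 2) - RatFunc.X ^ (-2 : ℤ) * RatFunc.C (qh ^ 2) ^ (-k)) /
      (RatFunc.C th * (1 - RatFunc.X ^ (-2 : ℤ) * RatFunc.C (qh ^ 2) ^ (-k))) := by
  rw [coefB, map_div₀, map_mul, map_sub, map_sub, shift_zpow_Y, shift_zpow_C,
    shift_zpow_C, map_one]

/-- The contribution of `η_s` to the recursion for `dNeg`. -/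
def negReflect (hq : qh ≠ 0) (th : K) (l j : ℕ) : RatFunc K :=
  RatFunc.C th * ((shift (Units.mk0 qh hq) ^ ((l : ℤ) + 1 - 2 * j)) (coefA th) *
    inversion 1 (dPos qh th l j))

/-- The contribution of `K(Y)` to the recursion for `dNeg`. -/
def negFix (hq : qh ≠ 0) (th : K) (l j : ℕ) : RatFunc K :=
  RatFunc.C th * ((shift (Units.mk0 qh hq) ^ (-((l : ℤ) + 1 - 2 * j)))
    (coefB th - RatFunc.C th⁻¹ + RatFunc.C (raiseConst qh th (l + 1))) * dPos qh th l j)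

theorem negReflect_eq (hq : qh ≠ 0) (ht : th ≠ 0)
    (hgen : ∀ a b : ℤ, (qh ^ 2) ^ a * (th ^ 2) ^ b = 1 → a = 0 ∧ b = 0) (i j : ℕ) :
    negReflect hq th (i + j) j = RatFunc.C th ^ (-((i : ℤ) + j + 1)) *
      ((RatFunc.C (qh ^ 2) * RatFunc.C (th ^ 2)) ^ j *
      ((1 - RatFunc.C (th ^ 2) * (RatFunc.X ^ (-2 : ℤ) * RatFunc.C (qh ^ 2) ^ ((j : ℤ) - i - 1))) /
        (1 - RatFunc.X ^ (-2 : ℤ) * RatFunc.C (qh ^ 2) ^ ((j : ℤ) - i - 1)) *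
      negForm (RatFunc.C (qh ^ 2)) (RatFunc.C (th ^ 2)) (RatFunc.X ^ (-2 : ℤ)) i j)) := by
  have hθ := C_ne_zero ht
  rw [negReflect, inversion_dPos hq ht hgen, dNeg_eq hq ht hgen, shift_zpow_coefA, Nat.cast_add,
    show -((i : ℤ) + j + 1 - 2 * j) = j - i - 1 by ring, neg_add _ (1 : ℤ), zpow_add₀ hθ,
    zpow_neg_one, map_inv₀, ← div_div, div_right_comm, div_eq_mul_inv _ (RatFunc.C th)]
  field_simp

theorem negFix_eq (hq : qh ≠ 0) (ht : th ≠ 0)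
    (hgen : ∀ a b : ℤ, (qh ^ 2) ^ a * (th ^ 2) ^ b = 1 → a = 0 ∧ b = 0) (i j : ℕ) :
    negFix hq th (i + j) j = RatFunc.C th ^ (-((i : ℤ) + j + 1)) *
      (RatFunc.C (th ^ 2) ^ i *
      ((1 - RatFunc.C (th ^ 2)) * (RatFunc.C (th ^ 2) * RatFunc.C (qh ^ 2) ^ (i + j + 1) -
        RatFunc.X ^ (-2 : ℤ) * RatFunc.C (qh ^ 2) ^ ((i : ℤ) + 1 - j)) /
        ((1 - RatFunc.C (th ^ 2) * RatFunc.C (qh ^ 2) ^ (i + j + 1)) *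
          (1 - RatFunc.X ^ (-2 : ℤ) * RatFunc.C (qh ^ 2) ^ ((i : ℤ) + 1 - j))) *
      posForm (RatFunc.C (qh ^ 2)) (RatFunc.C (th ^ 2)) (RatFunc.X ^ (-2 : ℤ)) i j)) := by
  have hθ := C_ne_zero ht
  have h := isGeneric_ratFunc hq ht hgen
  have hc : RatFunc.C (raiseConst qh th (i + j + 1)) = (RatFunc.C th)⁻¹ *
      (1 - RatFunc.C (th ^ 2)) / (1 - RatFunc.C (th ^ 2) * RatFunc.C (qh ^ 2) ^ (i + j + 1)) := by
    rw [raiseConst]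
    simp
  have key : RatFunc.C th * (shift (Units.mk0 qh hq) ^ (-((i : ℤ) + j + 1 - 2 * j)))
      (coefB th - RatFunc.C th⁻¹ + RatFunc.C (raiseConst qh th (i + j + 1))) =
      (1 - RatFunc.C (th ^ 2)) * (RatFunc.C (th ^ 2) * RatFunc.C (qh ^ 2) ^ (i + j + 1) -
        RatFunc.X ^ (-2 : ℤ) * RatFunc.C (qh ^ 2) ^ ((i : ℤ) + 1 - j)) /
        ((1 - RatFunc.C (th ^ 2) * RatFunc.C (qh ^ 2) ^ (i + j + 1)) *
          (1 - RatFunc.X ^ (-2 : ℤ) * RatFunc.C (qh ^ 2) ^ ((i : ℤ) + 1 - j))) := by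
    rw [map_add, map_sub, shift_zpow_coefB, shift_zpow_C, shift_zpow_C, hc, map_inv₀,
      show -(-((i : ℤ) + j + 1 - 2 * j)) = i + 1 - j by ring]
    have h1 := h.one_sub_y ((i : ℤ) + 1 - j)
    have h2 := h.one_sub_t (i + j + 1)
    generalize RatFunc.X ^ (-2 : ℤ) * RatFunc.C (qh ^ 2) ^ ((i : ℤ) + 1 - j) = w at *
    generalize RatFunc.C (qh ^ 2) ^ (i + j + 1) = Q at *
    generalize RatFunc.C (th ^ 2) = t at *
    obtain ⟨d, hd⟩ : ∃ d, d = 1 - t * Q := ⟨_, rfl⟩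
    rw [← hd] at h2 ⊢
    field_simp
    rw [hd]
    ring
  rw [negFix, dPos_eq hq ht hgen, ← mul_assoc, Nat.cast_add, key]
  ring

theorem dNeg_rec_zero (hq : qh ≠ 0) (ht : th ≠ 0)
    (hgen : ∀ a b : ℤ, (qh ^ 2) ^ a * (th ^ 2) ^ b = 1 → a = 0 ∧ b = 0) (l : ℕ) :
    dNeg qh th (l + 1) 0 = negReflect hq th l 0 := by
  have h1 := dNeg_eq hq ht hgen (l + 1) 0
  have h2 := negReflect_eq hq ht hgen l 0
  rw [add_zero] at h1 h2
  rw [h1, h2, negForm_zero_right (isGeneric_ratFunc hq ht hgen)]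
  push_cast
  rw [add_zero, add_zero, show (0 : ℤ) - l - 1 = -(l + 1) by ring]

theorem dNeg_rec_last (hq : qh ≠ 0) (ht : th ≠ 0)
    (hgen : ∀ a b : ℤ, (qh ^ 2) ^ a * (th ^ 2) ^ b = 1 → a = 0 ∧ b = 0) (l : ℕ) :
    dNeg qh th (l + 1) (l + 1) = negFix hq th l 0 := by
  have h1 := dNeg_eq hq ht hgen 0 (l + 1)
  have h2 := negFix_eq hq ht hgen l 0
  have h3 := negForm_zero_left (isGeneric_ratFunc hq ht hgen) l
  rw [zero_add] at h1
  rw [add_zero] at h2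
  have e : (l : ℤ) + 1 - (0 : ℕ) = ((l + 1 : ℕ) : ℤ) := by push_cast; ring
  rw [e, zpow_natCast, ← h3] at h2
  rw [h1, h2, mul_pow, pow_succ (RatFunc.C (th ^ 2))]
  push_cast
  rw [zero_add, add_zero]
  ring

/-- In the expansion of `E_{l+1}(X) 1₀`, the term of index `k` has exponent `l + 1 - 2k`. Its
reflected part lands at index `k` of the expansion of `E_{-l-1}(X) 1₀` and its fixed part at index
`l + 1 - k`; for `j + 1` this pairs `j + 1` with `l - j`. -/
theorem dNeg_rec_succ (hq : qh ≠ 0) (ht : th ≠ 0)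
    (hgen : ∀ a b : ℤ, (qh ^ 2) ^ a * (th ^ 2) ^ b = 1 → a = 0 ∧ b = 0) {l j : ℕ} (hj : j < l) :
    dNeg qh th (l + 1) (j + 1) = negReflect hq th l (j + 1) + negFix hq th l (l - j) := by
  obtain ⟨i, rfl⟩ : ∃ i, l = i + (j + 1) := ⟨l - (j + 1), by omega⟩
  have h1 := dNeg_eq hq ht hgen (i + 1) (j + 1)
  have h2 := negFix_eq hq ht hgen j (i + 1)
  have h3 := negForm_succ_succ (isGeneric_ratFunc hq ht hgen) i j
  rw [show i + (j + 1) + 1 = i + 1 + (j + 1) by ring, show i + (j + 1) - j = i + 1 by omega, h1,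
    negReflect_eq hq ht hgen i (j + 1), show i + (j + 1) = j + (i + 1) by ring, h2]
  rw [show j + (i + 1) + 1 = i + j + 2 by ring]
  push_cast
  rw [show (j : ℤ) + 1 - (i + 1) = j - i by ring, show (j : ℤ) + 1 - i - 1 = j - i by ring,
    show -((i : ℤ) + 1 + (j + 1)) = -(i + (j + 1) + 1) by ring,
    show -((j : ℤ) + (i + 1) + 1) = -(i + (j + 1) + 1) by ring, ← mul_add]
  congr 1
  rw [mul_pow, pow_succ (RatFunc.C (th ^ 2))]
  linear_combination (RatFunc.C (th ^ 2) ^ j) * h3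

/-- The contribution of `K(Y)` to the coefficients `K_j`. -/
def symFix (qh th : K) (l j : ℕ) : RatFunc K := dPos qh th l j * coefB th

/-- The contribution of `η_s` to the coefficients `K_j`. -/
def symReflect (hq : qh ≠ 0) (th : K) (l j : ℕ) : RatFunc K :=
  (shift (Units.mk0 qh hq) ^ ((l : ℤ) + 1 - 2 * j)) (coefA th / coefB th) *
    (inversion 1 (dPos qh th l j) * coefB th)

theorem symReflect_eq (hq : qh ≠ 0) (ht : th ≠ 0)
    (hgen : ∀ a b : ℤ, (qh ^ 2) ^ a * (th ^ 2) ^ b = 1 → a = 0 ∧ b = 0) (i j : ℕ) :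
    symReflect hq th (i + j) j = coefB th * (RatFunc.C th ^ (-((i : ℤ) + j + 1)) *
      ((1 - RatFunc.C (th ^ 2) * RatFunc.X ^ (-2 : ℤ) * RatFunc.C (qh ^ 2) ^ ((j : ℤ) - i - 1)) /
        (RatFunc.C (th ^ 2) - RatFunc.X ^ (-2 : ℤ) * RatFunc.C (qh ^ 2) ^ ((j : ℤ) - i - 1)) *
      ((RatFunc.C (qh ^ 2) * RatFunc.C (th ^ 2)) ^ j *
      negForm (RatFunc.C (qh ^ 2)) (RatFunc.C (th ^ 2)) (RatFunc.X ^ (-2 : ℤ)) i j))) := by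
  have hθ := C_ne_zero ht
  have h1 := (isGeneric_ratFunc hq ht hgen).one_sub_y ((j : ℤ) - i - 1)
  rw [symReflect, inversion_dPos hq ht hgen, dNeg_eq hq ht hgen, map_div₀, shift_zpow_coefA,
    shift_zpow_coefB, Nat.cast_add, show -((i : ℤ) + j + 1 - 2 * j) = j - i - 1 by ring,
    div_div_div_cancel_right₀ (mul_ne_zero hθ h1), neg_add _ (1 : ℤ), zpow_add₀ hθ,
    zpow_neg_one, map_inv₀, mul_assoc (RatFunc.C (th ^ 2)) (RatFunc.X ^ (-2 : ℤ))]
  ring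

theorem kCoef_rec_zero (hq : qh ≠ 0) (ht : th ≠ 0)
    (hgen : ∀ a b : ℤ, (qh ^ 2) ^ a * (th ^ 2) ^ b = 1 → a = 0 ∧ b = 0) (l : ℕ) :
    kCoef qh th (l + 1) 0 = symFix qh th l 0 := by
  have h1 := kCoef_eq hq ht hgen (l + 1) 0
  have h2 := dPos_eq hq ht hgen l 0
  have h3 := symForm_zero_right (isGeneric_ratFunc hq ht hgen) l
  rw [add_zero] at h1 h2
  have e : ((l + 1 : ℕ) : ℤ) - (0 : ℕ) = ((l + 1 : ℕ) : ℤ) := by push_cast; ring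
  rw [e, zpow_natCast, h3] at h1
  rw [h1, symFix, h2]
  push_cast
  rw [add_zero, add_zero, add_sub_cancel_right, zpow_natCast]
  ring

theorem kCoef_rec_last (hq : qh ≠ 0) (ht : th ≠ 0)
    (hgen : ∀ a b : ℤ, (qh ^ 2) ^ a * (th ^ 2) ^ b = 1 → a = 0 ∧ b = 0) (l : ℕ) :
    kCoef qh th (l + 1) (l + 1) = symReflect hq th l 0 := by
  have h := isGeneric_ratFunc hq ht hgen
  have h1 := kCoef_eq hq ht hgen 0 (l + 1)
  have h2 := symReflect_eq hq ht hgen l 0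
  have h3 := symForm_zero_left h l
  rw [zero_add] at h1
  rw [add_zero] at h2
  rw [h1, h2]
  push_cast
  rw [show (0 : ℤ) - (l + 1) = -(l + 1) by ring, show (0 : ℤ) - l - 1 = -(l + 1) by ring, h3,
    pow_zero, one_mul, zero_add, add_zero, zpow_neg_one, inv_mul_cancel_left₀ h.t_ne]

/-- Now the exponents `l + 1 - 2k` match the target directly, so the fixed part keeps its index and
the reflected part moves to `l + 1 - k`. -/
theorem kCoef_rec_succ (hq : qh ≠ 0) (ht : th ≠ 0)
    (hgen : ∀ a b : ℤ, (qh ^ 2) ^ a * (th ^ 2) ^ b = 1 → a = 0 ∧ b = 0) {l j : ℕ} (hj : j < l) :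
    kCoef qh th (l + 1) (j + 1) = symFix qh th l (j + 1) + symReflect hq th l (l - j) := by
  obtain ⟨i, rfl⟩ : ∃ i, l = i + (j + 1) := ⟨l - (j + 1), by omega⟩
  have h1 := kCoef_eq hq ht hgen (i + 1) (j + 1)
  have h2 := symReflect_eq hq ht hgen j (i + 1)
  have h3 := symForm_succ_succ (isGeneric_ratFunc hq ht hgen) i j
  have e : ((i + 1 : ℕ) : ℤ) - ((j + 1 : ℕ) : ℤ) = (i : ℤ) - j := by push_cast; ring
  rw [e, h3] at h1
  rw [show i + (j + 1) + 1 = i + 1 + (j + 1) by ring, show i + (j + 1) - j = i + 1 by omega, h1,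
    symFix, dPos_eq hq ht hgen i (j + 1), show i + (j + 1) = j + (i + 1) by ring, h2]
  push_cast
  rw [show (i : ℤ) + 1 - j - 1 = i - j by ring, add_sub_cancel_right, zpow_natCast,
    show -((i : ℤ) + 1 + (j + 1)) = -(i + (j + 1) + 1) by ring,
    show -((j : ℤ) + (i + 1) + 1) = -(i + (j + 1) + 1) by ring, mul_pow,
    pow_succ (RatFunc.C (th ^ 2))]
  ring

end Coefficients

/-! ### The expansions -/

section Expansions

variable {qh th : K}

/-- Encodes `f j = u j + v (l + 1 - j)` on `0 ≤ j ≤ l + 1`, where `u` and `v` stop at `l`; hence the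
end indices receive a single contribution each. -/
theorem sum_eq_sum_add_reflect {M : Type*} [AddCommMonoid M] {f u v : ℕ → M} {l : ℕ}
    (h0 : f 0 = u 0) (hl : f (l + 1) = v 0) (hs : ∀ j < l, f (j + 1) = u (j + 1) + v (l - j)) :
    ∑ j ∈ Finset.range (l + 2), f j =
      ∑ j ∈ Finset.range (l + 1), u j + ∑ j ∈ Finset.range (l + 1), v j := by
  rw [Finset.sum_range_succ, Finset.sum_range_succ' f, h0, hl, Finset.sum_range_succ' u,
    Finset.sum_range_succ' v,
    Finset.sum_congr rfl fun j hj => hs j (Finset.mem_range.1 hj), Finset.sum_add_distrib,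
    ← Finset.sum_range_reflect (fun j => v (j + 1))]
  have : ∑ j ∈ Finset.range l, v (l - j) = ∑ j ∈ Finset.range l, v (l - 1 - j + 1) :=
    Finset.sum_congr rfl fun j hj => by
      rw [Finset.mem_range] at hj
      congr 1
      omega
  rw [this]
  abel

/-- The element `η^k f(Y) 1₀`. -/
def etaTerm (qh th : K) (k : ℤ) (f : RatFunc K) : LocDAHA qh th :=
  etaPow qh th k * funHom qh th f * symmetrizer qh th

theorem etaTerm_add (k : ℤ) (f g : RatFunc K) :
    etaTerm qh th k (f + g) = etaTerm qh th k f + etaTerm qh th k g := by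
  rw [etaTerm, etaTerm, etaTerm, map_add, mul_add, add_mul]

theorem smul_etaTerm (c : K) (k : ℤ) (f : RatFunc K) :
    c • etaTerm qh th k f = etaTerm qh th k (RatFunc.C c * f) := by
  rw [etaTerm, etaTerm, ← RatFunc.algebraMap_eq_C, ← Algebra.smul_def, map_smul, mul_smul_comm,
    smul_mul_assoc]

/-- Since `η_π = η η_s`, the `η_s` left over inverts `Y` in `f` and is then absorbed by `1₀`. -/
theorem etaPi_mul_etaTerm (ht : th ≠ 0) (k : ℤ) (f : RatFunc K) :
    etaPi qh th * etaTerm qh th k f = etaTerm qh th (1 - k) (inversion 1 f) := by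
  rw [etaTerm, etaTerm, ← mul_assoc, ← mul_assoc, etaPi_mul_etaPow ht, mul_assoc _ (etaS qh th),
    etaS_mul_funHom ht, mul_assoc, mul_assoc _ (etaS qh th), etaS_mul_symmetrizer ht, ← mul_assoc]

theorem etaS_mul_etaTerm (ht : th ≠ 0) (k : ℤ) (f : RatFunc K) :
    etaS qh th * etaTerm qh th k f = etaTerm qh th (-k) (inversion 1 f) := by
  rw [etaTerm, etaTerm, ← mul_assoc, ← mul_assoc, etaS_mul_etaPow ht, mul_assoc _ (etaS qh th),
    etaS_mul_funHom ht, mul_assoc, mul_assoc _ (etaS qh th), etaS_mul_symmetrizer ht, ← mul_assoc]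

theorem funHom_mul_etaPow (hq : qh ≠ 0) (ht : th ≠ 0) (k : ℤ) (f : RatFunc K) :
    funHom qh th f * etaPow qh th k =
      etaPow qh th k * funHom qh th ((shift (Units.mk0 qh hq) ^ (-k)) f) := by
  rw [etaPow_mul_funHom hq ht, ← AlgEquiv.mul_apply, ← zpow_add, add_neg_cancel, zpow_zero,
    AlgEquiv.one_apply]

theorem funHom_mul_etaTerm (hq : qh ≠ 0) (ht : th ≠ 0) (k : ℤ) (f g : RatFunc K) :
    funHom qh th f * etaTerm qh th k g =
      etaTerm qh th k ((shift (Units.mk0 qh hq) ^ (-k)) f * g) := by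
  rw [etaTerm, etaTerm, ← mul_assoc, ← mul_assoc, funHom_mul_etaPow hq ht, map_mul]
  simp only [mul_assoc]

theorem evalX_macPos_expansion (hq : qh ≠ 0) (ht : th ≠ 0)
    (hgen : ∀ a b : ℤ, (qh ^ 2) ^ a * (th ^ 2) ^ b = 1 → a = 0 ∧ b = 0) {l : ℕ}
    (h : evalX qh th (macNeg qh th l) * symmetrizer qh th =
      ∑ j ∈ Finset.range (l + 1), etaTerm qh th (-(l : ℤ) + 2 * j) (dNeg qh th l j)) :
    evalX qh th (macPos qh th l) * symmetrizer qh th =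
      ∑ j ∈ Finset.range (l + 1), etaTerm qh th ((l : ℤ) + 1 - 2 * j) (dPos qh th l j) := by
  rw [evalX_macPos ht, h, Finset.mul_sum, Finset.smul_sum]
  refine Finset.sum_congr rfl fun j hj => ?_
  obtain ⟨i, rfl⟩ : ∃ i, l = i + j := ⟨l - j, by rw [Finset.mem_range] at hj; omega⟩
  rw [etaPi_mul_etaTerm ht, smul_etaTerm, ← inversion_C 1, ← map_mul, ← inversion_dPos hq ht hgen,
    inversion_inversion]
  congr 1
  ring

theorem evalX_macNeg_expansion (hq : qh ≠ 0) (ht : th ≠ 0)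
    (hgen : ∀ a b : ℤ, (qh ^ 2) ^ a * (th ^ 2) ^ b = 1 → a = 0 ∧ b = 0) (l : ℕ) :
    evalX qh th (macNeg qh th l) * symmetrizer qh th =
      ∑ j ∈ Finset.range (l + 1), etaTerm qh th (-(l : ℤ) + 2 * j) (dNeg qh th l j) := by
  induction l with
  | zero =>
    have h1 := dNeg_eq hq ht hgen 0 0
    have h2 : dNeg qh th 0 0 = 1 := by
      have h3 := (isGeneric_ratFunc hq ht hgen).qPoch_t 1
      simp only [map_pow] at h3
      simpa [negForm, scalarForm, qPoch_zero, h3] using h1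
    simp [evalX_macNeg_zero, etaTerm, h2, etaPow_zero]
  | succ l ih =>
    rw [evalX_macNeg_succ ht, evalX_macPos_expansion hq ht hgen ih, Finset.mul_sum,
      Finset.smul_sum]
    -- Split `T₁ + c` into `a η_s` and a function of `Y`. In both parts the function then moves to
    -- the right of the power of `η`, which rescales its variable.
    have hterm : ∀ j : ℕ, th • ((intHom qh th (gen qh th Gen.T) +
        algebraMap K _ (raiseConst qh th (l + 1))) *
          etaTerm qh th ((l : ℤ) + 1 - 2 * j) (dPos qh th l j)) =
        etaTerm qh th (-((l : ℤ) + 1 - 2 * j)) (negReflect hq th l j) +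
          etaTerm qh th ((l : ℤ) + 1 - 2 * j) (negFix hq th l j) := by
      intro j
      rw [intHom_T ht, add_assoc, ← funHom_C, ← map_add, add_mul, mul_assoc, etaS_mul_etaTerm ht,
        funHom_mul_etaTerm hq ht, funHom_mul_etaTerm hq ht, smul_add, smul_etaTerm, smul_etaTerm,
        neg_neg, negReflect, negFix]
    rw [Finset.sum_congr rfl fun j _ => hterm j, Finset.sum_add_distrib]
    symm
    refine sum_eq_sum_add_reflect (f := fun j : ℕ => etaTerm qh th (-((l + 1 : ℕ) : ℤ) + 2 * j)
      (dNeg qh th (l + 1) j)) ?_ ?_ fun j hj => ?_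
    · rw [dNeg_rec_zero hq ht hgen]
      congr 1
    · rw [dNeg_rec_last hq ht hgen]
      congr 1
      push_cast
      ring
    · rw [dNeg_rec_succ hq ht hgen hj, etaTerm_add]
      congr 2 <;> push_cast [Nat.cast_sub hj.le] <;> ring

theorem symmetrizer_mul_evalX_expansion (hq : qh ≠ 0) (ht : th ≠ 0)
    (hgen : ∀ a b : ℤ, (qh ^ 2) ^ a * (th ^ 2) ^ b = 1 → a = 0 ∧ b = 0) (l : ℕ) :
    symmetrizer qh th * (evalX qh th (macPos qh th l) * symmetrizer qh th) =
      ∑ j ∈ Finset.range (l + 2), symmetrizer qh th * (etaPow qh th ((l + 1 : ℕ) - 2 * (j : ℤ)) *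
        funHom qh th (kCoef qh th (l + 1) j)) := by
  rw [evalX_macPos_expansion hq ht hgen (evalX_macNeg_expansion hq ht hgen l), Finset.mul_sum]
  have hterm : ∀ j : ℕ,
      symmetrizer qh th * etaTerm qh th ((l : ℤ) + 1 - 2 * j) (dPos qh th l j) =
      symmetrizer qh th * (etaPow qh th ((l : ℤ) + 1 - 2 * j) * funHom qh th (symFix qh th l j)) +
      symmetrizer qh th * (etaPow qh th (-((l : ℤ) + 1 - 2 * j)) *
        funHom qh th (symReflect hq th l j)) := by
    intro j
    generalize hk : (l : ℤ) + 1 - 2 * j = k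
    -- Pull `η_s` from the right-hand `1₀` to the far left, where it meets the left-hand `1₀` and
    -- becomes the function `a/b`.
    have h1 : etaPow qh th k * funHom qh th (dPos qh th l j) *
        (funHom qh th (coefA th) * etaS qh th) = etaS qh th * (etaPow qh th (-k) *
        funHom qh th (inversion 1 (dPos qh th l j) * coefB th)) := by
      rw [← mul_assoc (etaS qh th), etaS_mul_etaPow ht, neg_neg, mul_assoc _ (etaS qh th),
        etaS_mul_funHom ht, map_mul, inversion_inversion, inversion_coefB ht, map_mul]
      simp only [mul_assoc]
    rw [etaTerm]
    nth_rw 2 [symmetrizer_eq ht]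
    rw [mul_add, mul_add, h1, add_comm, ← mul_assoc (symmetrizer qh th) (etaS qh th),
      symmetrizer_mul_etaS ht, mul_assoc (symmetrizer qh th) (funHom qh th _),
      ← mul_assoc (funHom qh th (coefA th / _)), funHom_mul_etaPow hq ht, neg_neg, mul_assoc,
      mul_assoc, ← map_mul, ← map_mul, symFix, symReflect, hk]
  rw [Finset.sum_congr rfl fun j _ => hterm j, Finset.sum_add_distrib]
  symm
  refine sum_eq_sum_add_reflect (f := fun j : ℕ => symmetrizer qh th *
    (etaPow qh th ((l + 1 : ℕ) - 2 * (j : ℤ)) * funHom qh th (kCoef qh th (l + 1) j)))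
    ?_ ?_ fun j hj => ?_
  · rw [kCoef_rec_zero hq ht hgen, Nat.cast_succ]
  · rw [kCoef_rec_last hq ht hgen]
    congr 3
    push_cast
    ring
  · rw [kCoef_rec_succ hq ht hgen hj, map_add, mul_add, mul_add]
    congr 4
    push_cast [Nat.cast_sub hj.le]
    ring

end Expansions

end SL2DAHA

end

/-! ### The theorem: expansions combined with independence -/

theorem theorem5p6 {K : Type*} [Field K] (qh th : K) (hq : qh ≠ 0) (ht : th ≠ 0)
    (hgen : ∀ a b : ℤ, (qh ^ 2) ^ a * (th ^ 2) ^ b = 1 → a = 0 ∧ b = 0) :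
    -- the electronic Macdonald polynomials exist and are determined by their definition
    (∀ m : ℤ, ∃! E : LaurentPolynomial K, SL2DAHA.IsElectronicMacdonald qh th m E) ∧
    -- `η` and `η⁻¹` are mutually inverse
    SL2DAHA.eta qh th * SL2DAHA.etaInv qh th = 1 ∧
    SL2DAHA.etaInv qh th * SL2DAHA.eta qh th = 1 ∧
    ∀ E : ℤ → LaurentPolynomial K, (∀ m, SL2DAHA.IsElectronicMacdonald qh th m (E m)) →
      -- expansion of `E_{l+1}(X) 1₀`, with unique coefficients `D_j^{(l)}(Y)`
      (∀ (l : ℕ) (D : ℕ → RatFunc K),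
        SL2DAHA.evalX qh th (E ((l : ℤ) + 1)) * SL2DAHA.symmetrizer qh th =
            ∑ j ∈ Finset.range (l + 1), SL2DAHA.etaPow qh th ((l : ℤ) + 1 - 2 * j) *
              SL2DAHA.ofFun qh th (D j) * SL2DAHA.symmetrizer qh th ↔
          ∀ j ≤ l, D j = SL2DAHA.dPos qh th l j) ∧
      -- expansion of `E_{-l}(X) 1₀`, with unique coefficients `D_j^{(-l)}(Y)`
      (∀ (l : ℕ) (D : ℕ → RatFunc K),
        SL2DAHA.evalX qh th (E (-(l : ℤ))) * SL2DAHA.symmetrizer qh th =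
            ∑ j ∈ Finset.range (l + 1), SL2DAHA.etaPow qh th (-(l : ℤ) + 2 * j) *
              SL2DAHA.ofFun qh th (D j) * SL2DAHA.symmetrizer qh th ↔
          ∀ j ≤ l, D j = SL2DAHA.dNeg qh th l j) ∧
      -- expansion of `1₀ E_l(X) 1₀`, `l > 0`, with unique coefficients `K_j^{(l)}(Y)`
      (∀ (l : ℕ), 0 < l → ∀ C : ℕ → RatFunc K,
        SL2DAHA.symmetrizer qh th * SL2DAHA.evalX qh th (E (l : ℤ)) *
              SL2DAHA.symmetrizer qh th =
            ∑ j ∈ Finset.range (l + 1), SL2DAHA.symmetrizer qh th *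
              SL2DAHA.etaPow qh th ((l : ℤ) - 2 * j) * SL2DAHA.ofFun qh th (C j) ↔
          ∀ j ≤ l, C j = SL2DAHA.kCoef qh th l j) := by
  -- Genericity with `b = 0`: if `q^(1/2)` were a root of unity, so would be `q`.
  have hroot : ∀ k : ℤ, qh ^ k = 1 → k = 0 := fun k hk =>
    (hgen k 0 (by rw [zpow_zero, mul_one, ← zpow_natCast, ← zpow_mul, mul_comm, zpow_mul, hk,
      one_zpow])).1
  refine ⟨fun m => ⟨SL2DAHA.macdonald qh th m,
    (SL2DAHA.isElectronicMacdonald_iff_eq hq ht hgen m _).2 rfl,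
    fun E hE => (SL2DAHA.isElectronicMacdonald_iff_eq hq ht hgen m E).1 hE⟩,
    SL2DAHA.eta_mul_etaInv ht, SL2DAHA.etaInv_mul_eta ht, fun E hE => ?_⟩
  obtain rfl : E = SL2DAHA.macdonald qh th :=
    funext fun m => (SL2DAHA.isElectronicMacdonald_iff_eq hq ht hgen m _).1 (hE m)
  refine ⟨fun l D => ?_, fun l D => ?_, fun l hl C => ?_⟩
  · have h := SL2DAHA.evalX_macPos_expansion hq ht hgen
      (SL2DAHA.evalX_macNeg_expansion hq ht hgen l)
    rw [SL2DAHA.macdonald_add_one, h]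
    constructor
    · intro hD j hj
      refine SL2DAHA.eq_of_sum_symmetrizer hq ht hroot (Finset.range (l + 1))
        (fun j => (l : ℤ) + 1 - 2 * j) (fun a b hab => by simpa using hab) D _ hD.symm j
        (Finset.mem_range.2 (by omega))
    · intro hD
      refine Finset.sum_congr rfl fun j hj => ?_
      rw [hD j (Nat.lt_succ_iff.1 (Finset.mem_range.1 hj))]
      rfl
  · rw [SL2DAHA.macdonald_neg, SL2DAHA.evalX_macNeg_expansion hq ht hgen l]
    constructor
    · intro hD j hj
      refine SL2DAHA.eq_of_sum_symmetrizer hq ht hroot (Finset.range (l + 1))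
        (fun j => -(l : ℤ) + 2 * j) (fun a b hab => by simpa using hab) D _ hD.symm j
        (Finset.mem_range.2 (by omega))
    · intro hD
      refine Finset.sum_congr rfl fun j hj => ?_
      rw [hD j (Nat.lt_succ_iff.1 (Finset.mem_range.1 hj))]
      rfl
  · obtain ⟨l, rfl⟩ := Nat.exists_eq_succ_of_ne_zero hl.ne'
    have h := SL2DAHA.symmetrizer_mul_evalX_expansion hq ht hgen l
    simp only [← mul_assoc] at h
    rw [show ((l.succ : ℕ) : ℤ) = (l : ℤ) + 1 from rfl, SL2DAHA.macdonald_add_one, h]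
    constructor
    · intro hC j hj
      refine SL2DAHA.eq_of_symmetrizer_sum hq ht hroot (Finset.range (l + 2))
        (fun j => (l : ℤ) + 1 - 2 * j) (fun a b hab => by simpa using hab) C _ hC.symm j
        (Finset.mem_range.2 (by omega))
    · intro hC
      refine Finset.sum_congr rfl fun j hj => ?_
      rw [hC j (Nat.lt_succ_iff.1 (Finset.mem_range.1 hj))]
      rfl
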